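/- All links are oriented. An oriented link $L\subset S^3$ is called a *strong $\mathbb C$-boundary* if there are an algebraic curve $A\subset\mathbb C^2$ (the zero set of a non-constant polynomial) and a smoothly embedded closed $4$-ball $B\subset\mathbb C^2$ such that $A$ is transverse to $\partial B$, the set $A\setminus B$ is connected, and the link $A\cap\partial B$ in the oriented $3$-sphere $\partial B$, endowed with the boundary orientation from $A\cap B$, is $L$ up to isotopy (after identifying $\partial B$ with $S^3$ by an orientation-preserving diffeomorphism); we then say that the pair $(A,B)$ realizes $L$. Let $5_1^2$ be the Whitehead link with the chirality given by the closure of the $3$-braid $(\sigma_1\sigma_2^{-1})^2\sigma_1$, where the convention is that the closure of $\sigma_1^2$ has linking number $+1$. **Proposition 6.3.** The two-component link $5_1^2$ is a strong $\mathbb C$-boundary. Moreover, there is a smoothly embedded closed $4$-ball $B\subset\mathbb C^2$ such that $5_1^2$ is realized by the pair $(A,B)$, where $A$ is the nodal cubic $\{(z,w)\in\mathbb C^2: w^2=z^2+z^3\}$. -/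

import Mathlib

open scoped ContDiff

noncomputable section

namespace FancyBall

/-- The real Euclidean inner product on `ℂ² = ℝ⁴`. -/
def rdot (x y : ℂ × ℂ) : ℝ :=
  x.1.re * y.1.re + x.1.im * y.1.im + x.2.re * y.2.re + x.2.im * y.2.im

/-- The closed unit ball of `ℂ²`, for the Euclidean norm. -/
def D4 : Set (ℂ × ℂ) := {x | rdot x x ≤ 1}

/-- The unit sphere of `ℂ²`, oriented (as always below) as the boundary of the unit ball. -/
def S3 : Set (ℂ × ℂ) := {x | rdot x x = 1}

/-! ### Oriented links in the 3-sphere -/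

/-- An oriented smooth link with `n` components in `S³`: finitely many disjoint, smoothly
embedded circles, each of them given by a regular `2π`-periodic parametrization, which fixes
its orientation. -/
structure OrientedLink (n : ℕ) where
  curve : Fin n → ℝ → ℂ × ℂ
  smooth : ∀ i, ContDiff ℝ ∞ (curve i)
  periodic : ∀ i t, curve i (t + 2 * Real.pi) = curve i t
  regular : ∀ i t, deriv (curve i) t ≠ 0
  embedded : ∀ i j s t, curve i s = curve j t → i = j ∧ ∃ k : ℤ, s = t + k * (2 * Real.pi)
  mem_sphere : ∀ i t, curve i t ∈ S3

/-- The underlying subset of `S³`. -/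
def OrientedLink.support {n : ℕ} (L : OrientedLink n) : Set (ℂ × ℂ) :=
  {x | ∃ i t, L.curve i t = x}

/-- `φ` restricts to a diffeomorphism of `S³`. (A map on `S³` is smooth if and only if it is the
restriction of a smooth map on the whole space.) -/
def IsSphereDiffeo (φ : ℂ × ℂ → ℂ × ℂ) : Prop :=
  ContDiff ℝ ∞ φ ∧ Set.MapsTo φ S3 S3 ∧
    ∃ ψ : ℂ × ℂ → ℂ × ℂ, ContDiff ℝ ∞ ψ ∧ Set.MapsTo ψ S3 S3 ∧ Set.InvOn ψ φ S3 S3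

/-- Two oriented links in `S³` are isotopic: some smooth ambient isotopy `H` of `S³`, from the
identity at time `0`, carries at time `1` the components of the first link to those of the
second one, preserving the orientations. -/
def Isotopic {n : ℕ} (K L : OrientedLink n) : Prop :=
  ∃ H : ℝ → ℂ × ℂ → ℂ × ℂ,
    ContDiff ℝ ∞ (fun q : ℝ × (ℂ × ℂ) => H q.1 q.2) ∧
    (∀ t ∈ Set.Icc (0 : ℝ) 1, IsSphereDiffeo (H t)) ∧
    (∀ x ∈ S3, H 0 x = x) ∧
    ∃ σ : Equiv.Perm (Fin n), ∀ i, ∃ θ : ℝ → ℝ, Continuous θ ∧ StrictMono θ ∧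
      ∀ t, H 1 (K.curve i t) = L.curve (σ i) (θ t)

/-! ### Algebraic curves, smooth balls and `ℂ`-boundaries -/

/-- The set of zeros in `ℂ²` of a polynomial in two variables. -/
def zeroSet (f : MvPolynomial (Fin 2) ℂ) : Set (ℂ × ℂ) :=
  {p | MvPolynomial.eval ![p.1, p.2] f = 0}

/-- The differential of the polynomial `f` at `p`, applied to `v`. Where the differential is not
zero, its kernel is the tangent line of the curve `f = 0`. -/
def dPoly (f : MvPolynomial (Fin 2) ℂ) (p v : ℂ × ℂ) : ℂ :=
  MvPolynomial.eval ![p.1, p.2] (MvPolynomial.pderiv 0 f) * v.1 +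
    MvPolynomial.eval ![p.1, p.2] (MvPolynomial.pderiv 1 f) * v.2

/-- `Φ` restricts to an orientation preserving diffeomorphism from the closed unit ball onto `B`;
so `B` is a smoothly embedded closed 4-ball in `ℂ²`, its boundary is `∂B = Φ(S³)`, and
`Φ : S³ → ∂B` preserves the orientations. (Each 4-ball that is smoothly embedded in `ℂ²` has
such a parametrization: compose with a reflection if the orientation is wrong.) -/
def IsBallParam (Φ : ℂ × ℂ → ℂ × ℂ) (B : Set (ℂ × ℂ)) : Prop :=
  ContDiff ℝ ∞ Φ ∧ Set.InjOn Φ D4 ∧ (∀ x ∈ D4, 0 < (fderiv ℝ Φ x).det) ∧ Φ '' D4 = B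

/-- For `x ∈ S³`: the vector `v` at the point `Φ x` of `∂B` is tangent to `∂B`. -/
def TangentToBoundary (Φ : ℂ × ℂ → ℂ × ℂ) (x v : ℂ × ℂ) : Prop :=
  ∃ ξ, rdot x ξ = 0 ∧ fderiv ℝ Φ x ξ = v

/-- For `x ∈ S³`: the vector `v` at the point `Φ x` of `∂B` points out of `B`. -/
def PointsOutward (Φ : ℂ × ℂ → ℂ × ℂ) (x v : ℂ × ℂ) : Prop :=
  ∃ ξ, 0 < rdot x ξ ∧ fderiv ℝ Φ x ξ = v

/-- The curve `f = 0` is transverse to `∂B = Φ(S³)`: each common point is a smooth point of the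
curve, and the tangent line of the curve is not contained in the tangent space of `∂B` (which
has real codimension one). -/
def TransverseToBoundary (f : MvPolynomial (Fin 2) ℂ) (Φ : ℂ × ℂ → ℂ × ℂ) : Prop :=
  ∀ x ∈ S3, Φ x ∈ zeroSet f →
    (∃ v, dPoly f (Φ x) v ≠ 0) ∧ ∃ v, dPoly f (Φ x) v = 0 ∧ ¬ TangentToBoundary Φ x v

/-- The oriented link `K ⊂ S³` is the pull-back by `Φ` of the oriented link `A ∩ ∂B`, where `A` is
the curve `f = 0` and `A ∩ ∂B` carries the boundary orientation of `A ∩ B`: if `v` is tangent to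
`A` and points out of `B`, and `u` is the velocity of the link, then `(v, u)` is a positive
basis of the complex line tangent to `A`. -/
def IsCutLink (f : MvPolynomial (Fin 2) ℂ) (Φ : ℂ × ℂ → ℂ × ℂ) {n : ℕ}
    (K : OrientedLink n) : Prop :=
  K.support = {x | x ∈ S3 ∧ Φ x ∈ zeroSet f} ∧
    ∀ i t, ∃ v, dPoly f (Φ (K.curve i t)) v = 0 ∧ PointsOutward Φ (K.curve i t) v ∧
      ∃ c : ℂ, 0 < c.im ∧ fderiv ℝ Φ (K.curve i t) (deriv (K.curve i) t) = c • v

/-- The algebraic curve `A = {f = 0}` and the smooth closed 4-ball `B ⊂ ℂ²` realize the oriented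
link `L` as a strong `ℂ`-boundary: `A` is transverse to `∂B`, the oriented link `A ∩ ∂B` in the
oriented 3-sphere `∂B` is `L` up to isotopy, and `A ∖ B` is connected. -/
def RealizesStrongly (f : MvPolynomial (Fin 2) ℂ) (B : Set (ℂ × ℂ)) {n : ℕ}
    (L : OrientedLink n) : Prop :=
  0 < f.totalDegree ∧
  (∃ Φ : ℂ × ℂ → ℂ × ℂ, IsBallParam Φ B ∧ TransverseToBoundary f Φ ∧
    ∃ K : OrientedLink n, IsCutLink f Φ K ∧ Isotopic K L) ∧
  IsConnected (zeroSet f \ B)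

/-- `L` is a strong `ℂ`-boundary. -/
def IsStrongCBoundary {n : ℕ} (L : OrientedLink n) : Prop :=
  ∃ (f : MvPolynomial (Fin 2) ℂ) (B : Set (ℂ × ℂ)), RealizesStrongly f B L

/-- The equation `w² = z² + z³` of the nodal cubic. -/
def nodalCubic : MvPolynomial (Fin 2) ℂ :=
  MvPolynomial.X 1 ^ 2 - MvPolynomial.X 0 ^ 2 - MvPolynomial.X 0 ^ 3

/-! ### The link `5₁²` -/

/-- A 3-strand braid in `ℝ × ℂ`, over the circle. The first strand is `w = 0`; the two others,
`w = whiteheadStrand (s / 2)` and `w = whiteheadStrand (s / 2 + π)` at the angle `s ∈ [0, 2π]`,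
form a single closed curve. Order the strands by `Re w`. Two of them exchange their places at
`s ≈ 1.14, 1.87, 3.14, 4.41, 5.15`; the pairs of places are `12, 23, 12, 23, 12`, and the half-turns
of the difference of the two values of `w` are counterclockwise (`σᵢ`) and clockwise (`σᵢ⁻¹`)
by turns. This is the braid word `σ₁ σ₂⁻¹ σ₁ σ₂⁻¹ σ₁`. -/
def whiteheadStrand (t : ℝ) : ℂ :=
  ⟨Real.cos (2 * t) - Real.cos t / 2, Real.sin (3 * t)⟩

/-- Central projection to `S³` of the point `(exp (i s), w)`. -/
def toSphere (s : ℝ) (w : ℂ) : ℂ × ℂ :=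
  ((Real.sqrt (1 + (w.re ^ 2 + w.im ^ 2)))⁻¹ : ℝ) • ((⟨Real.cos s, Real.sin s⟩ : ℂ), w)

/-- The two parametrized components of the closed braid. -/
def whiteheadCurve (i : Fin 2) (t : ℝ) : ℂ × ℂ :=
  if i = 0 then toSphere t 0 else toSphere (2 * t) (whiteheadStrand t)

theorem toSphere_mem (s : ℝ) (w : ℂ) : toSphere s w ∈ S3 := by
  have h : 0 < 1 + (w.re ^ 2 + w.im ^ 2) := by positivity
  have h1 : (Real.sqrt (1 + (w.re ^ 2 + w.im ^ 2)))⁻¹ ^ 2 * (1 + (w.re ^ 2 + w.im ^ 2)) = 1 := by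
    rw [inv_pow, Real.sq_sqrt h.le, inv_mul_cancel₀ h.ne']
  simp only [S3, rdot, toSphere, Set.mem_ofPred_eq, Prod.smul_mk, Complex.smul_re,
    Complex.smul_im, smul_eq_mul]
  set r := (Real.sqrt (1 + (w.re ^ 2 + w.im ^ 2)))⁻¹
  have := Real.sin_sq_add_cos_sq s
  linear_combination h1 + r ^ 2 * this

theorem toSphere_inj {s t : ℝ} {w z : ℂ} (h : toSphere s w = toSphere t z) :
    (∃ k : ℤ, s = t + k * (2 * Real.pi)) ∧ w = z := by
  have hr : 0 < (Real.sqrt (1 + (w.re ^ 2 + w.im ^ 2)))⁻¹ := by positivity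
  have hq : 0 < (Real.sqrt (1 + (z.re ^ 2 + z.im ^ 2)))⁻¹ := by positivity
  simp only [toSphere] at h
  set r := (Real.sqrt (1 + (w.re ^ 2 + w.im ^ 2)))⁻¹
  set q := (Real.sqrt (1 + (z.re ^ 2 + z.im ^ 2)))⁻¹
  have h1 := congrArg (fun x => x.1.re) h
  have h2 := congrArg (fun x => x.1.im) h
  have h3 := congrArg (fun x => x.2) h
  simp only [Prod.smul_mk, Complex.smul_re, Complex.smul_im, smul_eq_mul] at h1 h2 h3
  have e1 := Real.sin_sq_add_cos_sq s
  have e2 := Real.sin_sq_add_cos_sq t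
  have hsq : r ^ 2 = q ^ 2 := by
    have a1 : (r * Real.cos s) ^ 2 = (q * Real.cos t) ^ 2 := by rw [h1]
    have a2 : (r * Real.sin s) ^ 2 = (q * Real.sin t) ^ 2 := by rw [h2]
    linear_combination a1 + a2 - r ^ 2 * e1 + q ^ 2 * e2
  have hrq : r = q := by
    have := abs_eq_abs.mpr (sq_eq_sq_iff_eq_or_eq_neg.mp hsq)
    rwa [abs_of_pos hr, abs_of_pos hq] at this
  rw [hrq] at h1 h2 h3
  refine ⟨?_, smul_right_injective ℂ hq.ne' h3⟩
  have ha := Real.Angle.cos_sin_inj (mul_left_cancel₀ hq.ne' h1) (mul_left_cancel₀ hq.ne' h2)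
  obtain ⟨k, hk⟩ := Real.Angle.angle_eq_iff_two_pi_dvd_sub.mp ha
  exact ⟨k, by linarith⟩

theorem toSphere_smooth (a : ℝ) {w : ℝ → ℂ} (hw : ContDiff ℝ ∞ w) :
    ContDiff ℝ ∞ (fun t => toSphere (a * t) (w t)) := by
  have hre : ContDiff ℝ ∞ (fun t => (w t).re) := Complex.reCLM.contDiff.comp hw
  have him : ContDiff ℝ ∞ (fun t => (w t).im) := Complex.imCLM.contDiff.comp hw
  have hE : ContDiff ℝ ∞ (fun t : ℝ => (⟨Real.cos (a * t), Real.sin (a * t)⟩ : ℂ)) := by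
    have : (fun t : ℝ => (⟨Real.cos (a * t), Real.sin (a * t)⟩ : ℂ)) =
        fun t => Complex.equivRealProdCLM.symm (Real.cos (a * t), Real.sin (a * t)) := rfl
    rw [this]
    exact Complex.equivRealProdCLM.symm.contDiff.comp (by fun_prop)
  have hpos : ∀ t, 1 + ((w t).re ^ 2 + (w t).im ^ 2) ≠ 0 := fun t => by positivity
  refine ContDiff.smul (ContDiff.inv (ContDiff.sqrt (by fun_prop) hpos) fun t => ?_)
    (hE.prodMk hw)
  have : 0 < 1 + ((w t).re ^ 2 + (w t).im ^ 2) := by positivity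
  exact (Real.sqrt_pos.mpr this).ne'

theorem toSphere_regular {a : ℝ} (ha : a ≠ 0) {w : ℝ → ℂ} (hw : ContDiff ℝ ∞ w) (t : ℝ) :
    deriv (fun t => toSphere (a * t) (w t)) t ≠ 0 := by
  intro h
  have hd := ((toSphere_smooth a hw).differentiable (by simp) t).hasDerivAt
  rw [h] at hd
  have hf : HasDerivAt (fun t => (toSphere (a * t) (w t)).1) 0 t := hd.fst
  have h1 : HasDerivAt (fun t => (toSphere (a * t) (w t)).1.re) 0 t :=
    (Complex.reCLM.hasFDerivAt.comp_hasDerivAt t hf)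
  have h2 : HasDerivAt (fun t => (toSphere (a * t) (w t)).1.im) 0 t :=
    (Complex.imCLM.hasFDerivAt.comp_hasDerivAt t hf)
  have hm : HasDerivAt (fun t : ℝ => a * t) a t := by
    simpa using (hasDerivAt_id t).const_mul a
  have h3 := (h2.mul hm.cos).sub (h1.mul hm.sin)
  have hz : (fun t => (toSphere (a * t) (w t)).1.im) * (fun t => Real.cos (a * t)) -
      (fun t => (toSphere (a * t) (w t)).1.re) * (fun t => Real.sin (a * t)) = fun _ => 0 := by
    funext u
    simp only [toSphere, Prod.smul_mk, Complex.smul_re, Complex.smul_im, smul_eq_mul,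
      Pi.mul_apply, Pi.sub_apply]
    ring
  rw [hz] at h3
  have h4 := h3.unique (hasDerivAt_const t (0 : ℝ))
  have hr : 0 < (Real.sqrt (1 + ((w t).re ^ 2 + (w t).im ^ 2)))⁻¹ := by positivity
  simp only [toSphere, Prod.smul_mk, Complex.smul_re, Complex.smul_im, smul_eq_mul] at h4
  set r := (Real.sqrt (1 + ((w t).re ^ 2 + (w t).im ^ 2)))⁻¹
  have h5 := Real.sin_sq_add_cos_sq (a * t)
  have h6 : r * a = 0 := by linear_combination (-1 : ℝ) * h4 - r * a * h5
  exact (mul_ne_zero hr.ne' ha) h6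

theorem whiteheadStrand_smooth : ContDiff ℝ ∞ whiteheadStrand := by
  have : whiteheadStrand = fun t => Complex.equivRealProdCLM.symm
      (Real.cos (2 * t) - Real.cos t / 2, Real.sin (3 * t)) := rfl
  rw [this]
  exact Complex.equivRealProdCLM.symm.contDiff.comp (by fun_prop)

theorem whiteheadStrand_ne_zero (t : ℝ) : whiteheadStrand t ≠ 0 := by
  intro h
  have h1 := congrArg Complex.re h
  have h2 := congrArg Complex.im h
  simp only [whiteheadStrand, Complex.zero_re, Complex.zero_im, Real.cos_two_mul,
    Real.sin_three_mul] at h1 h2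
  have h3 := Real.sin_sq_add_cos_sq t
  have h4 : Real.sin t * (4 * Real.cos t ^ 2 - 1) = 0 := by
    linear_combination h2 + 4 * Real.sin t * h3
  rcases mul_eq_zero.mp h4 with h5 | h5
  · rw [h5] at h3
    nlinarith
  · nlinarith

theorem whiteheadCurve_zero : whiteheadCurve 0 = fun t => toSphere (1 * t) 0 := by
  funext t
  simp [whiteheadCurve]

theorem whiteheadCurve_one :
    whiteheadCurve 1 = fun t => toSphere (2 * t) (whiteheadStrand t) := by
  funext t
  simp [whiteheadCurve]

/-- The link `5₁²` (the Whitehead link, of the chirality of the closed braid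
`(σ₁ σ₂⁻¹)² σ₁`, where the closure of `σ₁²` has linking number `1`): the closure in `S³` of
the braid `whiteheadStrand`. -/
def link512 : OrientedLink 2 where
  curve := whiteheadCurve
  smooth i := by
    fin_cases i
    · exact whiteheadCurve_zero ▸ toSphere_smooth 1 (w := fun _ => 0) contDiff_const
    · exact whiteheadCurve_one ▸ toSphere_smooth 2 whiteheadStrand_smooth
  periodic i t := by
    have h1 : Real.cos (2 * (t + 2 * Real.pi)) = Real.cos (2 * t) := by
      rw [show 2 * (t + 2 * Real.pi) = 2 * t + (2 : ℕ) * (2 * Real.pi) by push_cast; ring]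
      exact Real.cos_add_nat_mul_two_pi _ _
    have h2 : Real.sin (2 * (t + 2 * Real.pi)) = Real.sin (2 * t) := by
      rw [show 2 * (t + 2 * Real.pi) = 2 * t + (2 : ℕ) * (2 * Real.pi) by push_cast; ring]
      exact Real.sin_add_nat_mul_two_pi _ _
    have h3 : Real.sin (3 * (t + 2 * Real.pi)) = Real.sin (3 * t) := by
      rw [show 3 * (t + 2 * Real.pi) = 3 * t + (3 : ℕ) * (2 * Real.pi) by push_cast; ring]
      exact Real.sin_add_nat_mul_two_pi _ _
    simp only [whiteheadCurve, toSphere, whiteheadStrand, h1, h2, h3, Real.cos_add_two_pi,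
      Real.sin_add_two_pi]
  regular i t := by
    fin_cases i
    · exact whiteheadCurve_zero ▸
        toSphere_regular one_ne_zero (w := fun _ => 0) contDiff_const t
    · exact whiteheadCurve_one ▸ toSphere_regular two_ne_zero whiteheadStrand_smooth t
  embedded i j s t h := by
    fin_cases i <;> fin_cases j <;> simp [whiteheadCurve] at h ⊢
    · exact (toSphere_inj h).1
    · exact whiteheadStrand_ne_zero t (toSphere_inj h).2.symm
    · exact whiteheadStrand_ne_zero s (toSphere_inj h).2
    · obtain ⟨⟨k, hk⟩, hw⟩ := toSphere_inj h
      have hs : s = t + k * Real.pi := by linarith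
      rcases Int.even_or_odd' k with ⟨m, rfl | rfl⟩
      · exact ⟨m, by rw [hs]; push_cast; ring⟩
      · exfalso
        have hs' : s = (t + Real.pi) + m * (2 * Real.pi) := by rw [hs]; push_cast; ring
        have hc : Real.cos s = -Real.cos t := by
          rw [hs', Real.cos_add_int_mul_two_pi, Real.cos_add_pi]
        have hn : Real.sin s = -Real.sin t := by
          rw [hs', Real.sin_add_int_mul_two_pi, Real.sin_add_pi]
        have h1 := congrArg Complex.re hw
        have h2 := congrArg Complex.im hw
        simp only [whiteheadStrand, Real.cos_two_mul, Real.sin_three_mul, hc, hn] at h1 h2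
        have h3 := Real.sin_sq_add_cos_sq t
        have h4 : Real.cos t = 0 := by nlinarith
        rw [h4] at h3
        have h5 : Real.sin t = 0 := by
          linear_combination (1 / 2 : ℝ) * h2 - 4 * Real.sin t * h3
        rw [h5] at h3
        norm_num at h3
  mem_sphere i t := by
    by_cases h : i = 0 <;> simp only [whiteheadCurve, h, if_true, if_false] <;>
      exact toSphere_mem _ _

end FancyBall

end

/-!
The nodal cubic `w² = z² + z³` is the image of the plane under
`s ↦ (-1 - s², -i (s + s³))` (`cubicMap`), which is injective except that `s = i` and `s = -i` both
go to the node. A ball that does the job meets the cubic in the images of two disjoint discs of the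
parameter plane: a small disc around `s = 0`, and a disc in the annulus `1/3 < ‖s‖ < 3` that
contains both `i` and `-i`. The complement of the two discs is connected, and the boundary of
their image is a link of an unknot with a curve that bounds an immersed disc with one double point.

*The ball.* `ballMap` is fibred over the coordinate `ξ = -1 - z = s²`: over each `ξ`, the slice of
the ball is a round disc in the `w`-line, whose centre and radius are given by smooth functions
`alpha` and `beta` of `ξ`. Write `s = ρ e^{iφ}`, `m = ρ²`, `υ = (m - 1) / (m + 1)`. Then
`s + s³ = ρ (1 + m) e^{2iφ} (cos φ + i υ sin φ)`, and the centres are chosen such that a point of the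
annulus is in the ball if and only if `dist2 υ φ ≤ (3/5)²`, where `dist2` is a quadratic polynomial
in `υ`. By completion of the square `dist2` is the sum of the squares of `√W υ + q cos² φ / √W` and
of the function `J φ` (`dist2_eq`). Where `cos φ ≥ -1/5` the function `J` is increasing, and where
`cos φ ≤ -1/5` we are outside the ball; so the boundary curve is given by
`J φ = (3/5) sin t` and `√W υ + q cos² φ / √W = (3/5) cos t` (`exists_knotParam_eq`). Close to
`s = 0` the centres and radii are changed by a cutoff function, such that the disc
`‖s‖ ≤ 1/10` is inside and `1/10 < ‖s‖ ≤ 1/3` is outside (`one_lt_level_inner`).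

*Transversality and orientation* follow from one inequality, `OutwardAt`: turning the velocity of
a boundary curve by `-i` gives a vector that points out of the ball. For the curve in the
annulus this is a computation with the two squares (`hasDerivAt_dist2_upsL`).

*Connectedness.* For fixed `φ` the function `dist2` is convex in `υ`, so each point of the cubic
outside the ball can be moved radially, either out to `‖s‖ ≥ 3` or into the ring
`1/10 < ‖s‖ ≤ 1/3`; these two sets are joined by the negative real axis (`isConnected_outside`).

*The isotopy type.* All links are central projections to the sphere of pairs of curves in
`ℂ² ∖ 0`, and a smooth family of such pairs gives an ambient isotopy, by isotopy extension
(`ambientIsotopic_of_cone_family`). Five families lead from the closed braid to the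
link of the ball (`isotopic_cut_link512`): a path of linear maps; a flattening of the axis to a core
circle; a family (`knotM`) that is linear in polar coordinates and turns the trigonometric
polynomials of the braid into the angle function `phi`; a family (`knotL`) that moves the centres of
the slices; and a small push of the core circle. In the two families of knots, two points on a
common ray must have arguments that are equal or differ by `2π`
(`isConeKnot_of_angle`), so that only two kinds of pairs of points have to be excluded.
-/

noncomputable section

namespace FancyBall

open Set Filter Topology

/-! ### Inverse functions and diffeomorphisms close to the identity -/

/-- A smooth function with positive derivative on an open interval has a smooth inverse there. -/
theorem exists_smooth_inverse {f : ℝ → ℝ} (hf : ContDiff ℝ ∞ f) {a b : ℝ}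
    (hpos : ∀ t ∈ Ioo a b, 0 < deriv f t) :
    ∃ g : ℝ → ℝ, IsOpen (f '' Ioo a b) ∧ ContDiffOn ℝ ∞ g (f '' Ioo a b) ∧
      ∀ t ∈ Ioo a b, g (f t) = t := by
  have hmono : StrictMonoOn f (Ioo a b) :=
    strictMonoOn_of_deriv_pos (convex_Ioo a b) hf.continuous.continuousOn
      (by simpa only [interior_Ioo] using hpos)
  set g := Function.invFunOn f (Ioo a b)
  have hg : ∀ t ∈ Ioo a b, g (f t) = t := fun t ht =>
    hmono.injOn (Function.invFunOn_mem ⟨t, ht, rfl⟩) ht (Function.invFunOn_eq ⟨t, ht, rfl⟩)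
  have key : ∀ t ∈ Ioo a b, f '' Ioo a b ∈ 𝓝 (f t) ∧ ContDiffAt ℝ ∞ g (f t) := by
    intro t ht
    have hd : HasFDerivAt f (ContinuousLinearEquiv.unitsEquivAut ℝ
        (Units.mk0 (deriv f t) (hpos t ht).ne') : ℝ →L[ℝ] ℝ) t := by
      have := (hf.differentiable (by simp) t).hasDerivAt.hasFDerivAt
      convert! this using 1
    have hs := hf.contDiffAt.hasStrictFDerivAt' (x := t) hd (by simp)
    have hc := hf.contDiffAt.to_localInverse (a := t) hd (by simp)
    have h0 := hf.contDiffAt.localInverse_apply_image (a := t) hd (by simp)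
    have hr := hs.eventually_right_inverse
    have hmem : ∀ᶠ y in 𝓝 (f t), hf.contDiffAt.localInverse hd (by simp) y ∈ Ioo a b := by
      refine hc.continuousAt.eventually_mem ?_
      rw [h0]
      exact isOpen_Ioo.mem_nhds ht
    refine ⟨?_, hc.congr_of_eventuallyEq ?_⟩
    · filter_upwards [hr, hmem] with y h1 h2
      exact ⟨_, h2, h1⟩
    · filter_upwards [hr, hmem] with y h1 h2
      have := hg _ h2
      change f (hf.contDiffAt.localInverse hd (by simp) y) = y at h1
      rwa [h1] at this
  refine ⟨g, isOpen_iff_mem_nhds.2 ?_, ?_, hg⟩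
  · rintro _ ⟨t, ht, rfl⟩
    exact (key t ht).1
  · rintro _ ⟨t, ht, rfl⟩
    exact (key t ht).2.contDiffWithinAt

section NearIdentity

variable {E : Type*} [NormedAddCommGroup E] [NormedSpace ℝ E] [CompleteSpace E]

/-- A smooth perturbation of the identity by a map with small derivative is a diffeomorphism. -/
theorem exists_inverse_id_add {f : E → E} (hf : ContDiff ℝ ∞ f)
    (hb : ∀ x, ‖fderiv ℝ f x‖ ≤ 1 / 2) :
    ∃ ψ : E → E, ContDiff ℝ ∞ ψ ∧ (∀ x, ψ (x + f x) = x) ∧ ∀ x, ψ x + f (ψ x) = x := by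
  have hlip : LipschitzWith (1 / 2) f := by
    refine lipschitzWith_of_nnnorm_fderiv_le (𝕜 := ℝ) (hf.differentiable (by simp)) fun x => ?_
    have := hb x
    rw [← NNReal.coe_le_coe]
    simpa using this
  have happ : ApproximatesLinearOn (fun x => x + f x)
      ((ContinuousLinearEquiv.refl ℝ E : E ≃L[ℝ] E) : E →L[ℝ] E) univ (1 / 2 : NNReal) := by
    intro x _ y _
    have : x + f x - (y + f y) - ((ContinuousLinearEquiv.refl ℝ E : E ≃L[ℝ] E) : E →L[ℝ] E) (x - y)
        = f x - f y := by
      simp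
      abel
    rw [this]
    simpa [dist_eq_norm] using hlip.dist_le_mul x y
  have hc : Subsingleton E ∨ (1 / 2 : NNReal) <
      ‖((ContinuousLinearEquiv.refl ℝ E).symm : E →L[ℝ] E)‖₊⁻¹ := by
    rcases subsingleton_or_nontrivial E with h | h
    · exact Or.inl h
    · right
      have : ((ContinuousLinearEquiv.refl ℝ E).symm : E →L[ℝ] E) = ContinuousLinearMap.id ℝ E := rfl
      rw [this, ContinuousLinearMap.nnnorm_id]
      rw [← NNReal.coe_lt_coe]
      norm_num
  let h := happ.toHomeomorph _ hc
  have hcoe : ∀ x, h x = x + f x := fun x => rfl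
  have hinv : ∀ x, ∃ A : E ≃L[ℝ] E, (A : E →L[ℝ] E) = ContinuousLinearMap.id ℝ E + fderiv ℝ f x := by
    intro x
    have hlt : ‖-fderiv ℝ f x‖ < 1 := by
      rw [norm_neg]
      linarith [hb x]
    refine ⟨ContinuousLinearEquiv.unitsEquiv ℝ E (Units.oneSub (-fderiv ℝ f x) hlt), ?_⟩
    ext v
    change (1 - -fderiv ℝ f x) v = _
    simp
  choose A hA using hinv
  refine ⟨h.symm, h.contDiff_symm (f₀' := A) (fun x => ?_) ?_, fun x => ?_, fun x => ?_⟩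
  · rw [hA]
    exact (hasFDerivAt_id x).add (hf.differentiable (by simp) x).hasFDerivAt
  · exact contDiff_id.add hf
  · rw [← hcoe]; exact h.symm_apply_apply x
  · rw [← hcoe]; exact h.apply_symm_apply x

/-- A smooth family `R l`, supported in a fixed compact set and vanishing at `l = l₀`, gives
diffeomorphisms `x ↦ x + R l x` for `l` close to `l₀`. -/
theorem eventually_exists_inverse_id_add {R : ℝ × E → E} {C : Set E} (hC : IsCompact C) {l₀ : ℝ}
    (h0 : ∀ x, R (l₀, x) = 0) (hsupp : ∀ l, ∀ x ∉ C, R (l, x) = 0)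
    (hs : ∀ x ∈ C, ∀ᶠ p in 𝓝 (l₀, x), ContDiffAt ℝ ∞ R p) :
    ∀ᶠ l in 𝓝 l₀, (∀ x, ContDiffAt ℝ ∞ R (l, x)) ∧
      ∃ ψ : E → E, ContDiff ℝ ∞ ψ ∧ (∀ x, ψ (x + R (l, x)) = x) ∧ ∀ x, ψ x + R (l, ψ x) = x := by
  have hout : ∀ l, ∀ x ∉ C, ContDiffAt ℝ ∞ R (l, x) := by
    intro l x hx
    refine (contDiffAt_const (c := (0 : E))).congr_of_eventuallyEq ?_
    have : ∀ᶠ p : ℝ × E in 𝓝 (l, x), p.2 ∈ Cᶜ :=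
      continuousAt_snd.eventually_mem (hC.isClosed.isOpen_compl.mem_nhds hx)
    filter_upwards [this] with p hp
    exact hsupp p.1 p.2 hp
  have h1 : ∀ᶠ l in 𝓝 l₀, ∀ x ∈ C, ContDiffAt ℝ ∞ R (l, x) ∧
      ‖(fderiv ℝ R (l, x)).comp (ContinuousLinearMap.inr ℝ ℝ E)‖ < 1 / 2 := by
    refine hC.eventually_forall_of_forall_eventually
      (P := fun l x => ContDiffAt ℝ ∞ R (l, x) ∧
        ‖(fderiv ℝ R (l, x)).comp (ContinuousLinearMap.inr ℝ ℝ E)‖ < 1 / 2) fun x hx => ?_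
    have hc : ContDiffAt ℝ ∞ R (l₀, x) := (hs x hx).self_of_nhds
    have hcont : ContinuousAt (fun p => (fderiv ℝ R p).comp (ContinuousLinearMap.inr ℝ ℝ E))
        (l₀, x) :=
      (hc.fderiv_right (m := 0) (by simp)).continuousAt.clm_comp continuousAt_const
    have hz : (fderiv ℝ R (l₀, x)).comp (ContinuousLinearMap.inr ℝ ℝ E) = 0 := by
      have h2 : HasFDerivAt (fun y : E => (l₀, y)) (ContinuousLinearMap.inr ℝ ℝ E) x :=
        hasFDerivAt_prodMk_right l₀ x
      have h3 := ((hc.differentiableAt (by simp)).hasFDerivAt.comp x h2)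
      have h4 : R ∘ (fun y : E => (l₀, y)) = fun _ => 0 := funext h0
      rw [h4] at h3
      exact h3.unique (hasFDerivAt_const 0 x)
    have hlt : ∀ᶠ p in 𝓝 (l₀, x),
        ‖(fderiv ℝ R p).comp (ContinuousLinearMap.inr ℝ ℝ E)‖ < 1 / 2 := by
      refine hcont.norm.eventually_lt_const ?_
      change ‖(fderiv ℝ R (l₀, x)).comp (ContinuousLinearMap.inr ℝ ℝ E)‖ < 1 / 2
      rw [hz]
      norm_num
    filter_upwards [hs x hx, hlt] with p hp1 hp2 using ⟨hp1, hp2⟩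
  filter_upwards [h1] with l hl
  have hsm : ∀ x, ContDiffAt ℝ ∞ R (l, x) := fun x => by
    by_cases hx : x ∈ C
    · exact (hl x hx).1
    · exact hout l x hx
  refine ⟨hsm, exists_inverse_id_add (f := fun x => R (l, x)) ?_ fun x => ?_⟩
  · rw [contDiff_iff_contDiffAt]
    intro x
    exact (hsm x).comp x (contDiffAt_const.prodMk contDiffAt_id)
  · have h2 : HasFDerivAt (fun y : E => (l, y)) (ContinuousLinearMap.inr ℝ ℝ E) x :=
      hasFDerivAt_prodMk_right l x
    have h3 := (((hsm x).differentiableAt (by simp)).hasFDerivAt.comp x h2).fderiv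
    by_cases hx : x ∈ C
    · have := (hl x hx).2
      rw [← h3] at this
      exact this.le
    · have h4 : (fun y => R (l, y)) =ᶠ[𝓝 x] fun _ => 0 := by
        filter_upwards [hC.isClosed.isOpen_compl.mem_nhds hx] with y hy using hsupp l y hy
      rw [h4.fderiv_eq]
      simp

end NearIdentity

/-! ### Ambient isotopies of links in the 3-sphere -/

variable {n : ℕ}

/-- A stronger form of `Isotopic`: the ambient isotopy carries each component to the one with the
same index, parametrization included. This is clearly an equivalence relation. -/
def AmbientIsotopic (K L : OrientedLink n) : Prop :=
  ∃ H : ℝ → ℂ × ℂ → ℂ × ℂ,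
    ContDiff ℝ ∞ (fun q : ℝ × (ℂ × ℂ) => H q.1 q.2) ∧ (∀ t, IsSphereDiffeo (H t)) ∧
    (∀ x ∈ S3, H 0 x = x) ∧ ∀ i t, H 1 (K.curve i t) = L.curve i t

theorem AmbientIsotopic.isotopic {K L : OrientedLink n} (h : AmbientIsotopic K L) :
    Isotopic K L := by
  obtain ⟨H, h1, h2, h3, h4⟩ := h
  exact ⟨H, h1, fun t _ => h2 t, h3, Equiv.refl _, fun i => ⟨id, continuous_id, strictMono_id, h4 i⟩⟩

theorem IsSphereDiffeo.comp {f g : ℂ × ℂ → ℂ × ℂ} (hf : IsSphereDiffeo f)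
    (hg : IsSphereDiffeo g) : IsSphereDiffeo (f ∘ g) := by
  obtain ⟨h1, h2, f', h3, h4, h5⟩ := hf
  obtain ⟨k1, k2, g', k3, k4, k5⟩ := hg
  exact ⟨h1.comp k1, h2.comp k2, g' ∘ f', k3.comp h3, k4.comp h4, k5.comp h5 k2 h4⟩

theorem AmbientIsotopic.trans {K L M : OrientedLink n} (h : AmbientIsotopic K L)
    (k : AmbientIsotopic L M) : AmbientIsotopic K M := by
  obtain ⟨H, h1, h2, h3, h4⟩ := h
  obtain ⟨G, k1, k2, k3, k4⟩ := k
  refine ⟨fun t x => G t (H t x), k1.comp (contDiff_fst.prodMk h1), fun t => (k2 t).comp (h2 t),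
    fun x hx => ?_, fun i t => ?_⟩
  · change G 0 (H 0 x) = x
    rw [h3 x hx, k3 x hx]
  · change G 1 (H 1 _) = _
    rw [h4, k4]

theorem AmbientIsotopic.symm {K L : OrientedLink n} (h : AmbientIsotopic K L) :
    AmbientIsotopic L K := by
  obtain ⟨H, h1, h2, h3, h4⟩ := h
  obtain ⟨-, m1, ψ, k1, k2, k3⟩ := h2 1
  have hψ : IsSphereDiffeo ψ := ⟨k1, k2, H 1, (h2 1).1, m1, k3.symm⟩
  have h5 : ContDiff ℝ ∞ (fun q : ℝ × (ℂ × ℂ) => (1 - q.1, ψ q.2)) :=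
    (contDiff_const.sub contDiff_fst).prodMk (k1.comp contDiff_snd)
  refine ⟨fun t x => H (1 - t) (ψ x), h1.comp h5,
    fun t => (h2 (1 - t)).comp hψ, fun x hx => ?_, fun i t => ?_⟩
  · change H (1 - 0) (ψ x) = x
    rw [sub_zero]
    exact k3.2 hx
  · change H (1 - 1) (ψ _) = _
    rw [sub_self, ← h4, k3.1 (K.mem_sphere i t), h3 _ (K.mem_sphere i t)]

theorem OrientedLink.curve_add_int_mul (L : OrientedLink n) (i : Fin n) (t : ℝ) (k : ℤ) :
    L.curve i (t + k * (2 * Real.pi)) = L.curve i t :=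
  (show Function.Periodic (L.curve i) (2 * Real.pi) from L.periodic i).int_mul k t

theorem contDiff_rdot : ContDiff ℝ ∞ (fun p : (ℂ × ℂ) × (ℂ × ℂ) => rdot p.1 p.2) := by
  have h1 : ContDiff ℝ ∞ (fun z : ℂ => z.re) := Complex.reCLM.contDiff
  have h2 : ContDiff ℝ ∞ (fun z : ℂ => z.im) := Complex.imCLM.contDiff
  unfold rdot
  fun_prop

theorem rdot_self_pos {x : ℂ × ℂ} (hx : x ≠ 0) : 0 < rdot x x := by
  by_contra h
  apply hx
  unfold rdot at h
  have e1 : x.1.re = 0 := by nlinarith [sq_nonneg x.1.re, sq_nonneg x.1.im, sq_nonneg x.2.re, sq_nonneg x.2.im]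
  have e2 : x.1.im = 0 := by nlinarith [sq_nonneg x.1.re, sq_nonneg x.1.im, sq_nonneg x.2.re, sq_nonneg x.2.im]
  have e3 : x.2.re = 0 := by nlinarith [sq_nonneg x.1.re, sq_nonneg x.1.im, sq_nonneg x.2.re, sq_nonneg x.2.im]
  have e4 : x.2.im = 0 := by nlinarith [sq_nonneg x.1.re, sq_nonneg x.1.im, sq_nonneg x.2.re, sq_nonneg x.2.im]
  exact Prod.ext (Complex.ext e1 e2) (Complex.ext e3 e4)

/-- Near each of its points a link has a smooth parameter, defined on an open subset of the space. -/
theorem OrientedLink.exists_local_parameter (L : OrientedLink n) (i : Fin n) (t₀ : ℝ) :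
    ∃ τ : ℂ × ℂ → ℝ, ∃ U ∈ 𝓝 (L.curve i t₀), ContDiffOn ℝ ∞ τ U ∧
      ∀ j t, L.curve j t ∈ U → j = i ∧ L.curve i (τ (L.curve j t)) = L.curve j t := by
  set c := L.curve i with hc
  set v := deriv c t₀ with hv
  have hcs : ContDiff ℝ ∞ c := L.smooth i
  set ℓ : ℂ × ℂ → ℝ := fun x => rdot (x - c t₀) v with hℓ
  have hℓs : ContDiff ℝ ∞ ℓ :=
    contDiff_rdot.comp ((contDiff_id.sub contDiff_const).prodMk contDiff_const)
  set g : ℝ → ℝ := fun t => ℓ (c t) with hg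
  have hgs : ContDiff ℝ ∞ g := hℓs.comp hcs
  have hg' : deriv g t₀ = rdot v v := by
    have hd := (hcs.differentiable (by simp) t₀).hasDerivAt
    have h1 : HasDerivAt (fun t => (c t).1.re) v.1.re t₀ :=
      (Complex.reCLM.hasFDerivAt.comp_hasDerivAt t₀ hd.fst)
    have h2 : HasDerivAt (fun t => (c t).1.im) v.1.im t₀ :=
      (Complex.imCLM.hasFDerivAt.comp_hasDerivAt t₀ hd.fst)
    have h3 : HasDerivAt (fun t => (c t).2.re) v.2.re t₀ :=
      (Complex.reCLM.hasFDerivAt.comp_hasDerivAt t₀ hd.snd)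
    have h4 : HasDerivAt (fun t => (c t).2.im) v.2.im t₀ :=
      (Complex.imCLM.hasFDerivAt.comp_hasDerivAt t₀ hd.snd)
    exact (((((h1.sub_const _).mul_const v.1.re).add ((h2.sub_const _).mul_const v.1.im)).add
      ((h3.sub_const _).mul_const v.2.re)).add ((h4.sub_const _).mul_const v.2.im)).deriv
  have hpos : 0 < deriv g t₀ := by
    rw [hg']
    exact rdot_self_pos (L.regular i t₀)
  have hev : ∀ᶠ t in 𝓝 t₀, 0 < deriv g t :=
    (hgs.continuous_deriv (by simp)).continuousAt.eventually_const_lt hpos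
  obtain ⟨ε, hε, hball⟩ := Metric.eventually_nhds_iff.1 hev
  set δ := min ε Real.pi with hδ
  have hδ0 : 0 < δ := lt_min hε Real.pi_pos
  obtain ⟨gi, hV, hgi, hinv⟩ := exists_smooth_inverse hgs (a := t₀ - δ) (b := t₀ + δ)
    (fun t ht => hball (by
      rw [Real.dist_eq, abs_lt]
      have := min_le_left ε Real.pi
      constructor <;> linarith [ht.1, ht.2]))
  set I := Ioo (t₀ - δ) (t₀ + δ)
  have ht₀ : t₀ ∈ I := ⟨by linarith, by linarith⟩
  set C : Set (ℂ × ℂ) := ⋃ j : Fin n, L.curve j ''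
    (Icc (t₀ - Real.pi) (t₀ + Real.pi) \ if j = i then I else ∅) with hC
  have hCc : IsCompact C := by
    refine isCompact_iUnion fun j => IsCompact.image ?_ (L.smooth j).continuous
    refine isCompact_Icc.diff ?_
    split_ifs
    · exact isOpen_Ioo
    · exact isOpen_empty
  have hnot : c t₀ ∉ C := by
    intro h
    simp only [hC, mem_iUnion, mem_image] at h
    obtain ⟨j, t, ⟨ht, hn⟩, he⟩ := h
    obtain ⟨rfl, k, hk⟩ := L.embedded j i t t₀ he
    rw [if_pos rfl] at hn
    have hπ := Real.pi_pos
    have hk0 : k = 0 := by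
      have h1 : (-1 : ℝ) < k := by
        by_contra hh
        push Not at hh
        have : (k : ℝ) * (2 * Real.pi) ≤ -1 * (2 * Real.pi) :=
          mul_le_mul_of_nonneg_right hh (by positivity)
        linarith [ht.1]
      have h2 : (k : ℝ) < 1 := by
        by_contra hh
        push Not at hh
        have : 1 * (2 * Real.pi) ≤ (k : ℝ) * (2 * Real.pi) :=
          mul_le_mul_of_nonneg_right hh (by positivity)
        linarith [ht.2]
      have h1' : (-1 : ℤ) < k := by exact_mod_cast h1
      have h2' : k < (1 : ℤ) := by exact_mod_cast h2
      omega
    rw [hk0] at hk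
    apply hn
    rw [hk]
    simpa using ht₀
  refine ⟨gi ∘ ℓ, ℓ ⁻¹' (g '' I) ∩ Cᶜ, ?_, ?_, ?_⟩
  · exact inter_mem ((hV.preimage hℓs.continuous).mem_nhds ⟨t₀, ht₀, rfl⟩)
      (hCc.isClosed.isOpen_compl.mem_nhds hnot)
  · exact hgi.comp hℓs.contDiffOn fun x hx => hx.1
  · intro j t ht
    set k := toIcoDiv Real.two_pi_pos (t₀ - Real.pi) t with hk
    set t' := toIcoMod Real.two_pi_pos (t₀ - Real.pi) t with ht'
    have hmem := toIcoMod_mem_Ico Real.two_pi_pos (t₀ - Real.pi) t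
    have heq : t = t' + k * (2 * Real.pi) := by
      have := toIcoMod_add_toIcoDiv_zsmul Real.two_pi_pos (t₀ - Real.pi) t
      rw [zsmul_eq_mul] at this
      exact this.symm
    have hcur : L.curve j t = L.curve j t' := by
      rw [heq, L.curve_add_int_mul]
    have hmem' : t' ∈ Icc (t₀ - Real.pi) (t₀ + Real.pi) :=
      ⟨hmem.1, by have := hmem.2.le; linarith⟩
    rw [hcur] at ht ⊢
    have hji : j = i ∧ t' ∈ I := by
      by_contra hcon
      apply ht.2
      refine mem_iUnion.2 ⟨j, t', ⟨hmem', ?_⟩, rfl⟩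
      by_cases hj : j = i
      · rw [if_pos hj]
        exact fun h => hcon ⟨hj, h⟩
      · rw [if_neg hj]
        exact fun h => h
    obtain ⟨rfl, hI⟩ := hji
    refine ⟨rfl, ?_⟩
    have : gi (ℓ (L.curve j t')) = t' := hinv t' hI
    simp only [Function.comp, this, hc]

theorem OrientedLink.isCompact_support (L : OrientedLink n) : IsCompact L.support := by
  have : L.support = ⋃ j : Fin n, L.curve j '' Icc 0 (2 * Real.pi) := by
    ext x
    simp only [support, mem_iUnion, mem_image]
    constructor
    · rintro ⟨i, t, rfl⟩
      have hmem := toIcoMod_mem_Ico Real.two_pi_pos 0 t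
      refine ⟨i, toIcoMod Real.two_pi_pos 0 t, ⟨hmem.1, by simpa using hmem.2.le⟩, ?_⟩
      have := toIcoMod_add_toIcoDiv_zsmul Real.two_pi_pos 0 t
      rw [zsmul_eq_mul] at this
      rw [← L.curve_add_int_mul i _ (toIcoDiv Real.two_pi_pos 0 t), this]
    · rintro ⟨i, t, -, rfl⟩
      exact ⟨i, t, rfl⟩
  rw [this]
  exact isCompact_iUnion fun j => isCompact_Icc.image (L.smooth j).continuous

/-- The displacement of a smooth family of links extends to a smooth function on the space. -/
theorem exists_displacement {γ : ℝ → OrientedLink n}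
    (hγ : ∀ i, ContDiff ℝ ∞ (fun p : ℝ × ℝ => (γ p.1).curve i p.2)) (l₀ : ℝ) :
    ∃ D : ℝ × (ℂ × ℂ) → ℂ × ℂ, ContDiff ℝ ∞ D ∧
      ∀ l i t, D (l, (γ l₀).curve i t) = (γ l).curve i t - (γ l₀).curve i t := by
  set S : ℝ × (ℂ × ℂ) → Set (ℂ × ℂ) := fun p =>
    {y | ∀ i t, (γ l₀).curve i t = p.2 → y = (γ p.1).curve i t - (γ l₀).curve i t} with hS
  have hconv : ∀ p, Convex ℝ (S p) := by
    intro p y hy z hz a b _ _ hab i t h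
    rw [hy i t h, hz i t h, ← add_smul, hab, one_smul]
  obtain ⟨D, hD⟩ := exists_contMDiffMap_forall_mem_convex_of_local (n := ⊤)
    (modelWithCornersSelf ℝ (ℝ × (ℂ × ℂ))) (t := S) hconv (by
      rintro ⟨l, x⟩
      by_cases hx : x ∈ (γ l₀).support
      · obtain ⟨i, t, rfl⟩ := hx
        obtain ⟨τ, U, hU, hτ, hUc⟩ := (γ l₀).exists_local_parameter i t
        refine ⟨univ ×ˢ U, prod_mem_nhds univ_mem hU,
          fun p => (γ p.1).curve i (τ p.2) - (γ l₀).curve i (τ p.2), ?_, ?_⟩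
        · rw [contMDiffOn_iff_contDiffOn]
          have h1 : ContDiffOn ℝ ∞ (fun p : ℝ × (ℂ × ℂ) => τ p.2) (univ ×ˢ U) :=
            hτ.comp contDiffOn_snd fun p hp => hp.2
          exact ((hγ i).comp_contDiffOn (contDiffOn_fst.prodMk h1)).sub
            (((γ l₀).smooth i).comp_contDiffOn h1)
        · rintro ⟨l', y⟩ ⟨-, hy⟩ j s rfl
          obtain ⟨rfl, hs⟩ := hUc j s hy
          obtain ⟨-, k, hk⟩ := (γ l₀).embedded _ _ _ _ hs
          change (γ l').curve j (τ ((γ l₀).curve j s)) - (γ l₀).curve j (τ ((γ l₀).curve j s)) = _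
          rw [hs, hk, OrientedLink.curve_add_int_mul]
      · refine ⟨univ ×ˢ (γ l₀).supportᶜ, prod_mem_nhds univ_mem
          ((γ l₀).isCompact_support.isClosed.isOpen_compl.mem_nhds hx), fun _ => 0,
          contMDiffOn_const, ?_⟩
        rintro ⟨l', y⟩ ⟨-, hy⟩ j s h
        exact absurd ⟨j, s, h⟩ hy)
  refine ⟨D, contMDiff_iff_contDiff.1 D.contMDiff, fun l i t => hD (l, _) i t rfl⟩

theorem contDiff_rdot_self : ContDiff ℝ ∞ (fun x : ℂ × ℂ => rdot x x) :=
  contDiff_rdot.comp (contDiff_id.prodMk contDiff_id)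

theorem rdot_smul_self (a : ℝ) (x : ℂ × ℂ) : rdot (a • x) (a • x) = a ^ 2 * rdot x x := by
  simp only [rdot, Prod.smul_fst, Prod.smul_snd, Complex.smul_re, Complex.smul_im, smul_eq_mul]
  ring

theorem isCompact_rdot_le (r : ℝ) : IsCompact {x : ℂ × ℂ | rdot x x ≤ r} := by
  refine Metric.isCompact_of_isClosed_isBounded
    (isClosed_le contDiff_rdot_self.continuous continuous_const) ?_
  refine (Metric.isBounded_iff_subset_closedBall 0).2 ⟨√r, fun x hx => ?_⟩
  have hx' : rdot x x ≤ r := hx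
  have e : rdot x x = ‖x.1‖ ^ 2 + ‖x.2‖ ^ 2 := by
    rw [← Complex.normSq_eq_norm_sq, ← Complex.normSq_eq_norm_sq, Complex.normSq_apply,
      Complex.normSq_apply, rdot]
    ring
  rw [mem_closedBall_zero_iff, Prod.norm_def]
  refine max_le ?_ ?_ <;> apply Real.le_sqrt_of_sq_le <;>
    nlinarith [sq_nonneg ‖x.1‖, sq_nonneg ‖x.2‖]

/-- Isotopy extension for short times. The displacement of the family extends to the space; cut off
near the sphere and corrected by a rescaling that preserves the norm, it gives maps of the sphere
that are close to the identity, hence diffeomorphisms. -/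
theorem eventually_ambientIsotopic {γ : ℝ → OrientedLink n}
    (hγ : ∀ i, ContDiff ℝ ∞ (fun p : ℝ × ℝ => (γ p.1).curve i p.2)) (l₀ : ℝ) :
    ∀ᶠ l in 𝓝 l₀, AmbientIsotopic (γ l₀) (γ l) := by
  obtain ⟨D₀, hD₀, hDγ⟩ := exists_displacement hγ l₀
  let χ : ContDiffBump (1 : ℝ) := ⟨1 / 4, 1 / 2, by norm_num, by norm_num⟩
  let b : ContDiffBump (0 : ℝ) := ⟨1 / 8, 1 / 4, by norm_num, by norm_num⟩
  have hχ0 : ∀ y, χ y ≠ 0 → 1 / 2 < y ∧ y < 3 / 2 := by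
    intro y hy
    have : y ∈ Function.support χ := hy
    rw [χ.support_eq, Metric.mem_ball, Real.dist_eq, abs_lt] at this
    change -(1 / 2) < y - 1 ∧ y - 1 < 1 / 2 at this
    constructor <;> linarith [this.1, this.2]
  have hχ1 : χ 1 = 1 := χ.one_of_mem_closedBall (by simp [χ])
  have hb0 : ∀ y, 1 / 2 < y → b y = 0 := by
    intro y hy
    apply b.zero_of_le_dist
    rw [Real.dist_eq, sub_zero, abs_of_pos (by linarith)]
    change 1 / 4 ≤ y
    linarith
  have hb1 : b 0 = 1 := b.one_of_mem_closedBall (by simp [b])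
  set D : ℝ × (ℂ × ℂ) → ℂ × ℂ := fun p => χ (rdot p.2 p.2) • (D₀ p - D₀ (l₀, p.2)) with hD
  have hDs : ContDiff ℝ ∞ D := by
    refine ContDiff.smul (χ.contDiff.comp (contDiff_rdot_self.comp contDiff_snd)) ?_
    exact hD₀.sub (hD₀.comp (contDiff_const.prodMk contDiff_snd))
  have hD0 : ∀ x, D (l₀, x) = 0 := fun x => by simp [hD]
  have hDout : ∀ l x, χ (rdot x x) = 0 → D (l, x) = 0 := fun l x h => by simp [hD, h]
  set N : ℂ × ℂ → ℝ := fun x => rdot x x + b (rdot x x) with hN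
  have hNs : ContDiff ℝ ∞ N := contDiff_rdot_self.add (b.contDiff.comp contDiff_rdot_self)
  have hNpos : ∀ x, 0 < N x := by
    intro x
    by_cases hx : x = 0
    · subst hx
      have : rdot 0 0 = 0 := by simp [rdot]
      simp only [hN, this, hb1]
      norm_num
    · exact add_pos_of_pos_of_nonneg (rdot_self_pos hx) b.nonneg
  set M : ℝ × (ℂ × ℂ) → ℝ := fun p => rdot (p.2 + D p) (p.2 + D p) + b (rdot p.2 p.2) with hM
  have hMs : ContDiff ℝ ∞ M :=
    (contDiff_rdot_self.comp (contDiff_snd.add hDs)).add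
      (b.contDiff.comp (contDiff_rdot_self.comp contDiff_snd))
  have hMN : ∀ l x, D (l, x) = 0 → M (l, x) = N x := fun l x h => by simp [hM, hN, h]
  set F : ℝ × (ℂ × ℂ) → ℂ × ℂ := fun p => √(N p.2 / M p) • (p.2 + D p) with hF
  have hFid : ∀ l x, D (l, x) = 0 → F (l, x) = x := by
    intro l x h
    simp only [hF, hMN l x h, h, div_self (hNpos x).ne', Real.sqrt_one, one_smul, add_zero]
  have hFs : ∀ p, 0 < M p → ContDiffAt ℝ ∞ F p := by
    intro p hp
    have h1 : ContDiffAt ℝ ∞ (fun p : ℝ × (ℂ × ℂ) => √(N p.2 / M p)) p :=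
      ContDiffAt.sqrt ((hNs.comp contDiff_snd).contDiffAt.div hMs.contDiffAt hp.ne')
        (div_pos (hNpos _) hp).ne'
    exact h1.smul (contDiff_snd.add hDs).contDiffAt
  set C : Set (ℂ × ℂ) := {x | rdot x x ≤ 3 / 2} with hC
  have hCc : IsCompact C := isCompact_rdot_le _
  have hCχ : ∀ x ∉ C, χ (rdot x x) = 0 := by
    intro x hx
    by_contra h
    exact hx (hχ0 _ h).2.le
  have hMev : ∀ᶠ l in 𝓝 l₀, ∀ x ∈ C, 0 < M (l, x) := by
    refine hCc.eventually_forall_of_forall_eventually (P := fun l x => 0 < M (l, x))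
      fun x _ => hMs.continuous.continuousAt.eventually_const_lt ?_
    rw [hMN l₀ x (hD0 x)]
    exact hNpos x
  have hdiff := eventually_exists_inverse_id_add (R := fun p => F p - p.2) hCc (l₀ := l₀)
    (fun x => by simp [hFid l₀ x (hD0 x)])
    (fun l x hx => by simp [hFid l x (hDout l x (hCχ x hx))])
    (fun x _ => by
      have h1 : ∀ᶠ p in 𝓝 (l₀, x), 0 < M p := by
        refine hMs.continuous.continuousAt.eventually_const_lt ?_
        rw [hMN l₀ x (hD0 x)]
        exact hNpos x
      filter_upwards [h1] with p hp using (hFs p hp).sub contDiff_snd.contDiffAt)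
  obtain ⟨ε, hε, hball⟩ := Metric.eventually_nhds_iff.1 (hdiff.and hMev)
  have hpres : ∀ l, dist l l₀ < ε → ∀ x, rdot (F (l, x)) (F (l, x)) = rdot x x := by
    intro l hl x
    by_cases hx : χ (rdot x x) = 0
    · rw [hFid l x (hDout l x hx)]
    · have h1 := hχ0 _ hx
      have hM0 : 0 < M (l, x) := (hball hl).2 x h1.2.le
      have h2 : N x = rdot x x := by simp only [hN, hb0 _ h1.1, add_zero]
      have h3 : M (l, x) = rdot (x + D (l, x)) (x + D (l, x)) := by
        simp only [hM, hb0 _ h1.1, add_zero]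
      simp only [hF]
      rw [rdot_smul_self, Real.sq_sqrt (div_pos (hNpos _) hM0).le, ← h3, h2,
        div_mul_cancel₀ _ hM0.ne']
  refine Metric.eventually_nhds_iff.2 ⟨ε, hε, fun l hl => ?_⟩
  set T : ℝ → ℝ := fun t => l₀ + Real.smoothTransition t * (l - l₀) with hT
  have hTs : ContDiff ℝ ∞ T :=
    contDiff_const.add (Real.smoothTransition.contDiff.mul contDiff_const)
  have hTε : ∀ t, dist (T t) l₀ < ε := by
    intro t
    refine lt_of_le_of_lt ?_ hl
    simp only [hT, Real.dist_eq, add_sub_cancel_left, abs_mul]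
    rw [abs_of_nonneg (Real.smoothTransition.nonneg t)]
    exact mul_le_of_le_one_left (abs_nonneg _) (Real.smoothTransition.le_one t)
  have hR : ∀ t x, ContDiffAt ℝ ∞ F (T t, x) := by
    intro t x
    have := ((hball (hTε t)).1.1 x).add (contDiff_snd (E := ℝ) (F := ℂ × ℂ)).contDiffAt
    refine this.congr_of_eventuallyEq (Eventually.of_forall fun p => ?_)
    simp
  refine ⟨fun t x => F (T t, x), ?_, fun t => ?_, fun x _ => ?_, fun i t => ?_⟩
  · rw [contDiff_iff_contDiffAt]
    intro q
    exact (hR q.1 q.2).comp q ((hTs.comp contDiff_fst).prodMk contDiff_snd).contDiffAt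
  · obtain ⟨ψ, h1, h2, h3⟩ := (hball (hTε t)).1.2
    simp only [add_sub_cancel] at h2 h3
    refine ⟨?_, fun x hx => ?_, ψ, h1, fun x hx => ?_, fun x _ => h2 x, fun x _ => h3 x⟩
    · rw [contDiff_iff_contDiffAt]
      intro x
      exact (hR t x).comp x (contDiff_const.prodMk contDiff_id).contDiffAt
    · exact (hpres _ (hTε t) x).trans hx
    · have := hpres _ (hTε t) (ψ x)
      rw [h3] at this
      exact this.symm.trans hx
  · have : T 0 = l₀ := by simp [hT]
    change F (T 0, x) = x
    rw [this, hFid l₀ x (hD0 x)]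
  · have h1 : T 1 = l := by simp [hT]
    change F (T 1, (γ l₀).curve i t) = _
    have hm : rdot ((γ l₀).curve i t) ((γ l₀).curve i t) = 1 := (γ l₀).mem_sphere i t
    have hm' : rdot ((γ l).curve i t) ((γ l).curve i t) = 1 := (γ l).mem_sphere i t
    have h2 : (γ l₀).curve i t + D (l, (γ l₀).curve i t) = (γ l).curve i t := by
      simp only [hD, hm, hχ1, one_smul, hDγ]
      simp
    have h3 : N ((γ l₀).curve i t) = 1 := by simp only [hN, hm, hb0 1 (by norm_num), add_zero]
    have h4 : M (l, (γ l₀).curve i t) = 1 := by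
      simp only [hM, h2, hm', hm, hb0 1 (by norm_num), add_zero]
    rw [h1]
    simp only [hF, h2, h3, h4, div_one, Real.sqrt_one, one_smul]

/-- Isotopy extension: a smooth family of links is carried along by an ambient isotopy. -/
theorem ambientIsotopic_of_family {γ : ℝ → OrientedLink n}
    (hγ : ∀ i, ContDiff ℝ ∞ (fun p : ℝ × ℝ => (γ p.1).curve i p.2)) (a b : ℝ) :
    AmbientIsotopic (γ a) (γ b) :=
  isPreconnected_univ.induction₂ (fun l m => AmbientIsotopic (γ l) (γ m))
    (fun l _ => by simpa only [nhdsWithin_univ] using eventually_ambientIsotopic hγ l)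
    (fun _ _ _ _ _ _ h k => h.trans k) (fun _ _ _ _ h => h.symm) (mem_univ a) (mem_univ b)

/-! ### Links in the sphere from cones -/

/-- A closed regular curve in `ℂ² ∖ 0` whose central projection to the sphere is an embedding. -/
structure IsConeKnot (c : ℝ → ℂ × ℂ) : Prop where
  smooth : ContDiff ℝ ∞ c
  periodic : ∀ t, c (t + 2 * Real.pi) = c t
  ne_zero : ∀ t, c t ≠ 0
  regular : ∀ t (r : ℝ), deriv c t ≠ r • c t
  embedded : ∀ s t (k : ℝ), 0 < k → c s = k • c t → ∃ m : ℤ, s = t + m * (2 * Real.pi)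

/-- Two closed curves in `ℂ² ∖ 0` whose central projections form a link in the sphere. -/
structure IsConeLink (c : Fin 2 → ℝ → ℂ × ℂ) : Prop where
  knot : ∀ i, IsConeKnot (c i)
  disjoint : ∀ s t (k : ℝ), 0 < k → c 0 s ≠ k • c 1 t

theorem IsConeLink.embedded {c : Fin 2 → ℝ → ℂ × ℂ} (h : IsConeLink c) (i j : Fin 2) (s t k : ℝ)
    (hk : 0 < k) (he : c i s = k • c j t) : i = j ∧ ∃ m : ℤ, s = t + m * (2 * Real.pi) := by
  have h10 : c 1 s ≠ k • c 0 t := by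
    intro h1
    apply h.disjoint t s k⁻¹ (inv_pos.2 hk)
    rw [h1, smul_smul, inv_mul_cancel₀ hk.ne', one_smul]
  fin_cases i <;> fin_cases j
  · exact ⟨rfl, (h.knot 0).embedded s t k hk he⟩
  · exact absurd he (h.disjoint s t k hk)
  · exact absurd he h10
  · exact ⟨rfl, (h.knot 1).embedded s t k hk he⟩

/-- Central projection to the unit sphere. -/
def normalize (x : ℂ × ℂ) : ℂ × ℂ := (√(rdot x x))⁻¹ • x

theorem normalize_mem {x : ℂ × ℂ} (hx : x ≠ 0) : normalize x ∈ S3 := by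
  have h := rdot_self_pos hx
  change rdot _ _ = 1
  rw [normalize, rdot_smul_self, inv_pow, Real.sq_sqrt h.le, inv_mul_cancel₀ h.ne']

theorem normalize_of_mem {x : ℂ × ℂ} (hx : x ∈ S3) : normalize x = x := by
  have h : rdot x x = 1 := hx
  rw [normalize, h, Real.sqrt_one, inv_one, one_smul]

theorem normalize_smul {k : ℝ} (hk : 0 < k) (x : ℂ × ℂ) : normalize (k • x) = normalize x := by
  rw [normalize, normalize, rdot_smul_self, Real.sqrt_mul (sq_nonneg k), Real.sqrt_sq hk.le,
    smul_smul, mul_inv, mul_right_comm, inv_mul_cancel₀ hk.ne', one_mul]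

theorem contDiffAt_normalize {x : ℂ × ℂ} (hx : x ≠ 0) : ContDiffAt ℝ ∞ normalize x := by
  have h := rdot_self_pos hx
  refine ContDiffAt.smul (f := fun x => (√(rdot x x))⁻¹) ?_ contDiffAt_id
  exact (contDiff_rdot_self.contDiffAt.sqrt h.ne').inv (Real.sqrt_pos.2 h).ne'

/-- The link in the sphere that is the central projection of `c`. -/
def IsConeLink.toLink {c : Fin 2 → ℝ → ℂ × ℂ} (h : IsConeLink c) : OrientedLink 2 where
  curve i t := normalize (c i t)
  smooth i := by
    rw [contDiff_iff_contDiffAt]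
    intro t
    exact (contDiffAt_normalize ((h.knot i).ne_zero t)).comp t (h.knot i).smooth.contDiffAt
  periodic i t := by rw [(h.knot i).periodic]
  regular i t h0 := by
    have hn := rdot_self_pos ((h.knot i).ne_zero t)
    have hc := ((h.knot i).smooth.differentiable (by simp) t).hasDerivAt
    have hf : DifferentiableAt ℝ (fun t => (√(rdot (c i t) (c i t)))⁻¹) t := by
      refine ContDiffAt.differentiableAt (n := ∞) ?_ (by simp)
      have h1 : ContDiff ℝ ∞ (fun t => rdot (c i t) (c i t)) :=
        contDiff_rdot_self.comp (h.knot i).smooth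
      exact (h1.contDiffAt.sqrt hn.ne').inv (Real.sqrt_pos.2 hn).ne'
    have h2 := (hf.hasDerivAt.smul hc).deriv
    change deriv (fun t => (√(rdot (c i t) (c i t)))⁻¹ • c i t) t = 0 at h0
    change deriv (fun t => (√(rdot (c i t) (c i t)))⁻¹ • c i t) t = _ at h2
    rw [h0] at h2
    set a := (√(rdot (c i t) (c i t)))⁻¹ with ha
    have ha0 : a ≠ 0 := (inv_pos.2 (Real.sqrt_pos.2 hn)).ne'
    set b := deriv (fun t => (√(rdot (c i t) (c i t)))⁻¹) t
    apply (h.knot i).regular t (-(a⁻¹ * b))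
    have h3 : a • deriv (c i) t = -(b • c i t) := eq_neg_of_add_eq_zero_left h2.symm
    calc deriv (c i) t = a⁻¹ • (a • deriv (c i) t) := by
          rw [smul_smul, inv_mul_cancel₀ ha0, one_smul]
      _ = _ := by rw [h3, smul_neg, smul_smul, neg_smul]
  embedded i j s t he := by
    have hs := Real.sqrt_pos.2 (rdot_self_pos ((h.knot i).ne_zero s))
    have ht := Real.sqrt_pos.2 (rdot_self_pos ((h.knot j).ne_zero t))
    refine h.embedded i j s t (√(rdot (c i s) (c i s)) * (√(rdot (c j t) (c j t)))⁻¹)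
      (by positivity) ?_
    simp only [normalize] at he
    rw [mul_smul, ← he, smul_smul, mul_inv_cancel₀ hs.ne', one_smul]
  mem_sphere i t := normalize_mem ((h.knot i).ne_zero t)

theorem OrientedLink.ext_curve {n : ℕ} {K L : OrientedLink n} (h : ∀ i t, K.curve i t = L.curve i t) :
    K = L := by
  cases K
  cases L
  congr
  funext i t
  exact h i t

/-- Positive factors, constant or not, do not change the link in the sphere. -/
theorem IsConeLink.toLink_congr {c d : Fin 2 → ℝ → ℂ × ℂ} (hc : IsConeLink c) (hd : IsConeLink d)
    (h : ∀ i t, ∃ k : ℝ, 0 < k ∧ c i t = k • d i t) : hc.toLink = hd.toLink := by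
  refine OrientedLink.ext_curve fun i t => ?_
  obtain ⟨k, hk, he⟩ := h i t
  change normalize (c i t) = normalize (d i t)
  rw [he, normalize_smul hk]

theorem OrientedLink.isConeLink (L : OrientedLink 2) : IsConeLink L.curve := by
  have hk : ∀ i j s t (k : ℝ), 0 < k → L.curve i s = k • L.curve j t →
      L.curve i s = L.curve j t := by
    intro i j s t k hk he
    rw [← normalize_of_mem (L.mem_sphere i s), he, normalize_smul hk,
      normalize_of_mem (L.mem_sphere j t)]
  refine ⟨fun i => ⟨L.smooth i, L.periodic i, fun t h => ?_, fun t r h => ?_,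
    fun s t k hk0 he => (L.embedded i i s t (hk _ _ _ _ _ hk0 he)).2⟩, fun s t k hk0 he => ?_⟩
  · have h1 : rdot _ _ = 1 := L.mem_sphere i t
    rw [h] at h1
    simp [rdot] at h1
  · have hd := ((L.smooth i).differentiable (by simp) t).hasDerivAt
    have h1 : HasDerivAt (fun t => (L.curve i t).1.re) _ t :=
      (Complex.reCLM.hasFDerivAt.comp_hasDerivAt t hd.fst)
    have h2 : HasDerivAt (fun t => (L.curve i t).1.im) _ t :=
      (Complex.imCLM.hasFDerivAt.comp_hasDerivAt t hd.fst)
    have h3 : HasDerivAt (fun t => (L.curve i t).2.re) _ t :=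
      (Complex.reCLM.hasFDerivAt.comp_hasDerivAt t hd.snd)
    have h4 : HasDerivAt (fun t => (L.curve i t).2.im) _ t :=
      (Complex.imCLM.hasFDerivAt.comp_hasDerivAt t hd.snd)
    have h5 := ((((h1.mul h1).add (h2.mul h2)).add (h3.mul h3)).add (h4.mul h4))
    have h6 := h5.unique ((hasDerivAt_const t (1 : ℝ)).congr_of_eventuallyEq
      (Eventually.of_forall fun s => L.mem_sphere i s))
    have h7 : rdot _ _ = 1 := L.mem_sphere i t
    have hr : r = 0 := by
      rw [h] at h6
      simp only [Complex.reCLM_apply, Complex.imCLM_apply, Prod.smul_fst, Prod.smul_snd,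
        Complex.smul_re, Complex.smul_im, smul_eq_mul] at h6
      simp only [rdot] at h7
      linear_combination (1 / 2 : ℝ) * h6 - r * h7
    rw [hr, zero_smul] at h
    exact L.regular i t h
  · exact absurd (L.embedded 0 1 s t (hk _ _ _ _ _ hk0 he)).1 (by decide)

theorem OrientedLink.toLink_isConeLink (L : OrientedLink 2) : L.isConeLink.toLink = L :=
  OrientedLink.ext_curve fun i t => normalize_of_mem (L.mem_sphere i t)

/-- A smooth family of pairs of curves that project to links gives an ambient isotopy. Time is
reparametrized by `Real.smoothTransition`, so that the family need be defined on `[0, 1]` only. -/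
theorem ambientIsotopic_of_cone_family {c : ℝ → Fin 2 → ℝ → ℂ × ℂ}
    (h : ∀ l ∈ Icc (0 : ℝ) 1, IsConeLink (c l))
    (hs : ∀ i, ∀ l ∈ Icc (0 : ℝ) 1, ∀ t, ContDiffAt ℝ ∞ (fun p : ℝ × ℝ => c p.1 i p.2) (l, t))
    (h0 : IsConeLink (c 0)) (h1 : IsConeLink (c 1)) : AmbientIsotopic h0.toLink h1.toLink := by
  have hT : ∀ l, Real.smoothTransition l ∈ Icc (0 : ℝ) 1 := fun l =>
    ⟨Real.smoothTransition.nonneg l, Real.smoothTransition.le_one l⟩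
  set γ : ℝ → OrientedLink 2 := fun l => (h _ (hT l)).toLink
  have hγ := ambientIsotopic_of_family (γ := γ) (fun i => by
    rw [contDiff_iff_contDiffAt]
    rintro ⟨l, t⟩
    have e : ContDiffAt ℝ ∞ (fun p : ℝ × ℝ => (Real.smoothTransition p.1, p.2)) (l, t) :=
      ((Real.smoothTransition.contDiff.comp contDiff_fst).prodMk contDiff_snd).contDiffAt
    have e1 : ContDiffAt ℝ ∞ (fun p : ℝ × ℝ => c (Real.smoothTransition p.1) i p.2) (l, t) :=
      ContDiffAt.comp (g := fun p : ℝ × ℝ => c p.1 i p.2) (l, t) (hs i _ (hT l) t) e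
    exact (contDiffAt_normalize (((h _ (hT l)).knot i).ne_zero t)).comp (l, t) e1) 0 1
  have e0 : γ 0 = h0.toLink := OrientedLink.ext_curve fun i t => by
    change normalize (c (Real.smoothTransition 0) i t) = normalize (c 0 i t)
    rw [Real.smoothTransition.zero]
  have e1 : γ 1 = h1.toLink := OrientedLink.ext_curve fun i t => by
    change normalize (c (Real.smoothTransition 1) i t) = normalize (c 1 i t)
    rw [Real.smoothTransition.one]
  rwa [e0, e1] at hγ

theorem IsConeKnot.map {c : ℝ → ℂ × ℂ} (h : IsConeKnot c) (A : (ℂ × ℂ) →L[ℝ] (ℂ × ℂ))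
    (hA : Function.Injective A) : IsConeKnot (fun t => A (c t)) := by
  refine ⟨A.contDiff.comp h.smooth, fun t => by rw [h.periodic], fun t h0 => h.ne_zero t
    (hA (by rw [h0, map_zero])), fun t r hr => h.regular t r (hA ?_), fun s t k hk he =>
    h.embedded s t k hk (hA (by rw [he, map_smul]))⟩
  have := (A.hasFDerivAt.comp_hasDerivAt t (h.smooth.differentiable (by simp) t).hasDerivAt).deriv
  change deriv (fun t => A (c t)) t = _ at this
  rw [← this, hr, map_smul]

theorem IsConeLink.map {c : Fin 2 → ℝ → ℂ × ℂ} (h : IsConeLink c) (A : (ℂ × ℂ) →L[ℝ] (ℂ × ℂ))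
    (hA : Function.Injective A) : IsConeLink (fun i t => A (c i t)) :=
  ⟨fun i => (h.knot i).map A hA, fun s t k hk he => h.disjoint s t k hk
    (hA (by rw [he, map_smul]))⟩

theorem exp_mul_I_eq_smul {s t k : ℝ} (hk : 0 < k)
    (h : Complex.exp (s * Complex.I) = k • Complex.exp (t * Complex.I)) :
    k = 1 ∧ ∃ m : ℤ, s = t + m * (2 * Real.pi) := by
  have h1 := congrArg norm h
  rw [norm_smul, Complex.norm_exp_ofReal_mul_I, Complex.norm_exp_ofReal_mul_I, mul_one,
    Real.norm_of_nonneg hk.le] at h1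
  refine ⟨h1.symm, ?_⟩
  rw [← h1, one_smul, Complex.exp_eq_exp_iff_exists_int] at h
  obtain ⟨m, hm⟩ := h
  refine ⟨m, ?_⟩
  have := congrArg Complex.im hm
  simpa using this

/-- A curve whose second coordinate runs once around a circle. -/
theorem isConeKnot_of_snd {c : ℝ → ℂ × ℂ} (hs : ContDiff ℝ ∞ c)
    (hp : ∀ t, c (t + 2 * Real.pi) = c t) {a : ℂ} (ha : a ≠ 0)
    (h2 : ∀ t, (c t).2 = a * Complex.exp (t * Complex.I)) : IsConeKnot c := by
  refine ⟨hs, hp, fun t h0 => ?_, fun t r hr => ?_, fun s t k hk he => ?_⟩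
  · have := h2 t
    rw [h0] at this
    exact mul_ne_zero ha (Complex.exp_ne_zero _) this.symm
  · have hd : HasDerivAt (fun t => (c t).2) (r • c t).2 t := by
      rw [← hr]
      exact ((hs.differentiable (by simp) t).hasDerivAt).snd
    have h3 : HasDerivAt (fun t : ℝ => a * Complex.exp (t * Complex.I))
        (a * (Complex.exp (t * Complex.I) * (1 * Complex.I))) t :=
      (((Complex.ofRealCLM.hasDerivAt (x := t)).mul_const Complex.I).cexp).const_mul a
    have h4 : (fun t => (c t).2) = fun t : ℝ => a * Complex.exp (t * Complex.I) := funext h2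
    have h5 := hd.unique (h4 ▸ h3)
    rw [Prod.smul_snd, h2, Complex.real_smul] at h5
    have h6 : a * Complex.exp (t * Complex.I) * (r - Complex.I) = 0 := by
      linear_combination h5
    rcases mul_eq_zero.1 h6 with h7 | h7
    · exact mul_ne_zero ha (Complex.exp_ne_zero _) h7
    · have := congrArg Complex.im h7
      simp at this
  · have h3 := congrArg Prod.snd he
    rw [Prod.smul_snd, h2, h2] at h3
    refine (exp_mul_I_eq_smul hk (mul_left_cancel₀ ha ?_)).2
    rw [h3, mul_smul_comm]

/-! ### The angular function of the boundary curve -/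

/-- The distance along the real axis, at `υ = 0`, from the centre of a slice of the ball to the
cubic, as a function of `x = cos φ`; it is the polynomial `13/25 - x + x²/2`. -/
def qf (x : ℝ) : ℝ := (1 - x) ^ 2 / 2 + 1 / 50

/-- The leading coefficient `cos⁴ φ + sin² φ` of `dist2`, as a quadratic polynomial in `υ`, written in
terms of `x = cos φ`. -/
def Wf (x : ℝ) : ℝ := 1 - x ^ 2 + x ^ 4

theorem qf_pos (x : ℝ) : 0 < qf x := by unfold qf; positivity

theorem Wf_ge (x : ℝ) : 3 / 4 ≤ Wf x := by
  unfold Wf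
  nlinarith [sq_nonneg (x ^ 2 - 1 / 2)]

theorem Wf_pos (x : ℝ) : 0 < Wf x := by linarith [Wf_ge x]

theorem sqrt_Wf_pos (x : ℝ) : 0 < √(Wf x) := Real.sqrt_pos.2 (Wf_pos x)

theorem sq_sqrt_Wf (x : ℝ) : √(Wf x) ^ 2 = Wf x := Real.sq_sqrt (Wf_pos x).le

theorem contDiff_qf : ContDiff ℝ ∞ qf := by unfold qf; fun_prop

theorem contDiff_Wf : ContDiff ℝ ∞ Wf := by unfold Wf; fun_prop

theorem contDiff_sqrt_Wf : ContDiff ℝ ∞ (fun x => √(Wf x)) :=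
  contDiff_Wf.sqrt fun x => (Wf_pos x).ne'

/-- The distance from the point of angle `φ` on the cubic to the centre of its slice of the ball,
minimized over `υ`, with the sign of `φ`. -/
def Jf (φ : ℝ) : ℝ := qf (Real.cos φ) * Real.sin φ / √(Wf (Real.cos φ))

theorem contDiff_Jf : ContDiff ℝ ∞ Jf :=
  ((contDiff_qf.comp Real.contDiff_cos).mul Real.contDiff_sin).div
    (contDiff_sqrt_Wf.comp Real.contDiff_cos) fun _ => (sqrt_Wf_pos _).ne'

theorem Jf_neg (φ : ℝ) : Jf (-φ) = -Jf φ := by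
  simp only [Jf, Real.cos_neg, Real.sin_neg]
  ring

theorem hasDerivAt_Jf (φ : ℝ) : HasDerivAt Jf
    ((qf (Real.cos φ) * Real.cos φ ^ 3 * (2 - Real.cos φ ^ 2) +
      (1 - Real.cos φ) * (1 - Real.cos φ ^ 2) * Wf (Real.cos φ)) /
        (√(Wf (Real.cos φ)) * Wf (Real.cos φ))) φ := by
  have hc := Real.hasDerivAt_cos φ
  have hs := Real.hasDerivAt_sin φ
  have hq : HasDerivAt (fun φ => qf (Real.cos φ)) ((1 - Real.cos φ) * Real.sin φ) φ := by
    have := ((((hasDerivAt_const φ (1 : ℝ)).sub hc).pow 2).div_const 2).add_const (1 / 50)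
    refine this.congr_deriv ?_
    simp
    ring
  have hW : HasDerivAt (fun φ => Wf (Real.cos φ))
      (Real.sin φ * (2 * Real.cos φ - 4 * Real.cos φ ^ 3)) φ := by
    have := ((hasDerivAt_const φ (1 : ℝ)).sub (hc.pow 2)).add (hc.pow 4)
    refine this.congr_deriv ?_
    simp
    ring
  have hR := hW.sqrt (Wf_pos _).ne'
  have hqs : HasDerivAt (fun φ => qf (Real.cos φ) * Real.sin φ)
      ((1 - Real.cos φ) * Real.sin φ * Real.sin φ + qf (Real.cos φ) * Real.cos φ) φ := hq.mul hs
  have h : HasDerivAt Jf _ φ := hqs.div hR (sqrt_Wf_pos _).ne'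
  refine h.congr_deriv ?_
  have h1 := sq_sqrt_Wf (Real.cos φ)
  have h2 := (sqrt_Wf_pos (Real.cos φ)).ne'
  have h3 := (Wf_pos (Real.cos φ)).ne'
  have h4 := Real.sin_sq_add_cos_sq φ
  set w := √(Wf (Real.cos φ))
  rw [← h1]
  field_simp
  have h5 : w ^ 2 = 1 - Real.cos φ ^ 2 + Real.cos φ ^ 4 := by rw [h1, Wf]
  have h6 : Real.sin φ ^ 2 = 1 - Real.cos φ ^ 2 := by linarith
  rw [h6, h5]
  ring

/-- The numerator of the derivative of `Jf` is positive if `cos φ ≥ -1/5`. -/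
theorem derivJ_num_pos {x : ℝ} (h1 : -(1 / 5) ≤ x) (h2 : x ≤ 1) :
    0 < qf x * x ^ 3 * (2 - x ^ 2) + (1 - x) * (1 - x ^ 2) * Wf x := by
  have hq := qf_pos x
  have hW := Wf_ge x
  rcases le_or_gt 0 x with h | h
  · have hx2 : x ^ 2 ≤ 1 := by nlinarith
    have a1 : 0 ≤ (1 - x) * (1 - x ^ 2) * Wf x :=
      mul_nonneg (mul_nonneg (by linarith) (by linarith)) (by linarith)
    rcases h.eq_or_lt with rfl | h0
    · norm_num [Wf]
    · have : 0 < qf x * x ^ 3 * (2 - x ^ 2) := by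
        have : 0 < 2 - x ^ 2 := by linarith
        positivity
      linarith
  · have hx2 : x ^ 2 ≤ 1 / 25 := by nlinarith
    have a1 : 1 * (24 / 25) * (3 / 4) ≤ (1 - x) * (1 - x ^ 2) * Wf x := by
      have b1 : 1 * (24 / 25) ≤ (1 - x) * (1 - x ^ 2) :=
        mul_le_mul (by linarith) (by linarith) (by norm_num) (by linarith)
      exact mul_le_mul b1 hW (by norm_num) (by linarith)
    have a2 : qf x ≤ 1 := by
      unfold qf
      nlinarith
    have a3 : 0 ≤ -x ^ 3 := by
      have : -x ^ 3 = -x * x ^ 2 := by ring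
      rw [this]
      exact mul_nonneg (by linarith) (sq_nonneg x)
    have a4 : -x ^ 3 ≤ 1 / 125 := by
      have : -x ^ 3 = -x * x ^ 2 := by ring
      rw [this]
      nlinarith [sq_nonneg x]
    have a5 : qf x * (-x ^ 3) * (2 - x ^ 2) ≤ 1 * (1 / 125) * 2 := by
      have : 0 ≤ 2 - x ^ 2 := by linarith
      gcongr
      nlinarith [sq_nonneg x]
    linarith

/-- The largest angle that is considered: its cosine is `-1/5`. -/
def φmax : ℝ := Real.arccos (-(1 / 5))

theorem cos_φmax : Real.cos φmax = -(1 / 5) := Real.cos_arccos (by norm_num) (by norm_num)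

theorem φmax_lt_pi : φmax < Real.pi := by
  rcases (Real.arccos_le_pi (-(1 / 5))).eq_or_lt with h | h
  · have := cos_φmax
    rw [φmax, h, Real.cos_pi] at this
    norm_num at this
  · exact h

theorem φmax_pos : 0 < φmax := Real.arccos_pos.2 (by norm_num)

theorem pi_div_two_lt_φmax : Real.pi / 2 < φmax := by
  rw [← Real.arccos_zero]
  exact Real.arccos_lt_arccos (by norm_num) (by norm_num) (by norm_num)

theorem cos_gt_of_abs_lt {φ : ℝ} (h : |φ| < φmax) : -(1 / 5) < Real.cos φ := by
  rw [← cos_φmax, ← Real.cos_abs φ]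
  exact Real.cos_lt_cos_of_nonneg_of_le_pi (abs_nonneg φ) φmax_lt_pi.le h

theorem deriv_Jf_pos {φ : ℝ} (h : -(1 / 5) ≤ Real.cos φ) : 0 < deriv Jf φ := by
  rw [(hasDerivAt_Jf φ).deriv]
  exact div_pos (derivJ_num_pos h (Real.cos_le_one φ))
    (mul_pos (sqrt_Wf_pos _) (Wf_pos _))

theorem strictMonoOn_Jf : StrictMonoOn Jf (Icc (-φmax) φmax) := by
  refine strictMonoOn_of_deriv_pos (convex_Icc _ _) contDiff_Jf.continuous.continuousOn fun φ hφ => ?_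
  rw [interior_Icc] at hφ
  exact deriv_Jf_pos (cos_gt_of_abs_lt (abs_lt.2 hφ)).le

theorem Jf_φmax : 3 / 5 < Jf φmax := by
  have hs : Real.sin φmax ^ 2 = 24 / 25 := by
    have := Real.sin_sq_add_cos_sq φmax
    rw [cos_φmax] at this
    linarith
  have hs0 : 0 < Real.sin φmax := Real.sin_pos_of_pos_of_lt_pi φmax_pos φmax_lt_pi
  have hs1 : 9 / 10 < Real.sin φmax := by nlinarith
  rw [Jf, cos_φmax, lt_div_iff₀ (sqrt_Wf_pos _)]
  have : √(Wf (-(1 / 5))) ≤ 1 := by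
    exact Real.sqrt_le_one.2 (by norm_num [Wf])
  have hq : qf (-(1 / 5)) = 37 / 50 := by norm_num [qf]
  rw [hq]
  linarith

theorem Jf_pi_div_two : Jf (Real.pi / 2) = 13 / 25 := by
  simp only [Jf, Real.cos_pi_div_two, Real.sin_pi_div_two, qf, Wf]
  norm_num

theorem exists_angle : ∃ g : ℝ → ℝ, ∀ v ∈ Icc (-1 : ℝ) 1,
    ContDiffAt ℝ ∞ g v ∧ |g v| < φmax ∧ Jf (g v) = 3 / 5 * v := by
  obtain ⟨g, ho, hg, hinv⟩ := exists_smooth_inverse contDiff_Jf (a := -φmax) (b := φmax)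
    fun t ht => deriv_Jf_pos (cos_gt_of_abs_lt (abs_lt.2 ht)).le
  refine ⟨fun v => g (3 / 5 * v), fun v hv => ?_⟩
  have h1 : 3 / 5 * v ∈ Jf '' Ioo (-φmax) φmax := by
    have hivt := intermediate_value_Ioo (f := Jf) (a := -φmax) (b := φmax)
      (by linarith [φmax_pos]) contDiff_Jf.continuous.continuousOn
    apply hivt
    rw [Jf_neg]
    have := Jf_φmax
    constructor <;> linarith [hv.1, hv.2]
  obtain ⟨φ, hφ, he⟩ := h1
  have h2 : ContDiffAt ℝ ∞ g (3 / 5 * v) := hg.contDiffAt (ho.mem_nhds ⟨φ, hφ, he⟩)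
  have h3 : g (3 / 5 * v) = φ := by rw [← he, hinv φ hφ]
  refine ⟨?_, ?_, ?_⟩
  · exact ContDiffAt.comp (g := g) v h2 (contDiffAt_const.mul contDiffAt_id)
  · change |g (3 / 5 * v)| < φmax
    rw [h3]
    exact abs_lt.2 hφ
  · change Jf (g (3 / 5 * v)) = _
    rw [h3, he]

/-- The solution `φ` of `J φ = (3/5) v`, for `|v| ≤ 1`. -/
def angle : ℝ → ℝ := Classical.choose exists_angle

theorem contDiffAt_angle {v : ℝ} (hv : v ∈ Icc (-1 : ℝ) 1) : ContDiffAt ℝ ∞ angle v :=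
  (Classical.choose_spec exists_angle v hv).1

theorem abs_angle_lt {v : ℝ} (hv : v ∈ Icc (-1 : ℝ) 1) : |angle v| < φmax :=
  (Classical.choose_spec exists_angle v hv).2.1

theorem Jf_angle {v : ℝ} (hv : v ∈ Icc (-1 : ℝ) 1) : Jf (angle v) = 3 / 5 * v :=
  (Classical.choose_spec exists_angle v hv).2.2

theorem angle_mem {v : ℝ} (hv : v ∈ Icc (-1 : ℝ) 1) : angle v ∈ Icc (-φmax) φmax :=
  abs_le.1 (abs_angle_lt hv).le

theorem angle_unique {v φ : ℝ} (hv : v ∈ Icc (-1 : ℝ) 1) (hφ : φ ∈ Icc (-φmax) φmax)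
    (h : Jf φ = 3 / 5 * v) : angle v = φ :=
  strictMonoOn_Jf.injOn (angle_mem hv) hφ ((Jf_angle hv).trans h.symm)

theorem angle_neg {v : ℝ} (hv : v ∈ Icc (-1 : ℝ) 1) : angle (-v) = -angle v := by
  refine angle_unique (v := -v) ⟨by linarith [hv.2], by linarith [hv.1]⟩
    ⟨by linarith [(angle_mem hv).2], by linarith [(angle_mem hv).1]⟩ ?_
  rw [Jf_neg, Jf_angle hv]
  ring

theorem angle_lt_angle {v w : ℝ} (hv : v ∈ Icc (-1 : ℝ) 1) (hw : w ∈ Icc (-1 : ℝ) 1)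
    (h : v < w) : angle v < angle w := by
  rw [← strictMonoOn_Jf.lt_iff_lt (angle_mem hv) (angle_mem hw), Jf_angle hv, Jf_angle hw]
  linarith

theorem pi_div_two_lt_angle_one : Real.pi / 2 < angle 1 := by
  have h1 : (1 : ℝ) ∈ Icc (-1 : ℝ) 1 := by norm_num
  have hp := Real.pi_pos
  rw [← strictMonoOn_Jf.lt_iff_lt ⟨by linarith [φmax_pos], pi_div_two_lt_φmax.le⟩ (angle_mem h1),
    Jf_angle h1, Jf_pi_div_two]
  norm_num

theorem cos_angle_gt {v : ℝ} (hv : v ∈ Icc (-1 : ℝ) 1) : -(1 / 5) < Real.cos (angle v) :=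
  cos_gt_of_abs_lt (abs_angle_lt hv)

theorem deriv_Jf_mul_deriv_angle {v : ℝ} (hv : v ∈ Icc (-1 : ℝ) 1) :
    deriv Jf (angle v) * deriv angle v = 3 / 5 := by
  have h1 := ((contDiff_Jf.differentiable (by simp) (angle v)).hasDerivAt.comp v
    ((contDiffAt_angle hv).differentiableAt (by simp)).hasDerivAt).hasDerivWithinAt (s := Icc (-1) 1)
  have h2 : HasDerivWithinAt (fun v : ℝ => 3 / 5 * v) (3 / 5) (Icc (-1) 1) v := by
    simpa using ((hasDerivAt_id v).const_mul (3 / 5 : ℝ)).hasDerivWithinAt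
  have h3 : HasDerivWithinAt (Jf ∘ angle) (3 / 5) (Icc (-1) 1) v :=
    h2.congr (fun w hw => Jf_angle hw) (Jf_angle hv)
  exact (uniqueDiffOn_Icc (by norm_num) v hv).eq_deriv _ h1 h3

theorem deriv_angle_pos {v : ℝ} (hv : v ∈ Icc (-1 : ℝ) 1) : 0 < deriv angle v := by
  have h := deriv_Jf_mul_deriv_angle hv
  have h1 := deriv_Jf_pos (cos_angle_gt hv).le
  by_contra hn
  nlinarith

/-! ### A criterion for embedded curves -/

theorem exp_two_mul_ne_zero (φ : ℝ) : Complex.exp ((2 * φ : ℝ) * Complex.I) ≠ 0 := Complex.exp_ne_zero _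

/-- A criterion for curves whose first coordinate has an argument that is an increasing function
of `sin t`, with values between `-2π` and `2π`: two points of the curve can lie on a common ray
only if they have the same argument, or arguments that differ by `2π`. -/
theorem isConeKnot_of_angle {r Θ : ℝ → ℝ} {y : ℝ → ℂ} (G : ℝ → ℝ) (hΘ : ∀ t, Θ t = G (Real.sin t))
    (hG : StrictMonoOn G (Icc (-1) 1)) (hodd : ∀ v ∈ Icc (-1 : ℝ) 1, G (-v) = -G v)
    (hG1 : G 1 < 2 * Real.pi) (hΘ' : ∀ t, deriv Θ t = 0 → Real.cos t = 0)
    (hrs : ContDiff ℝ ∞ r) (hΘs : ContDiff ℝ ∞ Θ) (hys : ContDiff ℝ ∞ y) (hr : ∀ t, 0 < r t)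
    (hrp : ∀ t, r (t + 2 * Real.pi) = r t) (hyp : ∀ t, y (t + 2 * Real.pi) = y t)
    (hA : ∀ t (k : ℝ), 0 < k → r (Real.pi - t) = k * r t → y (Real.pi - t) = k * y t →
      Real.cos t = 0)
    (hB : ∀ s t (k : ℝ), 0 < k → 0 < Real.sin s → Real.sin t < 0 → Θ s = Θ t + 2 * Real.pi →
      r s = k * r t → y s = k * y t → False)
    (hC : ∀ t (ρ : ℝ), Real.cos t = 0 → deriv r t = ρ * r t → deriv y t = ρ * y t → False) :
    IsConeKnot (fun t => ((r t : ℂ) * Complex.exp (Θ t * Complex.I), y t)) := by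
  have hsin : ∀ t, Real.sin t ∈ Icc (-1 : ℝ) 1 := Real.sin_mem_Icc
  have h1 : (1 : ℝ) ∈ Icc (-1 : ℝ) 1 := by norm_num
  have hG0 : G 0 = 0 := by
    have := hodd 0 (by norm_num)
    rw [neg_zero] at this
    linarith
  have hGlt : ∀ v ∈ Icc (-1 : ℝ) 1, G v < 2 * Real.pi := fun v hv =>
    (hG.monotoneOn hv h1 hv.2).trans_lt hG1
  have hGgt : ∀ v ∈ Icc (-1 : ℝ) 1, -(2 * Real.pi) < G v := fun v hv => by
    have := hGlt (-v) ⟨by linarith [hv.2], by linarith [hv.1]⟩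
    rw [hodd v hv] at this
    linarith
  have hrC : ContDiff ℝ ∞ (fun t => (r t : ℂ)) := Complex.ofRealCLM.contDiff.comp hrs
  have hΘC : ContDiff ℝ ∞ (fun t => (Θ t : ℂ)) := Complex.ofRealCLM.contDiff.comp hΘs
  have key : ∀ s t (k : ℝ), 0 < k → 0 < Real.sin s ∨ Real.sin t < 0 → Θ s = Θ t + 2 * Real.pi →
      r s = k * r t → y s = k * y t → False := by
    intro s t k hk _ h hr hy
    refine hB s t k hk ?_ ?_ h hr hy
    · by_contra hn
      have := hG.monotoneOn (hsin s) (by norm_num : (0 : ℝ) ∈ Icc (-1 : ℝ) 1) (not_lt.1 hn)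
      rw [hΘ, hΘ] at h
      linarith [hGgt _ (hsin t)]
    · by_contra hn
      have := hG.monotoneOn (by norm_num : (0 : ℝ) ∈ Icc (-1 : ℝ) 1) (hsin t) (not_lt.1 hn)
      rw [hΘ, hΘ] at h
      linarith [hGlt _ (hsin s)]
  refine ⟨(hrC.mul (hΘC.mul contDiff_const).cexp).prodMk hys, fun t => ?_, fun t h0 => ?_,
    fun t ρ h => ?_, fun s t k hk h => ?_⟩
  · simp only [hrp, hyp, hΘ, Real.sin_add_two_pi]
  · have := congrArg Prod.fst h0
    have h2 : (r t : ℂ) ≠ 0 := by exact_mod_cast (hr t).ne'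
    exact mul_ne_zero h2 (Complex.exp_ne_zero _) this
  · have hd1 := (hrs.differentiable (by simp) t).hasDerivAt
    have hd2 := (hΘs.differentiable (by simp) t).hasDerivAt
    have hd3 := (hys.differentiable (by simp) t).hasDerivAt
    have hd : HasDerivAt (fun t => ((r t : ℂ) * Complex.exp (Θ t * Complex.I), y t)) _ t :=
      (hd1.ofReal_comp.mul ((hd2.ofReal_comp.mul_const Complex.I).cexp)).prodMk hd3
    rw [hd.deriv] at h
    have e1 := congrArg Prod.fst h
    have e2 := congrArg Prod.snd h
    simp only [Prod.smul_mk, Complex.real_smul] at e1 e2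
    have hE := Complex.exp_ne_zero (Θ t * Complex.I)
    have e3 : ((deriv r t : ℝ) : ℂ) + r t * ((deriv Θ t : ℝ) : ℂ) * Complex.I = ρ * r t := by
      apply mul_right_cancel₀ hE
      linear_combination e1
    have e4 := congrArg Complex.re e3
    have e5 := congrArg Complex.im e3
    simp at e4 e5
    refine hC t ρ (hΘ' t ?_) e4 e2
    rcases e5 with h | h
    · exact absurd h (hr t).ne'
    · exact h
  · have e1 := congrArg Prod.fst h
    have e2 := congrArg Prod.snd h
    simp only [Prod.smul_mk, Complex.real_smul] at e1 e2
    have hrs0 := hr s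
    have hrt0 := hr t
    have e3 : Complex.exp (Θ s * Complex.I) = (k * r t / r s) • Complex.exp (Θ t * Complex.I) := by
      rw [Complex.real_smul]
      have h2 : (r s : ℂ) ≠ 0 := by exact_mod_cast hrs0.ne'
      push_cast
      rw [div_mul_eq_mul_div, eq_div_iff h2]
      linear_combination e1
    obtain ⟨e4, m, hm⟩ := exp_mul_I_eq_smul (by positivity) e3
    rw [div_eq_one_iff_eq hrs0.ne'] at e4
    have hπ := Real.pi_pos
    have hm1 : (m : ℝ) < 2 := by
      have a1 := hGlt _ (hsin s)
      have a2 := hGgt _ (hsin t)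
      rw [hΘ, hΘ] at hm
      by_contra hn
      have : 2 * (2 * Real.pi) ≤ m * (2 * Real.pi) :=
        mul_le_mul_of_nonneg_right (not_lt.1 hn) (by positivity)
      linarith
    have hm2 : (-2 : ℝ) < m := by
      have a1 := hGgt _ (hsin s)
      have a2 := hGlt _ (hsin t)
      rw [hΘ, hΘ] at hm
      by_contra hn
      have : m * (2 * Real.pi) ≤ (-2) * (2 * Real.pi) :=
        mul_le_mul_of_nonneg_right (not_lt.1 hn) (by positivity)
      linarith
    have hm1' : m < 2 := by exact_mod_cast hm1
    have hm2' : -2 < m := by exact_mod_cast hm2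
    have hcases : m = -1 ∨ m = 0 ∨ m = 1 := by omega
    rcases hcases with rfl | rfl | rfl
    · exfalso
      have h3 : Θ t = Θ s + 2 * Real.pi := by push_cast at hm; linarith
      have hsgn : 0 < Real.sin t ∨ Real.sin s < 0 := by
        by_contra hn
        push Not at hn
        have b1 := hG.monotoneOn (hsin t) (hsin s) (by linarith [hn.1, hn.2])
        rw [hΘ, hΘ] at h3
        linarith
      have hk' : (k : ℂ) ≠ 0 := by exact_mod_cast hk.ne'
      refine key t s k⁻¹ (inv_pos.2 hk) hsgn h3 ?_ ?_
      · rw [← e4]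
        field_simp
      · rw [e2]
        push_cast
        field_simp
    · have h3 : Real.sin s = Real.sin t := by
        apply hG.injOn (hsin s) (hsin t)
        rw [← hΘ, ← hΘ, hm]
        simp
      have h4 : Real.cos s ^ 2 = Real.cos t ^ 2 := by
        have := Real.sin_sq_add_cos_sq s
        have := Real.sin_sq_add_cos_sq t
        rw [h3] at *
        linarith
      have hfin : ∀ u, Real.cos u = Real.cos t → Real.sin u = Real.sin t →
          ∃ m : ℤ, u = t + m * (2 * Real.pi) := by
        intro u hc hs
        obtain ⟨k, hk⟩ := Real.Angle.angle_eq_iff_two_pi_dvd_sub.mp (Real.Angle.cos_sin_inj hc hs)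
        exact ⟨k, by linarith⟩
      rcases sq_eq_sq_iff_eq_or_eq_neg.1 h4 with h5 | h5
      · exact hfin s h5 h3
      · have h6 : Real.cos s = Real.cos (Real.pi - t) ∧ Real.sin s = Real.sin (Real.pi - t) := by
          rw [Real.cos_pi_sub, Real.sin_pi_sub]
          exact ⟨h5, h3⟩
        obtain ⟨k', hk'⟩ := Real.Angle.angle_eq_iff_two_pi_dvd_sub.mp
          (Real.Angle.cos_sin_inj h6.1 h6.2)
        have h7 : Real.pi - t = s + (-k' : ℤ) * (2 * Real.pi) := by push_cast; linarith
        have h8 : r (Real.pi - t) = r s := by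
          rw [h7]
          exact (show Function.Periodic r (2 * Real.pi) from hrp).int_mul _ s
        have h9 : y (Real.pi - t) = y s := by
          rw [h7]
          exact (show Function.Periodic y (2 * Real.pi) from hyp).int_mul _ s
        have h10 := hA t k hk (by rw [h8, e4]) (by rw [h9, e2])
        exact hfin s (by rw [h5, h10, neg_zero]) h3
    · exfalso
      have h3 : Θ s = Θ t + 2 * Real.pi := by push_cast at hm; linarith
      have hsgn : 0 < Real.sin s ∨ Real.sin t < 0 := by
        by_contra hn
        push Not at hn
        have b1 := hG.monotoneOn (hsin s) (hsin t) (by linarith [hn.1, hn.2])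
        rw [hΘ, hΘ] at h3
        linarith
      exact key s t k hk hsgn h3 e4.symm e2

/-! ### The family of knots around the link of the ball -/

/-- The angle `φ` at the time `t` of the boundary curve in the annulus. -/
def phi (t : ℝ) : ℝ := angle (Real.sin t)

theorem contDiff_phi : ContDiff ℝ ∞ phi := by
  rw [contDiff_iff_contDiffAt]
  intro t
  exact (contDiffAt_angle (Real.sin_mem_Icc t)).comp t Real.contDiff_sin.contDiffAt

theorem hasDerivAt_phi (t : ℝ) : HasDerivAt phi (deriv angle (Real.sin t) * Real.cos t) t :=
  ((contDiffAt_angle (Real.sin_mem_Icc t)).differentiableAt (by simp)).hasDerivAt.comp t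
    (Real.hasDerivAt_sin t)

theorem cos_eq_zero_of_deriv_phi {t : ℝ} (h : deriv phi t = 0) : Real.cos t = 0 := by
  rw [(hasDerivAt_phi t).deriv] at h
  exact (mul_eq_zero.1 h).resolve_left (deriv_angle_pos (Real.sin_mem_Icc t)).ne'

theorem cos_phi_gt (t : ℝ) : -(1 / 5) < Real.cos (phi t) := cos_angle_gt (Real.sin_mem_Icc t)

theorem Jf_phi (t : ℝ) : Jf (phi t) = 3 / 5 * Real.sin t := Jf_angle (Real.sin_mem_Icc t)

theorem qf_mul_sin_phi (t : ℝ) : qf (Real.cos (phi t)) * Real.sin (phi t) =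
    3 / 5 * Real.sin t * √(Wf (Real.cos (phi t))) := by
  have := Jf_phi t
  rwa [Jf, div_eq_iff (sqrt_Wf_pos _).ne'] at this

theorem phi_pi_sub (t : ℝ) : phi (Real.pi - t) = phi t := by simp [phi]

theorem phi_add_two_pi (t : ℝ) : phi (t + 2 * Real.pi) = phi t := by simp [phi]

/-- The value of `m = ‖s‖²` at which `(m - 1) / (m + 1) = υ`. -/
def mob (υ : ℝ) : ℝ := (1 + υ) / (1 - υ)

/-- The ratio `m / (20 √(1 - m²/400))`, up to the factor `3/5`, of the size of the first coordinate in
the ball to the size of the slice. -/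
def ff (υ : ℝ) : ℝ := 3 / 5 * mob υ / √(400 - mob υ ^ 2)

theorem re_im_of_eq_mul {a b c d k : ℝ}
    (h : (a : ℂ) + b * Complex.I = k * (c + d * Complex.I)) : a = k * c ∧ b = k * d :=
  ⟨by simpa using congrArg Complex.re h, by simpa using congrArg Complex.im h⟩

theorem mob_pos {υ : ℝ} (h : |υ| < 4 / 5) : 0 < mob υ := by
  have := abs_lt.1 h
  exact div_pos (by linarith) (by linarith)

theorem mob_lt {υ : ℝ} (h : |υ| < 4 / 5) : mob υ < 9 := by
  have := abs_lt.1 h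
  rw [mob, div_lt_iff₀ (by linarith)]
  linarith

theorem mob_sq_lt {υ : ℝ} (h : |υ| < 4 / 5) : 0 < 400 - mob υ ^ 2 := by
  nlinarith [mob_pos h, mob_lt h]

theorem ff_pos {υ : ℝ} (h : |υ| < 4 / 5) : 0 < ff υ :=
  div_pos (mul_pos (by norm_num) (mob_pos h)) (Real.sqrt_pos.2 (mob_sq_lt h))

theorem contDiffAt_mob {υ : ℝ} (h : |υ| < 4 / 5) : ContDiffAt ℝ ∞ mob υ := by
  have := abs_lt.1 h
  exact (contDiffAt_const.add contDiffAt_id).div (contDiffAt_const.sub contDiffAt_id) (by linarith)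

theorem contDiffAt_ff {υ : ℝ} (h : |υ| < 4 / 5) : ContDiffAt ℝ ∞ ff υ :=
  (contDiffAt_const.mul (contDiffAt_mob h)).div
    ((contDiffAt_const.sub ((contDiffAt_mob h).pow 2)).sqrt (mob_sq_lt h).ne')
    (Real.sqrt_pos.2 (mob_sq_lt h)).ne'

theorem mob_le_mob {υ ν : ℝ} (h : |υ| < 4 / 5) (h' : |ν| < 4 / 5) (hle : υ ≤ ν) :
    mob υ ≤ mob ν := by
  have h1 := abs_lt.1 h
  have h2 := abs_lt.1 h'
  rw [mob, mob, div_le_div_iff₀ (by linarith) (by linarith)]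
  nlinarith

/-- `ff` grows at least like `mob`, so a ratio of values of `ff` at arguments of opposite sign is
bounded below. -/
theorem ff_ratio {υ ν k : ℝ} (h : |υ| < 4 / 5) (h' : |ν| < 4 / 5) (hυ : 0 < υ) (hν : ν < 0)
    (hk : ff υ = k * ff ν) : 1 + 2 * υ < k := by
  have h0 : |(0 : ℝ)| < 4 / 5 := by norm_num
  have hυ1 := abs_lt.1 h
  have m0 : mob 0 = 1 := by norm_num [mob]
  have a1 : mob ν ≤ 1 := m0 ▸ mob_le_mob h' h0 hν.le
  have a2 : 1 ≤ mob υ := m0 ▸ mob_le_mob h0 h hυ.le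
  have a3 := mob_pos h'
  have a4 : 1 + 2 * υ < mob υ := by
    rw [mob, lt_div_iff₀ (by linarith)]
    nlinarith
  have s1 : √(400 - mob υ ^ 2) ≤ √(400 - mob ν ^ 2) := Real.sqrt_le_sqrt (by nlinarith)
  have s2 := Real.sqrt_pos.2 (mob_sq_lt h)
  have s3 := Real.sqrt_pos.2 (mob_sq_lt h')
  have b1 : mob υ * ff ν ≤ ff υ := by
    rw [ff, ff, ← mul_div_assoc, div_le_div_iff₀ s3 s2]
    have : mob υ * (3 / 5 * mob ν) ≤ 3 / 5 * mob υ := by nlinarith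
    exact mul_le_mul this s1 s2.le (by nlinarith)
  have b2 := ff_pos h'
  rw [hk] at b1
  exact a4.trans_le (le_of_mul_le_mul_right b1 b2)

/-- The value of `υ` at the time `t`. For `l = 0` this is the boundary curve in the annulus; for `l = 1`
the contribution of the centre of the slice is absent. -/
def upsL (l t : ℝ) : ℝ :=
  (3 / 5 * Real.cos t - (1 - l) * (qf (Real.cos (phi t)) * Real.cos (phi t) ^ 2) /
    √(Wf (Real.cos (phi t)))) / √(Wf (Real.cos (phi t)))

/-- The coefficient of `-υ` in the second coordinate of the knots of the family `knotL`, as a function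
of `x = cos φ`. -/
def cL (l x : ℝ) : ℝ := (1 - l) * x ^ 2 + l * (3 / 2 * x ^ 2 - 1 / 2)

/-- The second coordinate of the knots of the family `knotL`. -/
def yL (l t : ℝ) : ℂ := Complex.exp ((2 * phi t : ℝ) * Complex.I) *
  ((-((1 - l) * qf (Real.cos (phi t))) - upsL l t * cL l (Real.cos (phi t)) : ℝ) +
    (upsL l t * Real.sin (phi t) : ℝ) * Complex.I)

theorem qf_mul_sq_le {x : ℝ} (h1 : -(1 / 5) ≤ x) (h2 : x ≤ 1) : qf x * x ^ 2 ≤ 7 / 100 * Wf x := by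
  have hW := Wf_ge x
  have : qf x * x ^ 2 ≤ 21 / 400 := by
    unfold qf
    rcases le_or_gt 0 x with h | h
    · have a1 : x * (1 - x) ≤ 1 / 4 := by nlinarith [sq_nonneg (x - 1 / 2)]
      have a2 : 0 ≤ x * (1 - x) := mul_nonneg h (by linarith)
      have a3 : x ^ 2 ≤ 1 := by nlinarith
      nlinarith
    · have a1 : x ^ 2 ≤ 1 / 25 := by nlinarith
      have a2 : (1 - x) ^ 2 ≤ 36 / 25 := by nlinarith
      nlinarith [sq_nonneg x, sq_nonneg (1 - x)]
  linarith

theorem abs_upsL_lt {l : ℝ} (hl : l ∈ Icc (0 : ℝ) 1) (t : ℝ) : |upsL l t| < 4 / 5 := by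
  have hx := cos_phi_gt t
  have hx1 := Real.cos_le_one (phi t)
  set x := Real.cos (phi t)
  have hW := Wf_ge x
  have hw := sqrt_Wf_pos x
  have hw2 := sq_sqrt_Wf x
  have hqx := qf_mul_sq_le hx.le hx1
  have hq0 : 0 ≤ qf x * x ^ 2 := mul_nonneg (qf_pos x).le (sq_nonneg x)
  change |(3 / 5 * Real.cos t - (1 - l) * (qf x * x ^ 2) / √(Wf x)) / √(Wf x)| < 4 / 5
  set w := √(Wf x)
  have hw3 : 43 / 50 < w := by nlinarith
  have b0 : 0 ≤ (1 - l) * (qf x * x ^ 2) / w :=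
    div_nonneg (mul_nonneg (by linarith [hl.2]) hq0) hw.le
  have b1 : (1 - l) * (qf x * x ^ 2) / w ≤ 7 / 100 * w := by
    rw [div_le_iff₀ hw]
    nlinarith [hl.1, hl.2]
  have c1 := Real.cos_le_one t
  have c2 := Real.neg_one_le_cos t
  rw [abs_lt, lt_div_iff₀ hw, div_lt_iff₀ hw]
  constructor <;> nlinarith

theorem contDiff_cos_phi : ContDiff ℝ ∞ (fun t => Real.cos (phi t)) :=
  Real.contDiff_cos.comp contDiff_phi

theorem contDiff_upsL : ContDiff ℝ ∞ (fun p : ℝ × ℝ => upsL p.1 p.2) := by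
  have hx : ContDiff ℝ ∞ (fun p : ℝ × ℝ => Real.cos (phi p.2)) := contDiff_cos_phi.comp contDiff_snd
  have hq := contDiff_qf.comp hx
  have hw := contDiff_sqrt_Wf.comp hx
  have hw0 : ∀ p : ℝ × ℝ, √(Wf (Real.cos (phi p.2))) ≠ 0 := fun p => (sqrt_Wf_pos _).ne'
  exact ((contDiff_const.mul (Real.contDiff_cos.comp contDiff_snd)).sub
    (((contDiff_const.sub contDiff_fst).mul (hq.mul (hx.pow 2))).div hw hw0)).div hw hw0

theorem contDiff_yL : ContDiff ℝ ∞ (fun p : ℝ × ℝ => yL p.1 p.2) := by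
  have hφ : ContDiff ℝ ∞ (fun p : ℝ × ℝ => phi p.2) := contDiff_phi.comp contDiff_snd
  have hx : ContDiff ℝ ∞ (fun p : ℝ × ℝ => Real.cos (phi p.2)) := contDiff_cos_phi.comp contDiff_snd
  have hs : ContDiff ℝ ∞ (fun p : ℝ × ℝ => Real.sin (phi p.2)) := Real.contDiff_sin.comp hφ
  have hq : ContDiff ℝ ∞ (fun p : ℝ × ℝ => qf (Real.cos (phi p.2))) := contDiff_qf.comp hx
  have hu := contDiff_upsL
  have hc : ContDiff ℝ ∞ (fun p : ℝ × ℝ => cL p.1 (Real.cos (phi p.2))) := by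
    unfold cL
    fun_prop
  have hof : ∀ {g : ℝ × ℝ → ℝ}, ContDiff ℝ ∞ g → ContDiff ℝ ∞ (fun p => (g p : ℂ)) :=
    fun h => Complex.ofRealCLM.contDiff.comp h
  refine ((hof (contDiff_const.mul hφ)).mul contDiff_const).cexp.mul
    ((hof ?_).add ((hof (hu.mul hs)).mul contDiff_const))
  exact (((contDiff_const.sub contDiff_fst).mul hq).neg).sub (hu.mul hc)

/-- A family of knots `(f e^{2iφ}, e^{2iφ} (-(1 - l) q - υ (c - i sin φ)))`. For `l = 0` this is, up to
positive factors, the component of the link of the ball in the annulus; for `l = 1` the shift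
`q` by the centres of the slices is gone. -/
def knotL (l t : ℝ) : ℂ × ℂ :=
  ((ff (upsL l t) : ℂ) * Complex.exp ((2 * phi t : ℝ) * Complex.I), yL l t)

theorem contDiffAt_knotL {l : ℝ} (hl : l ∈ Icc (0 : ℝ) 1) (t : ℝ) :
    ContDiffAt ℝ ∞ (fun p : ℝ × ℝ => knotL p.1 p.2) (l, t) := by
  have h1 : ContDiffAt ℝ ∞ (fun p : ℝ × ℝ => ff (upsL p.1 p.2)) (l, t) :=
    ContDiffAt.comp (g := ff) (l, t) (contDiffAt_ff (abs_upsL_lt hl t)) contDiff_upsL.contDiffAt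
  have h2 : ContDiff ℝ ∞ (fun p : ℝ × ℝ => ((2 * phi p.2 : ℝ) : ℂ)) :=
    Complex.ofRealCLM.contDiff.comp (contDiff_const.mul (contDiff_phi.comp contDiff_snd))
  exact ((Complex.ofRealCLM.contDiff.contDiffAt.comp (l, t) h1).mul
    (h2.mul contDiff_const).cexp.contDiffAt).prodMk contDiff_yL.contDiffAt

/-- Two points of `knotL` with the same angle `φ` on a common ray coincide. -/
theorem knotL_same_angle {l : ℝ} (t k : ℝ) (hk : 0 < k)
    (hy : yL l (Real.pi - t) = k * yL l t) : Real.cos t = 0 := by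
  have hE := exp_two_mul_ne_zero (phi t)
  simp only [yL, phi_pi_sub] at hy
  rw [mul_left_comm] at hy
  have h := mul_left_cancel₀ hE hy
  obtain ⟨hre, him⟩ := re_im_of_eq_mul h
  have hw := sqrt_Wf_pos (Real.cos (phi t))
  have hw2 := sq_sqrt_Wf (Real.cos (phi t))
  have hu1 : upsL l (Real.pi - t) * √(Wf (Real.cos (phi t))) = -(3 / 5 * Real.cos t) -
      (1 - l) * (qf (Real.cos (phi t)) * Real.cos (phi t) ^ 2) / √(Wf (Real.cos (phi t))) := by
    rw [upsL, phi_pi_sub, div_mul_cancel₀ _ hw.ne', Real.cos_pi_sub]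
    ring
  have hu2 : upsL l t * √(Wf (Real.cos (phi t))) = 3 / 5 * Real.cos t -
      (1 - l) * (qf (Real.cos (phi t)) * Real.cos (phi t) ^ 2) / √(Wf (Real.cos (phi t))) := by
    rw [upsL, div_mul_cancel₀ _ hw.ne']
  have hqp := qf_pos (Real.cos (phi t))
  set υ := upsL l t
  set υ' := upsL l (Real.pi - t)
  have hsc := Real.sin_sq_add_cos_sq (phi t)
  by_cases hS : Real.sin (phi t) = 0
  · have hx : Real.cos (phi t) = 1 := by
      have h1 : Real.cos (phi t) ^ 2 = 1 := by rw [hS] at hsc; linarith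
      have := cos_phi_gt t
      nlinarith
    rw [hx] at hre hu1 hu2
    have hW1 : √(Wf 1) = 1 := by norm_num [Wf]
    rw [hW1] at hu1 hu2
    have hq1 : qf 1 = 1 / 50 := by norm_num [qf]
    rw [hq1] at hre hu1 hu2
    simp only [cL] at hre
    have : (1 + k) * Real.cos t = 0 := by
      linear_combination (5 / 3 : ℝ) * hre + (5 / 3 : ℝ) * hu1 - (5 / 3 : ℝ) * k * hu2
    rcases mul_eq_zero.1 this with h | h
    · linarith
    · exact h
  · have h1 : υ' = k * υ := by
      have : (υ' - k * υ) * Real.sin (phi t) = 0 := by linear_combination him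
      linarith [(mul_eq_zero.1 this).resolve_right hS]
    have h2 : (k - 1) * ((1 - l) * qf (Real.cos (phi t))) = 0 := by
      rw [h1] at hre
      linear_combination hre
    rcases mul_eq_zero.1 h2 with h | h
    · have hk1 : k = 1 := by linarith
      rw [hk1, one_mul] at h1
      rw [h1, hu2] at hu1
      linarith
    · have hl0 : 1 - l = 0 := (mul_eq_zero.1 h).resolve_right hqp.ne'
      rw [hl0] at hu1 hu2
      simp only [zero_mul, zero_div, sub_zero] at hu1 hu2
      rw [h1] at hu1
      have : (1 + k) * Real.cos t = 0 := by
        linear_combination (5 / 3 : ℝ) * hu1 - (5 / 3 : ℝ) * k * hu2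
      rcases mul_eq_zero.1 this with h | h
      · linarith
      · exact h

/-- The velocity of `knotL` is not radial at the two points where the angle is stationary. -/
theorem knotL_regular {l t ρ : ℝ} (ht : Real.cos t = 0)
    (hy : deriv (yL l) t = ρ * yL l t) : False := by
  have hφ : HasDerivAt phi 0 t := by
    have := hasDerivAt_phi t
    rwa [ht, mul_zero] at this
  have hx : HasDerivAt (fun t => Real.cos (phi t)) 0 t := by
    have := hφ.cos
    rwa [mul_zero] at this
  have hcomp : ∀ {g : ℝ → ℝ}, ContDiff ℝ ∞ g → HasDerivAt (fun t => g (Real.cos (phi t))) 0 t := by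
    intro g hg
    have := (hg.differentiable (by simp) (Real.cos (phi t))).hasDerivAt.comp t hx
    rwa [mul_zero] at this
  have hw := sqrt_Wf_pos (Real.cos (phi t))
  have hu : HasDerivAt (upsL l) (-(3 / 5 * Real.sin t) / √(Wf (Real.cos (phi t)))) t := by
    have h1 : HasDerivAt (fun t => 3 / 5 * Real.cos t * (√(Wf (Real.cos (phi t))))⁻¹)
        (-(3 / 5 * Real.sin t) / √(Wf (Real.cos (phi t)))) t := by
      have := ((Real.hasDerivAt_cos t).const_mul (3 / 5)).mul
        (hcomp (g := fun x => (√(Wf x))⁻¹) (contDiff_sqrt_Wf.inv fun x => (sqrt_Wf_pos x).ne'))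
      refine this.congr_deriv ?_
      ring
    have h2 := h1.sub (hcomp (g := fun x => (1 - l) * (qf x * x ^ 2) / √(Wf x) / √(Wf x))
      (((contDiff_const.mul (contDiff_qf.mul (contDiff_id.pow 2))).div contDiff_sqrt_Wf
        fun x => (sqrt_Wf_pos x).ne').div contDiff_sqrt_Wf fun x => (sqrt_Wf_pos x).ne'))
    rw [sub_zero] at h2
    refine h2.congr_of_eventuallyEq (Eventually.of_forall fun s => ?_)
    simp only [upsL, Pi.sub_apply]
    ring
  set u' := -(3 / 5 * Real.sin t) / √(Wf (Real.cos (phi t))) with hu'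
  have hs : HasDerivAt (fun t => Real.sin (phi t)) 0 t := by
    have := hφ.sin
    rwa [mul_zero] at this
  have hE : HasDerivAt (fun t => Complex.exp ((2 * phi t : ℝ) * Complex.I)) 0 t := by
    have := ((hφ.const_mul 2).ofReal_comp.mul_const Complex.I).cexp
    simpa using this
  have hR : HasDerivAt (fun t => -((1 - l) * qf (Real.cos (phi t))) -
      upsL l t * cL l (Real.cos (phi t))) (-(u' * cL l (Real.cos (phi t)))) t := by
    have := ((hcomp (g := fun x => -((1 - l) * qf x)) (contDiff_const.mul contDiff_qf).neg).sub
      (hu.mul (hcomp (g := cL l) (by unfold cL; fun_prop))))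
    refine this.congr_deriv ?_
    ring
  have hI : HasDerivAt (fun t => upsL l t * Real.sin (phi t)) (u' * Real.sin (phi t)) t := by
    refine (hu.mul hs).congr_deriv ?_
    ring
  have hY : HasDerivAt (yL l) _ t := hE.mul (hR.ofReal_comp.add (hI.ofReal_comp.mul_const Complex.I))
  rw [hY.deriv, zero_mul, zero_add, yL, mul_left_comm] at hy
  have h := mul_left_cancel₀ (exp_two_mul_ne_zero (phi t)) hy
  obtain ⟨hre, him⟩ := re_im_of_eq_mul h
  have hu0 : upsL l t * √(Wf (Real.cos (phi t))) = -
      ((1 - l) * (qf (Real.cos (phi t)) * Real.cos (phi t) ^ 2) / √(Wf (Real.cos (phi t)))) := by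
    rw [upsL, div_mul_cancel₀ _ hw.ne', ht]
    ring
  have hsin : Real.sin t ≠ 0 := by
    intro h0
    have := Real.sin_sq_add_cos_sq t
    rw [h0, ht] at this
    norm_num at this
  have hu'0 : u' ≠ 0 := by
    rw [hu']
    exact div_ne_zero (neg_ne_zero.2 (mul_ne_zero (by norm_num) hsin)) hw.ne'
  have hS : Real.sin (phi t) ≠ 0 := by
    intro h0
    have := qf_mul_sin_phi t
    rw [h0, mul_zero] at this
    exact mul_ne_zero (mul_ne_zero (by norm_num) hsin) hw.ne' this.symm
  have h1 : u' = ρ * upsL l t := by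
    have : (u' - ρ * upsL l t) * Real.sin (phi t) = 0 := by linear_combination him
    linarith [(mul_eq_zero.1 this).resolve_right hS]
  have h2 : ρ * ((1 - l) * qf (Real.cos (phi t))) = 0 := by
    rw [h1] at hre
    linear_combination hre
  rcases mul_eq_zero.1 h2 with h3 | h3
  · rw [h3, zero_mul] at h1
    exact hu'0 h1
  · have hl0 : 1 - l = 0 := (mul_eq_zero.1 h3).resolve_right (qf_pos _).ne'
    rw [hl0] at hu0
    simp only [zero_mul, zero_div, neg_zero] at hu0
    rw [(mul_eq_zero.1 hu0).resolve_right hw.ne', mul_zero] at h1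
    exact hu'0 h1

/-- The algebraic core of the embeddedness of `knotL`: no two points with opposite `x` and `υ > 0`
at the first one lie on a common ray. -/
theorem no_opposite_pair {l : ℝ} (hl : l ∈ Icc (0 : ℝ) 1) {x S w c c' s s' υ υ' k : ℝ}
    (hx1 : -(1 / 5) ≤ x) (hx2 : x ≤ 1 / 5) (hS : 0 < S) (hw : 0 < w)
    (hc : s ^ 2 + c ^ 2 = 1) (hc' : s' ^ 2 + c' ^ 2 = 1)
    (hs : qf x * S = 3 / 5 * s * w) (hs' : qf (-x) * (-S) = 3 / 5 * s' * w)
    (hu : υ * w = 3 / 5 * c - (1 - l) * (qf x * x ^ 2) / w)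
    (hu' : υ' * w = 3 / 5 * c' - (1 - l) * (qf (-x) * x ^ 2) / w)
    (hυ : 0 < υ) (hk : 1 + 2 * υ < k) (him : υ = -(k * υ'))
    (hre : (1 - l) * qf x + υ * cL l x = k * ((1 - l) * qf (-x) + υ' * cL l x)) : False := by
  have hq := qf_pos x
  have hq' := qf_pos (-x)
  have hk0 : 0 < k := by linarith
  have hυ' : υ' < 0 := by
    by_contra hn
    have := mul_nonneg hk0.le (not_lt.1 hn)
    linarith
  have hsum : 0 < υ + υ' := by linarith [mul_pos (show 0 < k - 1 by linarith) (neg_pos.2 hυ')]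
  have hl1 : 0 ≤ 1 - l := by linarith [hl.2]
  have hb : 0 ≤ (1 - l) * (qf x * x ^ 2) / w :=
    div_nonneg (mul_nonneg hl1 (mul_nonneg hq.le (sq_nonneg x))) hw.le
  have hb' : 0 ≤ (1 - l) * (qf (-x) * x ^ 2) / w :=
    div_nonneg (mul_nonneg hl1 (mul_nonneg hq'.le (sq_nonneg x))) hw.le
  rcases lt_or_ge (qf (-x)) (qf x) with h | h
  · have hs0 : 0 < s := by
      by_contra hn
      have h1 := mul_pos hq hS
      have h2 : 3 / 5 * s * w ≤ 0 :=
        mul_nonpos_of_nonpos_of_nonneg (by linarith) hw.le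
      linarith
    have hss : -s' < s := by
      have h1 : qf (-x) * S < qf x * S := mul_lt_mul_of_pos_right h hS
      have h2 : 3 / 5 * (-s') * w < 3 / 5 * s * w := by linarith
      have h3 := lt_of_mul_lt_mul_right h2 hw.le
      linarith
    have hs'0 : 0 < -s' := by
      by_contra hn
      have h1 := mul_pos hq' hS
      have h2 : 3 / 5 * (-s') * w ≤ 0 :=
        mul_nonpos_of_nonpos_of_nonneg (by linarith) hw.le
      linarith
    have hcc : c ^ 2 < c' ^ 2 := by
      have := pow_lt_pow_left₀ hss hs'0.le two_ne_zero
      rw [neg_sq] at this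
      linarith
    have hcs : 0 < c + c' := by linarith [mul_pos hsum hw]
    have hcc' : c < c' := by
      by_contra hn
      linarith [mul_nonneg (sub_nonneg.2 (not_lt.1 hn)) hcs.le]
    have hbb : (1 - l) * (qf (-x) * x ^ 2) / w ≤ (1 - l) * (qf x * x ^ 2) / w := by
      apply div_le_div_of_nonneg_right _ hw.le
      apply mul_le_mul_of_nonneg_left _ hl1
      exact mul_le_mul_of_nonneg_right h.le (sq_nonneg x)
    linarith [mul_pos hυ hw, mul_neg_of_neg_of_pos hυ' hw]
  · have hx0 : 0 ≤ x := by
      unfold qf at h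
      linarith
    have hq'1 : 13 / 25 ≤ qf (-x) := by
      unfold qf
      linarith [sq_nonneg x]
    have e1 : k * ((1 - l) * qf (-x)) = (1 - l) * qf x + 2 * υ * cL l x := by
      have : k * υ' = -υ := by linarith
      linear_combination -hre - cL l x * this
    have e2 : (k - 1) * ((1 - l) * qf (-x)) ≤ 2 * υ * cL l x := by
      linarith [mul_le_mul_of_nonneg_left h hl1]
    have e3 : 2 * υ * ((1 - l) * qf (-x)) ≤ 2 * υ * cL l x := by
      have : 2 * υ * ((1 - l) * qf (-x)) ≤ (k - 1) * ((1 - l) * qf (-x)) :=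
        mul_le_mul_of_nonneg_right (by linarith) (mul_nonneg hl1 hq'.le)
      linarith
    have e4 : (1 - l) * qf (-x) ≤ cL l x := le_of_mul_le_mul_left e3 (by linarith)
    unfold cL at e4
    have hxx : x ^ 2 ≤ 1 / 25 := by nlinarith
    have e5 : (1 - l) * (13 / 25) ≤ (1 - l) * qf (-x) := mul_le_mul_of_nonneg_left hq'1 hl1
    linarith [mul_le_mul_of_nonneg_left hxx hl1, mul_le_mul_of_nonneg_left hxx hl.1, hl.1]

/-- Two points of `knotL` whose angles `φ` differ by `π`, so that the arguments `2φ` of their first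
coordinates differ by `2π`, do not lie on a common ray. -/
theorem knotL_opposite_angle {l : ℝ} (hl : l ∈ Icc (0 : ℝ) 1) (s t k : ℝ) (hk : 0 < k)
    (hφ : phi s = phi t + Real.pi) (hs0 : 0 < Real.sin s) (ht0 : Real.sin t < 0)
    (hr : ff (upsL l s) = k * ff (upsL l t)) (hy : yL l s = k * yL l t) : False := by
  have hcx : Real.cos (phi t) = -Real.cos (phi s) := by rw [hφ, Real.cos_add_pi, neg_neg]
  have hsx : Real.sin (phi t) = -Real.sin (phi s) := by rw [hφ, Real.sin_add_pi, neg_neg]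
  have hx1 := cos_phi_gt s
  have hx2 := cos_phi_gt t
  have hQs := qf_mul_sin_phi s
  have hQt := qf_mul_sin_phi t
  have hE : Complex.exp ((2 * phi s : ℝ) * Complex.I) =
      Complex.exp ((2 * phi t : ℝ) * Complex.I) := by
    have : ((2 * phi s : ℝ) * Complex.I : ℂ) = (2 * phi t : ℝ) * Complex.I +
        2 * Real.pi * Complex.I := by
      rw [hφ]
      push_cast
      ring
    rw [this, Complex.exp_add, Complex.exp_two_pi_mul_I, mul_one]
  simp only [yL] at hy
  rw [hE, mul_left_comm] at hy
  obtain ⟨hre, him⟩ := re_im_of_eq_mul (mul_left_cancel₀ (exp_two_mul_ne_zero (phi t)) hy)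
  have hw := sqrt_Wf_pos (Real.cos (phi s))
  have hWe : Wf (-Real.cos (phi s)) = Wf (Real.cos (phi s)) := by
    unfold Wf
    ring
  have hu : upsL l s * √(Wf (Real.cos (phi s))) = 3 / 5 * Real.cos s -
      (1 - l) * (qf (Real.cos (phi s)) * Real.cos (phi s) ^ 2) / √(Wf (Real.cos (phi s))) := by
    rw [upsL, div_mul_cancel₀ _ hw.ne']
  have hu' : upsL l t * √(Wf (Real.cos (phi s))) = 3 / 5 * Real.cos t -
      (1 - l) * (qf (-Real.cos (phi s)) * Real.cos (phi s) ^ 2) / √(Wf (Real.cos (phi s))) := by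
    rw [upsL, hcx, hWe, neg_sq, div_mul_cancel₀ _ hw.ne']
  rw [hcx] at hx2 hre hQt
  rw [hsx] at him hQt
  rw [hWe] at hQt
  have hcLe : cL l (-Real.cos (phi s)) = cL l (Real.cos (phi s)) := by
    unfold cL
    ring
  rw [hcLe] at hre
  have hbs := abs_upsL_lt hl s
  have hbt := abs_upsL_lt hl t
  have hscs := Real.sin_sq_add_cos_sq s
  have hsct := Real.sin_sq_add_cos_sq t
  have hsct' : (-Real.sin t) ^ 2 + Real.cos t ^ 2 = 1 := by rw [neg_sq, hsct]
  have hscs' : (-Real.sin s) ^ 2 + Real.cos s ^ 2 = 1 := by rw [neg_sq, hscs]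
  have hqs := qf_pos (Real.cos (phi s))
  have hqt := qf_pos (-Real.cos (phi s))
  set x := Real.cos (phi s) with hxdef
  set S := Real.sin (phi s)
  set υ := upsL l s
  set υ' := upsL l t
  set w := √(Wf x)
  have hS : 0 < S := by
    by_contra hn
    have : 0 < 3 / 5 * Real.sin s * w := by positivity
    linarith [mul_nonpos_of_nonneg_of_nonpos hqs.le (not_lt.1 hn)]
  have him' : υ = -(k * υ') := by
    have : (υ + k * υ') * S = 0 := by linear_combination him
    linarith [(mul_eq_zero.1 this).resolve_right hS.ne']
  rcases lt_trichotomy υ 0 with h | h | h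
  · -- exchange the roles of the two points
    have hυ' : 0 < υ' := by
      by_contra hn
      linarith [mul_nonpos_of_nonneg_of_nonpos hk.le (not_lt.1 hn)]
    have hki := inv_pos.2 hk
    have hkk : k⁻¹ * k = 1 := inv_mul_cancel₀ hk.ne'
    have hr' : ff υ' = k⁻¹ * ff υ := by
      rw [hr]
      linear_combination -(ff υ') * hkk
    have hcL' : cL l (-x) = cL l x := hcLe
    refine no_opposite_pair hl (x := -x) (S := S) (w := w) (c := Real.cos t) (c' := Real.cos s)
      (s := -Real.sin t) (s' := -Real.sin s) (υ := υ') (υ' := υ) (k := k⁻¹)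
      (by linarith) (by linarith) hS hw hsct' hscs' (by linarith) ?_ ?_ ?_ hυ'
      (ff_ratio hbt hbs hυ' h hr') ?_ ?_
    · rw [neg_neg]
      linarith
    · rw [neg_sq]
      exact hu'
    · rw [neg_neg, neg_sq]
      exact hu
    · rw [him']
      linear_combination -υ' * hkk
    · rw [hcL', neg_neg]
      linear_combination k⁻¹ * hre + (-((1 - l) * qf (-x)) - υ' * cL l x) * hkk
  · rw [h] at him' hr hre
    have hυ' : υ' = 0 := by
      have : k * υ' = 0 := by linarith
      exact (mul_eq_zero.1 this).resolve_left hk.ne'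
    rw [hυ'] at hr hre
    have hk1 : k = 1 := by
      have := ff_pos (υ := 0) (by norm_num)
      have h2 : (k - 1) * ff 0 = 0 := by linarith
      linarith [(mul_eq_zero.1 h2).resolve_right this.ne']
    rw [h] at hu
    rw [hυ'] at hu'
    have hz : (1 - l) * x = 0 := by
      rw [hk1] at hre
      unfold qf at hre
      linear_combination (1 / 2 : ℝ) * hre
    have hz' : (1 - l) * (qf x * x ^ 2) = 0 := by
      linear_combination (qf x * x) * hz
    have hz'' : (1 - l) * (qf (-x) * x ^ 2) = 0 := by
      linear_combination (qf (-x) * x) * hz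
    rw [hz'] at hu
    rw [hz''] at hu'
    have hc1 : Real.cos s = 0 := by
      rw [zero_div] at hu
      linarith
    have hc2 : Real.cos t = 0 := by
      rw [zero_div] at hu'
      linarith
    have hsin1 : Real.sin s = 1 := by
      rw [hc1] at hscs
      have : (Real.sin s - 1) * (Real.sin s + 1) = 0 := by linear_combination hscs
      rcases mul_eq_zero.1 this with h | h <;> linarith
    have hsin2 : Real.sin t = -1 := by
      rw [hc2] at hsct
      have : (Real.sin t - 1) * (Real.sin t + 1) = 0 := by linear_combination hsct
      rcases mul_eq_zero.1 this with h | h <;> linarith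
    simp only [phi] at hφ
    rw [hsin1, hsin2, angle_neg (by norm_num)] at hφ
    linarith [pi_div_two_lt_angle_one]
  · have hυ' : υ' < 0 := by
      by_contra hn
      have := mul_nonneg hk.le (not_lt.1 hn)
      linarith
    refine no_opposite_pair hl (x := x) (S := S) (w := w) (c := Real.cos s) (c' := Real.cos t)
      (s := Real.sin s) (s' := Real.sin t) (υ := υ) (υ' := υ') (k := k)
      hx1.le (by linarith) hS hw hscs hsct hQs hQt hu hu' h (ff_ratio hbs hbt h hυ' hr) him' ?_
    linear_combination -hre

theorem isConeKnot_knotL {l : ℝ} (hl : l ∈ Icc (0 : ℝ) 1) : IsConeKnot (knotL l) := by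
  have hpair : ContDiff ℝ ∞ (fun t : ℝ => (l, t)) := contDiff_const.prodMk contDiff_id
  have hups : ContDiff ℝ ∞ (upsL l) := 
    ContDiff.comp (g := fun p : ℝ × ℝ => upsL p.1 p.2) (f := fun t : ℝ => (l, t)) contDiff_upsL hpair
  have h1 : (1 : ℝ) ∈ Icc (-1 : ℝ) 1 := by norm_num
  have hperu : ∀ t, upsL l (t + 2 * Real.pi) = upsL l t := fun t => by
    simp only [upsL, phi_add_two_pi, Real.cos_add_two_pi]
  have hys : ContDiff ℝ ∞ (yL l) := 
    ContDiff.comp (g := fun p : ℝ × ℝ => yL p.1 p.2) (f := fun t : ℝ => (l, t)) contDiff_yL hpair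
  have hΘs : ContDiff ℝ ∞ (fun t => 2 * phi t) := contDiff_const.mul contDiff_phi
  have hrs : ContDiff ℝ ∞ (fun t => ff (upsL l t)) := by
    rw [contDiff_iff_contDiffAt]
    intro t
    exact ContDiffAt.comp (g := ff) t (contDiffAt_ff (abs_upsL_lt hl t)) hups.contDiffAt
  suffices key : IsConeKnot (fun t => ((ff (upsL l t) : ℂ) *
    Complex.exp ((2 * phi t : ℝ) * Complex.I), yL l t)) from key
  refine isConeKnot_of_angle (r := fun t => ff (upsL l t)) (Θ := fun t => 2 * phi t) (y := yL l)
    (fun v => 2 * angle v) (fun _ => rfl) ?_ ?_ ?_ ?_ hrs hΘs hys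
    (fun t => ff_pos (abs_upsL_lt hl t)) ?_ ?_ ?_ ?_ ?_
  · intro v hv w hw h
    have := angle_lt_angle hv hw h
    change 2 * angle v < 2 * angle w
    linarith
  · intro v hv
    rw [angle_neg hv]
    ring
  · have := (abs_lt.1 (abs_angle_lt h1)).2
    have := φmax_lt_pi
    change 2 * angle 1 < _
    linarith
  · intro t h
    have h2 : deriv (fun t => 2 * phi t) t = 2 * deriv phi t :=
      ((hasDerivAt_phi t).differentiableAt.hasDerivAt.const_mul 2).deriv
    rw [h2] at h
    exact cos_eq_zero_of_deriv_phi (by linarith)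
  · intro t
    rw [hperu]
  · intro t
    simp only [yL, phi_add_two_pi, hperu]
  · intro t k hk _ hy
    exact knotL_same_angle t k hk hy
  · intro s t k hk hs ht hΘ hr hy
    exact knotL_opposite_angle hl s t k hk (by linarith) hs ht hr hy
  · intro t ρ ht _ hy
    exact knotL_regular ht hy

/-! ### The family of knots between the closed braid and the angle function -/

/-- The logarithm of a curve in `ℂ ∖ 0`, as the integral of its logarithmic derivative. -/
theorem exists_smooth_log {p p' : ℝ → ℂ} (hp : ContDiff ℝ ∞ p) (hp' : ContDiff ℝ ∞ p')
    (hd : ∀ v, HasDerivAt p (p' v) v) (h0 : ∀ v, p v ≠ 0) (h1 : p 0 = 1) :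
    ∃ Λ : ℝ → ℂ, ContDiff ℝ ∞ Λ ∧ Λ 0 = 0 ∧ (∀ v, HasDerivAt Λ (p' v / p v) v) ∧
      ∀ v, Complex.exp (Λ v) = p v := by
  have hq : ContDiff ℝ ∞ (fun v => p' v / p v) := by
    simp only [div_eq_mul_inv]
    exact hp'.mul (hp.inv h0)
  have hΛ : ∀ v, HasDerivAt (fun v => ∫ s in (0 : ℝ)..v, p' s / p s) (p' v / p v) v := fun v =>
    intervalIntegral.integral_hasDerivAt_right (hq.continuous.intervalIntegrable _ _)
      hq.continuous.aestronglyMeasurable.stronglyMeasurableAtFilter hq.continuous.continuousAt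
  refine ⟨fun v => ∫ s in (0 : ℝ)..v, p' s / p s, ?_, by simp, hΛ, fun v => ?_⟩
  · rw [contDiff_infty_iff_deriv]
    refine ⟨fun v => (hΛ v).differentiableAt, ?_⟩
    have : deriv (fun v => ∫ s in (0 : ℝ)..v, p' s / p s) = fun v => p' v / p v :=
      funext fun v => (hΛ v).deriv
    rw [this]
    exact hq
  · set Λ : ℝ → ℂ := fun v => ∫ s in (0 : ℝ)..v, p' s / p s
    have h2 : ∀ v, HasDerivAt (fun v => p v * Complex.exp (-Λ v)) 0 v := by
      intro v
      have := (hd v).mul (hΛ v).neg.cexp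
      refine this.congr_deriv ?_
      change p' v * Complex.exp (-Λ v) + p v * (Complex.exp (-Λ v) * -(p' v / p v)) = 0
      have := h0 v
      field_simp
      ring
    have h3 := is_const_of_deriv_eq_zero (fun v => (h2 v).differentiableAt) (fun v => (h2 v).deriv) v 0
    have h4 : Λ 0 = 0 := by simp [Λ]
    simp only [h4, h1, neg_zero, Complex.exp_zero, one_mul, Complex.exp_neg] at h3
    exact (eq_of_mul_inv_eq_one h3).symm

/-- The first coordinate of the closed braid, as a function of `sin t`. -/
def pL (v : ℝ) : ℂ := (1 - 2 * v ^ 2 : ℝ) + (v * (3 - 4 * v ^ 2) : ℝ) * Complex.I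

theorem pL_re (v : ℝ) : (pL v).re = 1 - 2 * v ^ 2 := by simp [pL, -Complex.ofReal_sub, -Complex.ofReal_mul]

theorem pL_im (v : ℝ) : (pL v).im = v * (3 - 4 * v ^ 2) := by
  simp [pL, -Complex.ofReal_sub, -Complex.ofReal_mul]

theorem pL_ne_zero (v : ℝ) : pL v ≠ 0 := by
  intro h
  have h1 := pL_re v
  have h2 := pL_im v
  rw [h] at h1 h2
  simp only [Complex.zero_re, Complex.zero_im] at h1 h2
  rcases mul_eq_zero.1 h2.symm with h3 | h3
  · rw [h3] at h1
    norm_num at h1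
  · linarith

theorem exists_log_pL : ∃ Λ : ℝ → ℂ, ContDiff ℝ ∞ Λ ∧ Λ 0 = 0 ∧
    (∀ v, HasDerivAt Λ (((-(4 * v) : ℝ) + (3 - 12 * v ^ 2 : ℝ) * Complex.I) / pL v) v) ∧
      ∀ v, Complex.exp (Λ v) = pL v := by
  have hof : ∀ {g : ℝ → ℝ}, ContDiff ℝ ∞ g → ContDiff ℝ ∞ (fun p => (g p : ℂ)) :=
    fun h => Complex.ofRealCLM.contDiff.comp h
  have ha : ContDiff ℝ ∞ pL :=
    (hof (g := fun v => 1 - 2 * v ^ 2) (by fun_prop)).add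
      ((hof (g := fun v => v * (3 - 4 * v ^ 2)) (by fun_prop)).mul contDiff_const)
  have hb : ContDiff ℝ ∞ (fun v : ℝ => ((-(4 * v) : ℝ) + (3 - 12 * v ^ 2 : ℝ) * Complex.I : ℂ)) :=
    (hof (g := fun v => -(4 * v)) (by fun_prop)).add
      ((hof (g := fun v => 3 - 12 * v ^ 2) (by fun_prop)).mul contDiff_const)
  refine exists_smooth_log ha hb (fun v => ?_) pL_ne_zero (by simp [pL])
  have h1 : HasDerivAt (fun v : ℝ => 1 - 2 * v ^ 2) (-(4 * v)) v := by
    refine (((hasDerivAt_id v).pow 2).const_mul 2 |>.const_sub 1).congr_deriv ?_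
    simp
    ring
  have h2 : HasDerivAt (fun v : ℝ => v * (3 - 4 * v ^ 2)) (3 - 12 * v ^ 2) v := by
    refine ((hasDerivAt_id v).mul (((hasDerivAt_id v).pow 2).const_mul 4 |>.const_sub 3)).congr_deriv ?_
    simp
    ring
  exact h1.ofReal_comp.add (h2.ofReal_comp.mul_const Complex.I)

/-- A smooth logarithm of `pL`. -/
def logL : ℝ → ℂ := Classical.choose exists_log_pL

theorem contDiff_logL : ContDiff ℝ ∞ logL := (Classical.choose_spec exists_log_pL).1

theorem logL_zero : logL 0 = 0 := (Classical.choose_spec exists_log_pL).2.1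

theorem hasDerivAt_logL (v : ℝ) :
    HasDerivAt logL (((-(4 * v) : ℝ) + (3 - 12 * v ^ 2 : ℝ) * Complex.I) / pL v) v :=
  (Classical.choose_spec exists_log_pL).2.2.1 v

theorem exp_logL (v : ℝ) : Complex.exp (logL v) = pL v := (Classical.choose_spec exists_log_pL).2.2.2 v

theorem pL_eq (v : ℝ) :
    ((Real.exp (logL v).re : ℝ) : ℂ) * Complex.exp ((logL v).im * Complex.I) = pL v := by
  rw [Complex.ofReal_exp, ← Complex.exp_add, Complex.re_add_im, exp_logL]

theorem contDiff_logL_im : ContDiff ℝ ∞ (fun v => (logL v).im) :=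
  Complex.imCLM.contDiff.comp contDiff_logL

theorem deriv_logL_im_pos (v : ℝ) : 0 < deriv (fun v => (logL v).im) v := by
  have h : HasDerivAt (fun v => (logL v).im) _ v :=
    Complex.imCLM.hasFDerivAt.comp_hasDerivAt v (hasDerivAt_logL v)
  rw [h.deriv]
  have hn : 0 < Complex.normSq (pL v) := Complex.normSq_pos.2 (pL_ne_zero v)
  have e : ∀ a b : ℝ, Complex.imCLM (((a : ℂ) + b * Complex.I) / pL v) =
      (b * (pL v).re - a * (pL v).im) / Complex.normSq (pL v) := by
    intro a b
    rw [Complex.imCLM_apply, Complex.div_im]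
    simp
    ring
  rw [e, pL_re, pL_im]
  apply div_pos _ hn
  nlinarith [sq_nonneg (v ^ 2 - 3 / 8)]

theorem logL_im_neg (v : ℝ) : (logL (-v)).im = -(logL v).im := by
  have h1 : ∀ v, HasDerivAt (fun v => (logL (-v)).im + (logL v).im) 0 v := by
    intro v
    have ha : HasDerivAt (fun v => (logL v).im) _ v :=
      Complex.imCLM.hasFDerivAt.comp_hasDerivAt v (hasDerivAt_logL v)
    have hb : HasDerivAt (fun v => (logL (-v)).im) _ v :=
      Complex.imCLM.hasFDerivAt.comp_hasDerivAt v
        ((hasDerivAt_logL (-v)).scomp v (hasDerivAt_neg v))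
    refine (hb.add ha).congr_deriv ?_
    have e : ∀ v, Complex.imCLM ((((-(4 * v) : ℝ) : ℂ) + (3 - 12 * v ^ 2 : ℝ) * Complex.I) / pL v) =
        (3 - 6 * v ^ 2 + 8 * v ^ 4) / ((1 - 2 * v ^ 2) ^ 2 + (v * (3 - 4 * v ^ 2)) ^ 2) := by
      intro v
      rw [Complex.imCLM_apply, Complex.div_im, Complex.normSq_apply, pL_re, pL_im]
      simp only [Complex.add_im, Complex.add_re, Complex.mul_im, Complex.mul_re, Complex.ofReal_re,
        Complex.ofReal_im, Complex.I_re, Complex.I_im]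
      rw [← sub_div]
      congr 1 <;> ring
    rw [map_smul, e, e, smul_eq_mul]
    ring
  have h2 := is_const_of_deriv_eq_zero (fun v => (h1 v).differentiableAt) (fun v => (h1 v).deriv) v 0
  simp only [neg_zero, logL_zero, Complex.zero_im, add_zero] at h2
  linarith

theorem strictMono_logL_im : StrictMono (fun v => (logL v).im) :=
  strictMono_of_deriv_pos deriv_logL_im_pos

theorem logL_im_one : Real.pi < (logL 1).im ∧ (logL 1).im < 2 * Real.pi := by
  have him : ∀ v, (pL v).im = Real.exp (logL v).re * Real.sin (logL v).im := by
    intro v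
    rw [← exp_logL, Complex.exp_im]
  have hre : ∀ v, (pL v).re = Real.exp (logL v).re * Real.cos (logL v).im := by
    intro v
    rw [← exp_logL, Complex.exp_re]
  have h0 : 0 < (logL 1).im := by
    have := strictMono_logL_im (zero_lt_one' ℝ)
    simpa only [logL_zero, Complex.zero_im] using this
  constructor
  · by_contra hn
    have h1 := Real.sin_nonneg_of_nonneg_of_le_pi h0.le (not_lt.1 hn)
    have h2 := him 1
    rw [pL_im] at h2
    have := mul_nonneg (Real.exp_pos (logL 1).re).le h1
    linarith
  · by_contra hn
    have hmem : 2 * Real.pi ∈ Icc ((fun v => (logL v).im) 0) ((fun v => (logL v).im) 1) := by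
      refine ⟨?_, not_lt.1 hn⟩
      simp only [logL_zero, Complex.zero_im]
      positivity
    obtain ⟨v, hv, he⟩ := intermediate_value_Icc zero_le_one
      contDiff_logL_im.continuous.continuousOn hmem
    change (logL v).im = _ at he
    have h1 := him v
    have h2 := hre v
    rw [he, Real.sin_two_pi, mul_zero, pL_im] at h1
    rw [he, Real.cos_two_pi, mul_one, pL_re] at h2
    have h3 := Real.exp_pos (logL v).re
    rcases mul_eq_zero.1 h1 with h4 | h4
    · rw [h4, logL_zero] at he
      simp at he
    · nlinarith

/-- At the end `l = 1` of the family `knotM`, the second coordinate is `-cos t (aM t + i bM t)`; this is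
the real part. -/
def aM (t : ℝ) : ℝ := 3 / 5 * ((3 / 2 * Real.cos (phi t) ^ 2 - 1 / 2) * (2 * Real.cos (phi t) ^ 2 - 1)
  + 2 * Real.cos (phi t) * (1 - Real.cos (phi t) ^ 2)) / √(Wf (Real.cos (phi t)))

/-- The imaginary part that goes with `aM`. -/
def bM (t : ℝ) : ℝ := 3 / 5 * (Real.sin (phi t) * (3 * Real.cos (phi t) ^ 3 - 2 * Real.cos (phi t) ^ 2
  - Real.cos (phi t) + 1)) / √(Wf (Real.cos (phi t)))

theorem aM_pos (t : ℝ) : 0 < aM t := by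
  have hx := cos_phi_gt t
  set x := Real.cos (phi t)
  refine div_pos (mul_pos (by norm_num) ?_) (sqrt_Wf_pos _)
  have h1 : 0 < 3 * x ^ 3 - 13 / 5 * x ^ 2 - 99 / 50 * x + 599 / 250 := by
    have := mul_nonneg (show 0 ≤ x + 1 / 5 by linarith) (sq_nonneg (x - 21 / 25))
    nlinarith [sq_nonneg (x - 21 / 25)]
  have h2 := mul_pos (show 0 < x + 1 / 5 by linarith) h1
  nlinarith

theorem sin_phi_pos {t : ℝ} (h : 0 < Real.sin t) : 0 < Real.sin (phi t) := by
  have h1 := qf_mul_sin_phi t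
  have h2 : 0 < 3 / 5 * Real.sin t * √(Wf (Real.cos (phi t))) := by
    have := sqrt_Wf_pos (Real.cos (phi t))
    positivity
  rw [← h1] at h2
  exact pos_of_mul_pos_right h2 (qf_pos _).le

theorem sin_phi_neg {t : ℝ} (h : Real.sin t < 0) : Real.sin (phi t) < 0 := by
  have h1 := qf_mul_sin_phi t
  have h2 : 3 / 5 * Real.sin t * √(Wf (Real.cos (phi t))) < 0 :=
    mul_neg_of_neg_of_pos (by linarith) (sqrt_Wf_pos _)
  rw [← h1] at h2
  by_contra hn
  exact absurd h2 (not_lt.2 (mul_nonneg (qf_pos _).le (not_lt.1 hn)))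

theorem bM_factor_pos (t : ℝ) :
    0 < 3 * Real.cos (phi t) ^ 3 - 2 * Real.cos (phi t) ^ 2 - Real.cos (phi t) + 1 := by
  have hx := cos_phi_gt t
  set x := Real.cos (phi t)
  have := mul_nonneg (show 0 ≤ x + 1 / 5 by linarith) (sq_nonneg (x - 31 / 50))
  nlinarith [sq_nonneg (x - 31 / 50)]

theorem bM_pos {t : ℝ} (h : 0 < Real.sin t) : 0 < bM t :=
  div_pos (mul_pos (by norm_num) (mul_pos (sin_phi_pos h) (bM_factor_pos t))) (sqrt_Wf_pos _)

theorem bM_neg {t : ℝ} (h : Real.sin t < 0) : bM t < 0 :=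
  div_neg_of_neg_of_pos (mul_neg_of_pos_of_neg (by norm_num)
    (mul_neg_of_neg_of_pos (sin_phi_neg h) (bM_factor_pos t))) (sqrt_Wf_pos _)

theorem contDiff_aM : ContDiff ℝ ∞ aM := by
  have hx := contDiff_cos_phi
  exact ContDiff.div (by fun_prop) (contDiff_sqrt_Wf.comp hx) fun t => (sqrt_Wf_pos _).ne'

theorem contDiff_bM : ContDiff ℝ ∞ bM := by
  have hx := contDiff_cos_phi
  have hs : ContDiff ℝ ∞ (fun t => Real.sin (phi t)) := Real.contDiff_sin.comp contDiff_phi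
  exact ContDiff.div (by fun_prop) (contDiff_sqrt_Wf.comp hx) fun t => (sqrt_Wf_pos _).ne'

/-- The absolute value of the first coordinate in the family `knotM`. -/
def rM (l t : ℝ) : ℝ := (1 - l) * Real.exp (logL (Real.sin t)).re + l * ff (upsL 1 t)

/-- The argument of the first coordinate in the family `knotM`, an increasing function of `sin t`. -/
def ΘM (l t : ℝ) : ℝ := (1 - l) * (logL (Real.sin t)).im + l * (2 * phi t)

/-- The second coordinate in the family `knotM`. -/
def yM (l t : ℝ) : ℂ := ((-Real.cos t : ℝ) : ℂ) *
  (((1 - l) * (1 / 2) + l * aM t : ℝ) + ((1 - l) * (2 * Real.sin t) + l * bM t : ℝ) * Complex.I)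

/-- A family of knots that is linear in the polar coordinates of the first coordinate. At `l = 0` it is
the closed braid after a linear change of coordinates (`knotM_zero`), at `l = 1` it is `knotL 1`
(`knotM_one`). The real part of the factor of `-cos t` in the second coordinate is positive and
its imaginary part has the sign of `sin t`, which keeps the knots embedded. -/
def knotM (l t : ℝ) : ℂ × ℂ := ((rM l t : ℂ) * Complex.exp (ΘM l t * Complex.I), yM l t)

theorem knotM_zero (t : ℝ) : knotM 0 t = (pL (Real.sin t),
    ((-Real.cos t : ℝ) : ℂ) * ((1 / 2 : ℝ) + (2 * Real.sin t : ℝ) * Complex.I)) := by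
  simp only [knotM, rM, ΘM, yM, sub_zero, zero_mul, one_mul, add_zero, pL_eq]

theorem knotM_one (t : ℝ) : knotM 1 t = knotL 1 t := by
  simp only [knotM, rM, ΘM, yM, sub_self, zero_mul, one_mul, zero_add, knotL]
  refine Prod.ext rfl ?_
  change _ = yL 1 t
  have hu : upsL 1 t = 3 / 5 * Real.cos t / √(Wf (Real.cos (phi t))) := by simp [upsL]
  rw [yL, hu, Complex.exp_mul_I, ← Complex.ofReal_cos, ← Complex.ofReal_sin, Real.cos_two_mul,
    Real.sin_two_mul, aM, bM, cL]
  have hw := (sqrt_Wf_pos (Real.cos (phi t))).ne'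
  have hsc := Real.sin_sq_add_cos_sq (phi t)
  set x := Real.cos (phi t)
  set S := Real.sin (phi t)
  set w := √(Wf x)
  apply Complex.ext
  · simp only [Complex.mul_re, Complex.add_re, Complex.add_im, Complex.mul_im, Complex.ofReal_re,
      Complex.ofReal_im, Complex.I_re, Complex.I_im]
    field_simp
    linear_combination (12 * Real.cos t * x) * hsc
  · simp only [Complex.mul_re, Complex.add_re, Complex.add_im, Complex.mul_im, Complex.ofReal_re,
      Complex.ofReal_im, Complex.I_re, Complex.I_im]
    field_simp
    ring

theorem rM_pos {l : ℝ} (hl : l ∈ Icc (0 : ℝ) 1) (t : ℝ) : 0 < rM l t := by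
  have h1 := Real.exp_pos (logL (Real.sin t)).re
  have h2 := ff_pos (abs_upsL_lt (l := 1) (by norm_num) t)
  unfold rM
  rcases hl.1.eq_or_lt with rfl | h
  · simpa using h1
  · have := mul_pos h h2
    have := mul_nonneg (sub_nonneg.2 hl.2) h1.le
    linarith

theorem contDiff_pair_left {E : Type*} [NormedAddCommGroup E] [NormedSpace ℝ E] {g : ℝ × ℝ → E}
    (hg : ContDiff ℝ ∞ g) (l : ℝ) : ContDiff ℝ ∞ (fun t => g (l, t)) :=
  hg.comp (contDiff_const.prodMk contDiff_id)

theorem contDiff_rM : ContDiff ℝ ∞ (fun p : ℝ × ℝ => rM p.1 p.2) := by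
  have h1 : ContDiff ℝ ∞ (fun t => Real.exp (logL (Real.sin t)).re) :=
    Real.contDiff_exp.comp (Complex.reCLM.contDiff.comp (contDiff_logL.comp Real.contDiff_sin))
  have hu : ContDiff ℝ ∞ (upsL 1) := contDiff_pair_left contDiff_upsL 1
  have h2 : ContDiff ℝ ∞ (fun t => ff (upsL 1 t)) := by
    rw [contDiff_iff_contDiffAt]
    intro t
    exact ContDiffAt.comp (g := ff) t (contDiffAt_ff (abs_upsL_lt (by norm_num) t)) hu.contDiffAt
  exact ((contDiff_const.sub contDiff_fst).mul (h1.comp contDiff_snd)).add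
    (contDiff_fst.mul (h2.comp contDiff_snd))

theorem contDiff_ΘM : ContDiff ℝ ∞ (fun p : ℝ × ℝ => ΘM p.1 p.2) := by
  have h1 : ContDiff ℝ ∞ (fun t => (logL (Real.sin t)).im) :=
    contDiff_logL_im.comp Real.contDiff_sin
  exact ((contDiff_const.sub contDiff_fst).mul (h1.comp contDiff_snd)).add
    (contDiff_fst.mul (contDiff_const.mul (contDiff_phi.comp contDiff_snd)))

theorem contDiff_yM : ContDiff ℝ ∞ (fun p : ℝ × ℝ => yM p.1 p.2) := by
  have hof : ∀ {g : ℝ × ℝ → ℝ}, ContDiff ℝ ∞ g → ContDiff ℝ ∞ (fun p => (g p : ℂ)) :=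
    fun h => Complex.ofRealCLM.contDiff.comp h
  have hc : ContDiff ℝ ∞ (fun p : ℝ × ℝ => Real.cos p.2) := Real.contDiff_cos.comp contDiff_snd
  have hs : ContDiff ℝ ∞ (fun p : ℝ × ℝ => Real.sin p.2) := Real.contDiff_sin.comp contDiff_snd
  have hl : ContDiff ℝ ∞ (fun p : ℝ × ℝ => 1 - p.1) := contDiff_const.sub contDiff_fst
  exact (hof hc.neg).mul ((hof ((hl.mul contDiff_const).add
    (contDiff_fst.mul (contDiff_aM.comp contDiff_snd)))).add
      ((hof ((hl.mul (contDiff_const.mul hs)).add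
        (contDiff_fst.mul (contDiff_bM.comp contDiff_snd)))).mul contDiff_const))

theorem contDiff_knotM : ContDiff ℝ ∞ (fun p : ℝ × ℝ => knotM p.1 p.2) := by
  have hof : ∀ {g : ℝ × ℝ → ℝ}, ContDiff ℝ ∞ g → ContDiff ℝ ∞ (fun p => (g p : ℂ)) :=
    fun h => Complex.ofRealCLM.contDiff.comp h
  exact ((hof contDiff_rM).mul ((hof contDiff_ΘM).mul contDiff_const).cexp).prodMk contDiff_yM

theorem isConeKnot_knotM {l : ℝ} (hl : l ∈ Icc (0 : ℝ) 1) : IsConeKnot (knotM l) := by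
  have hl1 : 0 ≤ 1 - l := sub_nonneg.2 hl.2
  have h1 : (1 : ℝ) ∈ Icc (-1 : ℝ) 1 := by norm_num
  have hA : ∀ t, 0 < (1 - l) * (1 / 2) + l * aM t := by
    intro t
    have := aM_pos t
    rcases hl.1.eq_or_lt with rfl | h
    · norm_num
    · have := mul_pos h this
      linarith
  have hBpos : ∀ t, 0 < Real.sin t → 0 < (1 - l) * (2 * Real.sin t) + l * bM t := by
    intro t ht
    have := bM_pos ht
    rcases hl.1.eq_or_lt with rfl | h
    · linarith
    · have := mul_pos h this
      have := mul_nonneg hl1 ht.le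
      linarith
  have hBneg : ∀ t, Real.sin t < 0 → (1 - l) * (2 * Real.sin t) + l * bM t < 0 := by
    intro t ht
    have := bM_neg ht
    rcases hl.1.eq_or_lt with rfl | h
    · linarith
    · have := mul_neg_of_pos_of_neg h this
      have := mul_nonpos_of_nonneg_of_nonpos hl1 ht.le
      linarith
  have hG1 : Real.pi < (1 - l) * (logL 1).im + l * (2 * angle 1) ∧
      (1 - l) * (logL 1).im + l * (2 * angle 1) < 2 * Real.pi := by
    have a1 := logL_im_one
    have a2 := pi_div_two_lt_angle_one
    have a3 := (abs_lt.1 (abs_angle_lt h1)).2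
    have a4 := φmax_lt_pi
    rcases hl.1.eq_or_lt with rfl | h
    · constructor <;> linarith
    · constructor
      · have := mul_nonneg hl1 (sub_nonneg.2 a1.1.le)
        have := mul_pos h (show 0 < 2 * angle 1 - Real.pi by linarith)
        linarith
      · have := mul_nonneg hl1 (sub_nonneg.2 a1.2.le)
        have := mul_pos h (show 0 < 2 * Real.pi - 2 * angle 1 by linarith)
        linarith
  have hodd : ∀ v ∈ Icc (-1 : ℝ) 1, (1 - l) * (logL (-v)).im + l * (2 * angle (-v)) =
      -((1 - l) * (logL v).im + l * (2 * angle v)) := by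
    intro v hv
    rw [logL_im_neg, angle_neg hv]
    ring
  suffices key : IsConeKnot (fun t => ((rM l t : ℂ) * Complex.exp (ΘM l t * Complex.I), yM l t))
    from key
  refine isConeKnot_of_angle (r := rM l) (Θ := ΘM l) (y := yM l)
    (fun v => (1 - l) * (logL v).im + l * (2 * angle v)) (fun _ => rfl) ?_ hodd hG1.2 ?_
    (contDiff_pair_left contDiff_rM l) (contDiff_pair_left contDiff_ΘM l)
    (contDiff_pair_left contDiff_yM l) (rM_pos hl) ?_ ?_ ?_ ?_ ?_
  · intro v hv w hw h
    have a1 := angle_lt_angle hv hw h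
    have a2 : (logL v).im < (logL w).im := strictMono_logL_im h
    change (1 - l) * (logL v).im + l * (2 * angle v) < (1 - l) * (logL w).im + l * (2 * angle w)
    rcases hl.1.eq_or_lt with rfl | h
    · linarith
    · have := mul_nonneg hl1 (sub_nonneg.2 a2.le)
      have := mul_pos h (sub_pos.2 a1)
      linarith
  · intro t h
    have d1 : HasDerivAt (fun t => (logL (Real.sin t)).im)
        (deriv (fun v => (logL v).im) (Real.sin t) * Real.cos t) t :=
      (contDiff_logL_im.differentiable (by simp) _).hasDerivAt.comp t (Real.hasDerivAt_sin t)
    have d2 : HasDerivAt (ΘM l) _ t :=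
      (d1.const_mul (1 - l)).add (((hasDerivAt_phi t).const_mul 2).const_mul l)
    rw [d2.deriv] at h
    have e1 := deriv_logL_im_pos (Real.sin t)
    have e2 := deriv_angle_pos (Real.sin_mem_Icc t)
    have e3 : ((1 - l) * deriv (fun v => (logL v).im) (Real.sin t) +
        l * (2 * deriv angle (Real.sin t))) * Real.cos t = 0 := by
      rw [← h]
      ring
    refine (mul_eq_zero.1 e3).resolve_left (ne_of_gt ?_)
    rcases hl.1.eq_or_lt with rfl | h
    · linarith
    · have := mul_nonneg hl1 e1.le
      have := mul_pos h e2
      linarith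
  · intro t
    simp only [rM, upsL, phi_add_two_pi, Real.cos_add_two_pi, Real.sin_add_two_pi]
  · intro t
    simp only [yM, aM, bM, phi_add_two_pi, Real.cos_add_two_pi, Real.sin_add_two_pi]
  · intro t k hk _ hy
    have he : yM l (Real.pi - t) = ((-1 : ℝ) : ℂ) * yM l t := by
      simp only [yM, aM, bM, phi_pi_sub, Real.cos_pi_sub, Real.sin_pi_sub]
      push_cast
      ring
    rw [he] at hy
    have h0 : ((1 + k : ℝ) : ℂ) * yM l t = 0 := by
      push_cast at hy ⊢
      linear_combination -hy
    have h2 : yM l t = 0 := by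
      refine (mul_eq_zero.1 h0).resolve_left ?_
      exact_mod_cast (by linarith : (1 + k) ≠ 0)
    rcases mul_eq_zero.1 h2 with h3 | h3
    · have : -Real.cos t = 0 := by exact_mod_cast h3
      linarith
    · have := congrArg Complex.re h3
      simp only [Complex.add_re, Complex.mul_re, Complex.ofReal_re, Complex.ofReal_im, Complex.I_re,
        Complex.I_im, Complex.zero_re] at this
      linarith [hA t]
  · intro s t k hk hs ht hΘ _ hy
    have hy' : yM l s = (k : ℂ) * yM l t := hy
    simp only [yM] at hy'
    have hre := congrArg Complex.re hy'
    have him := congrArg Complex.im hy'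
    simp only [Complex.mul_re, Complex.mul_im, Complex.add_re, Complex.add_im, Complex.ofReal_re,
      Complex.ofReal_im, Complex.I_re, Complex.I_im, mul_zero, zero_mul, sub_zero, add_zero,
      mul_one, zero_add] at hre him
    have As := hA s
    have At := hA t
    have Bs := hBpos s hs
    have Bt := hBneg t ht
    set A := (1 - l) * (1 / 2) + l * aM s
    set A' := (1 - l) * (1 / 2) + l * aM t
    set B := (1 - l) * (2 * Real.sin s) + l * bM s
    set B' := (1 - l) * (2 * Real.sin t) + l * bM t
    by_cases hc : Real.cos s = 0
    · have hct : Real.cos t = 0 := by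
        rw [hc] at hre
        have : k * A' * Real.cos t = 0 := by linarith
        exact (mul_eq_zero.1 this).resolve_left (mul_pos hk At).ne'
      have s1 := Real.sin_sq_add_cos_sq s
      have s2 := Real.sin_sq_add_cos_sq t
      rw [hc] at s1
      rw [hct] at s2
      have hsin1 : Real.sin s = 1 := by
        have : (Real.sin s - 1) * (Real.sin s + 1) = 0 := by linear_combination s1
        rcases mul_eq_zero.1 this with h | h <;> linarith
      have hsin2 : Real.sin t = -1 := by
        have : (Real.sin t - 1) * (Real.sin t + 1) = 0 := by linear_combination s2
        rcases mul_eq_zero.1 this with h | h <;> linarith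
      simp only [ΘM, phi, hsin1, hsin2] at hΘ
      have := hodd 1 h1
      linarith [hG1.1]
    · -- the real parts have the same sign, the imaginary parts have opposite signs
      have e1 : 0 < A * Real.cos s ^ 2 := mul_pos As (by positivity)
      have e2 : Real.cos s * Real.cos t * (k * A') = A * Real.cos s ^ 2 := by
        linear_combination Real.cos s * hre
      have e3 : 0 < Real.cos s * Real.cos t := by
        rw [← e2] at e1
        exact pos_of_mul_pos_left e1 (mul_pos hk At).le
      have e4 : Real.cos s * Real.cos t * (k * B') = B * Real.cos s ^ 2 := by
        linear_combination Real.cos s * him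
      have e5 : 0 < B * Real.cos s ^ 2 := mul_pos Bs (by positivity)
      have e6 : Real.cos s * Real.cos t * (k * B') < 0 :=
        mul_neg_of_pos_of_neg e3 (mul_neg_of_pos_of_neg hk Bt)
      linarith
  · intro t ρ ht _ hy
    have hcv : ContDiff ℝ ∞ (fun t => (((1 - l) * (1 / 2) + l * aM t : ℝ) +
        ((1 - l) * (2 * Real.sin t) + l * bM t : ℝ) * Complex.I : ℂ)) := by
      have hof : ∀ {g : ℝ → ℝ}, ContDiff ℝ ∞ g → ContDiff ℝ ∞ (fun p => (g p : ℂ)) :=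
        fun h => Complex.ofRealCLM.contDiff.comp h
      have ha := contDiff_aM
      have hb := contDiff_bM
      exact (hof (g := fun t => (1 - l) * (1 / 2) + l * aM t) (by fun_prop)).add
        ((hof (g := fun t => (1 - l) * (2 * Real.sin t) + l * bM t) (by fun_prop)).mul contDiff_const)
    have hd : HasDerivAt (yM l) _ t :=
      (Real.hasDerivAt_cos t).neg.ofReal_comp.mul (hcv.differentiable (by simp) t).hasDerivAt
    have hd' := hd.deriv
    have hy' : deriv (yM l) t = ρ * yM l t := hy
    have hy0 : yM l t = 0 := by simp [yM, ht]
    rw [hy0, mul_zero] at hy'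
    rw [hy'] at hd'
    have hs : Real.sin t ≠ 0 := by
      intro h0
      have := Real.sin_sq_add_cos_sq t
      rw [h0, ht] at this
      norm_num at this
    have hz : ((Real.sin t : ℝ) : ℂ) * (((1 - l) * (1 / 2) + l * aM t : ℝ) +
        ((1 - l) * (2 * Real.sin t) + l * bM t : ℝ) * Complex.I : ℂ) = 0 := by
      rw [Pi.neg_apply, ht, neg_zero, Complex.ofReal_zero, zero_mul, add_zero, neg_neg] at hd'
      exact hd'.symm
    rcases mul_eq_zero.1 hz with h3 | h3
    · exact hs (by exact_mod_cast h3)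
    · have := congrArg Complex.re h3
      simp only [Complex.add_re, Complex.mul_re, Complex.ofReal_re, Complex.ofReal_im, Complex.I_re,
        Complex.I_im, Complex.zero_re] at this
      linarith [hA t]

/-! ### From the closed braid to the link of the ball -/

theorem isConeLink_pair {c₀ c₁ : ℝ → ℂ × ℂ} (h0 : IsConeKnot c₀) (h1 : IsConeKnot c₁)
    (hd : ∀ s t (k : ℝ), 0 < k → c₀ s ≠ k • c₁ t) : IsConeLink ![c₀, c₁] := by
  refine ⟨fun i => ?_, hd⟩
  fin_cases i
  · exact h0
  · exact h1

theorem ambientIsotopic_pair {c₀ c₁ : ℝ → ℝ → ℂ × ℂ}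
    (h : ∀ l ∈ Icc (0 : ℝ) 1, IsConeLink ![c₀ l, c₁ l])
    (hs0 : ∀ l ∈ Icc (0 : ℝ) 1, ∀ t, ContDiffAt ℝ ∞ (fun p : ℝ × ℝ => c₀ p.1 p.2) (l, t))
    (hs1 : ∀ l ∈ Icc (0 : ℝ) 1, ∀ t, ContDiffAt ℝ ∞ (fun p : ℝ × ℝ => c₁ p.1 p.2) (l, t))
    (h0 : IsConeLink ![c₀ 0, c₁ 0]) (h1 : IsConeLink ![c₀ 1, c₁ 1]) :
    AmbientIsotopic h0.toLink h1.toLink := by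
  refine ambientIsotopic_of_cone_family (c := fun l => ![c₀ l, c₁ l]) h (fun i l hl t => ?_) h0 h1
  fin_cases i
  · exact hs0 l hl t
  · exact hs1 l hl t

/-- The absolute value of the second coordinate of the unknotted component, whose first coordinate
has the absolute value `1 / 2000`. -/
def κ : ℝ := √(1 - 1 / 4000000)

theorem κ_sq : κ ^ 2 = 1 - 1 / 4000000 := Real.sq_sqrt (by norm_num)

theorem κ_gt : 9 / 10 < κ := Real.lt_sqrt_of_sq_lt (by norm_num)

theorem κ_pos : 0 < κ := by linarith [κ_gt]

/-- The component that is the axis of the closed braid, after a linear change of coordinates; for `a = 0`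
it is a core circle of the sphere. -/
def axis (a b : ℝ) (s : ℝ) : ℂ × ℂ :=
  ((a : ℂ) * Real.cos s, -(b : ℂ) * Complex.exp (s * Complex.I))

/-- For `a = 1/2000` and `b = κ` this is the unknotted component of the link of the ball, which comes
from the boundary of the disc `‖s‖ ≤ 1/10` in the parameter plane. -/
def axisTwo (a b : ℝ) (s : ℝ) : ℂ × ℂ :=
  ((a : ℂ) * Complex.exp ((2 * s : ℝ) * Complex.I), -(b : ℂ) * Complex.exp (s * Complex.I))

theorem exp_add_two_pi (s : ℝ) :
    Complex.exp (((s + 2 * Real.pi : ℝ) : ℂ) * Complex.I) = Complex.exp (s * Complex.I) := by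
  have : (((s + 2 * Real.pi : ℝ) : ℂ) * Complex.I) = s * Complex.I + 2 * Real.pi * Complex.I := by
    push_cast
    ring
  rw [this, Complex.exp_add, Complex.exp_two_pi_mul_I, mul_one]

theorem contDiff_axis (b : ℝ) : ContDiff ℝ ∞ (fun p : ℝ × ℝ => axis (1 - p.1) b p.2) := by
  have hof : ∀ {g : ℝ × ℝ → ℝ}, ContDiff ℝ ∞ g → ContDiff ℝ ∞ (fun p => (g p : ℂ)) :=
    fun h => Complex.ofRealCLM.contDiff.comp h
  exact ((hof (contDiff_const.sub contDiff_fst)).mul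
    (hof (Real.contDiff_cos.comp contDiff_snd))).prodMk
      (contDiff_const.mul ((hof contDiff_snd).mul contDiff_const).cexp)

theorem contDiff_axisTwo (a b : ℝ) : ContDiff ℝ ∞ (fun p : ℝ × ℝ => axisTwo ((1 - p.1) * a) b p.2) := by
  have hof : ∀ {g : ℝ × ℝ → ℝ}, ContDiff ℝ ∞ g → ContDiff ℝ ∞ (fun p => (g p : ℂ)) :=
    fun h => Complex.ofRealCLM.contDiff.comp h
  exact ((hof ((contDiff_const.sub contDiff_fst).mul contDiff_const)).mul
    ((hof (contDiff_const.mul contDiff_snd)).mul contDiff_const).cexp).prodMk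
      (contDiff_const.mul ((hof contDiff_snd).mul contDiff_const).cexp)

theorem isConeKnot_axis (a : ℝ) {b : ℝ} (hb : b ≠ 0) : IsConeKnot (axis a b) := by
  have hs : ContDiff ℝ ∞ (axis (1 - (1 - a)) b) := contDiff_pair_left (contDiff_axis b) (1 - a)
  rw [sub_sub_cancel] at hs
  refine isConeKnot_of_snd hs (fun t => ?_) (a := -(b : ℂ)) (by simpa using hb) fun t => rfl
  simp only [axis, Real.cos_add_two_pi, exp_add_two_pi]

theorem isConeKnot_axisTwo (a : ℝ) {b : ℝ} (hb : b ≠ 0) : IsConeKnot (axisTwo a b) := by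
  have hs : ContDiff ℝ ∞ (axisTwo ((1 - 0) * a) b) := contDiff_pair_left (contDiff_axisTwo a b) 0
  rw [sub_zero, one_mul] at hs
  refine isConeKnot_of_snd hs (fun t => ?_) (a := -(b : ℂ)) (by simpa using hb) fun t => rfl
  have : (2 * (t + 2 * Real.pi) : ℝ) = 2 * t + 2 * Real.pi + 2 * Real.pi := by ring
  simp only [axisTwo, this, exp_add_two_pi]

/-- The core circle, run through by the second coordinate, is disjoint from every curve whose
first coordinate does not vanish. -/
theorem isConeLink_core {c : ℝ → ℂ × ℂ} (hc : IsConeKnot c) (h : ∀ t, (c t).1 ≠ 0) :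
    IsConeLink ![axis 0 1, c] := by
  refine isConeLink_pair (isConeKnot_axis 0 one_ne_zero) hc fun s t k hk he => h t ?_
  have := congrArg Prod.fst he
  simp only [axis, Complex.ofReal_zero, zero_mul, Prod.smul_fst, Complex.real_smul] at this
  exact (mul_eq_zero.1 this.symm).resolve_left (by exact_mod_cast hk.ne')

theorem isConeLink_knotM {l : ℝ} (hl : l ∈ Icc (0 : ℝ) 1) : IsConeLink ![axis 0 1, knotM l] :=
  isConeLink_core (isConeKnot_knotM hl) fun t =>
    mul_ne_zero (by exact_mod_cast (rM_pos hl t).ne') (Complex.exp_ne_zero _)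

theorem isConeLink_knotL {l : ℝ} (hl : l ∈ Icc (0 : ℝ) 1) : IsConeLink ![axis 0 1, knotL l] :=
  isConeLink_core (isConeKnot_knotL hl) fun t =>
    mul_ne_zero (by exact_mod_cast (ff_pos (abs_upsL_lt hl t)).ne') (Complex.exp_ne_zero _)

theorem isConeLink_axis_knotM {l : ℝ} (hl : l ∈ Icc (0 : ℝ) 1) :
    IsConeLink ![axis (1 - l) 1, knotM 0] := by
  refine isConeLink_pair (isConeKnot_axis _ one_ne_zero) (isConeKnot_knotM (by norm_num))
    fun s t k hk he => ?_
  rw [knotM_zero] at he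
  have e1 := congrArg Prod.fst he
  have e2 := congrArg Prod.snd he
  simp only [axis, Prod.smul_mk, Complex.real_smul] at e1 e2
  have a1 := congrArg Complex.re e1
  have a2 := congrArg Complex.im e1
  have a3 := congrArg Complex.re e2
  simp only [Complex.mul_re, Complex.mul_im, Complex.ofReal_re, Complex.ofReal_im, pL_re,
    pL_im, zero_mul, mul_zero, sub_zero, add_zero, zero_add, Complex.neg_re, Complex.add_re,
    Complex.I_re, Complex.I_im, Complex.exp_ofReal_mul_I_re, Complex.add_im, mul_one,
    Complex.ofReal_one, neg_mul, one_mul] at a1 a2 a3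
  set u := Real.cos t
  set v := Real.sin t
  have huv : v ^ 2 + u ^ 2 = 1 := Real.sin_sq_add_cos_sq t
  have b1 : (1 - l) * u = 2 * (1 - 2 * v ^ 2) := by
    have : k * ((1 - l) * u - 2 * (1 - 2 * v ^ 2)) = 0 := by
      linear_combination 2 * (1 - l) * a3 + 2 * a1
    linarith [(mul_eq_zero.1 this).resolve_left hk.ne']
  have b2 : v * (3 - 4 * v ^ 2) = 0 := by
    have : k * (v * (3 - 4 * v ^ 2)) = 0 := by linarith
    exact (mul_eq_zero.1 this).resolve_left hk.ne'
  have b3 : (1 - l) ^ 2 * u ^ 2 ≤ u ^ 2 := by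
    have : (1 - l) ^ 2 ≤ 1 := by nlinarith [hl.1, hl.2]
    nlinarith [sq_nonneg u]
  have b4 : (1 - l) ^ 2 * u ^ 2 = 4 * (1 - 2 * v ^ 2) ^ 2 := by
    rw [← mul_pow, b1]
    ring
  rcases mul_eq_zero.1 b2 with h | h
  · rw [h] at b4 huv
    linarith
  · have hv : v ^ 2 = 3 / 4 := by linarith
    rw [hv] at b4 huv
    linarith

theorem norm_knotL_snd_le (t : ℝ) : ‖yL 0 t‖ ≤ 12 / 5 := by
  have hu := (abs_upsL_lt (l := 0) (by norm_num) t).le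
  have hx := cos_phi_gt t
  have hx1 := Real.cos_le_one (phi t)
  have hq : qf (Real.cos (phi t)) ≤ 4 / 5 := by
    unfold qf
    nlinarith
  have hq0 := qf_pos (Real.cos (phi t))
  rw [yL, norm_mul, Complex.norm_exp_ofReal_mul_I, one_mul]
  refine (norm_add_le _ _).trans ?_
  rw [norm_mul, Complex.norm_I, mul_one, Complex.norm_real, Complex.norm_real, Real.norm_eq_abs,
    Real.norm_eq_abs, abs_mul]
  have h1 : |Real.sin (phi t)| ≤ 1 := Real.abs_sin_le_one _
  have h2 : |upsL 0 t| * |Real.sin (phi t)| ≤ 4 / 5 * 1 := by gcongr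
  have hx2 : Real.cos (phi t) ^ 2 ≤ 1 := by nlinarith
  have h3 : |-((1 - 0) * qf (Real.cos (phi t))) - upsL 0 t * cL 0 (Real.cos (phi t))| ≤
      4 / 5 + 4 / 5 * 1 := by
    refine (abs_sub _ _).trans (add_le_add ?_ ?_)
    · rw [abs_neg, sub_zero, one_mul, abs_of_pos hq0]
      exact hq
    · rw [abs_mul]
      have : |cL 0 (Real.cos (phi t))| ≤ 1 := by
        rw [cL, zero_mul, add_zero, sub_zero, one_mul, abs_of_nonneg (sq_nonneg _)]
        exact hx2
      gcongr
  linarith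

theorem ff_ge {υ : ℝ} (h : |υ| < 4 / 5) : 1 / 300 ≤ ff υ := by
  have h1 := abs_lt.1 h
  have hm : 1 / 9 ≤ mob υ := by
    rw [mob, div_le_div_iff₀ (by norm_num) (by linarith)]
    linarith
  have hs : √(400 - mob υ ^ 2) ≤ 20 := Real.sqrt_le_iff.2 ⟨by norm_num, by nlinarith [sq_nonneg (mob υ)]⟩
  rw [ff, le_div_iff₀ (Real.sqrt_pos.2 (mob_sq_lt h))]
  linarith

theorem isConeLink_axisTwo_knotL {l : ℝ} (hl : l ∈ Icc (0 : ℝ) 1) :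
    IsConeLink ![axisTwo ((1 - l) * (1 / 2000)) κ, knotL 0] := by
  refine isConeLink_pair (isConeKnot_axisTwo _ κ_pos.ne') (isConeKnot_knotL (by norm_num))
    fun s t k hk he => ?_
  have hb := abs_upsL_lt (l := 0) (by norm_num) t
  have e1 := congrArg (fun x => ‖x.1‖) he
  have e2 := congrArg (fun x => ‖x.2‖) he
  simp only [axisTwo, knotL, Prod.smul_mk, norm_smul, norm_mul, norm_neg,
    Complex.norm_exp_ofReal_mul_I, Complex.norm_real, mul_one, Real.norm_eq_abs, abs_of_pos hk,
    abs_of_pos (ff_pos hb), abs_of_pos κ_pos] at e1 e2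
  have h1 : |1 - l| ≤ 1 := abs_le.2 ⟨by linarith [hl.2], by linarith [hl.1]⟩
  have h2 := ff_ge hb
  have h3 := norm_knotL_snd_le t
  have h4 := κ_gt
  have h5 : k * ‖yL 0 t‖ ≤ k * (12 / 5) := mul_le_mul_of_nonneg_left h3 hk.le
  have h6 : k * (1 / 300) ≤ k * ff (upsL 0 t) := mul_le_mul_of_nonneg_left h2 hk.le
  have h7 : |(1 : ℝ) / 2000| = 1 / 2000 := abs_of_pos (by norm_num)
  have h8 : |(1 - l) * (1 / 2000)| ≤ 1 / 2000 := by
    rw [abs_mul, h7]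
    linarith
  linarith

/-- The link that the ball cuts out of the nodal cubic. -/
theorem isConeLink_cut : IsConeLink ![axisTwo (1 / 2000) κ, knotL 0] := by
  simpa using isConeLink_axisTwo_knotL (l := 0) (by norm_num)

/-- The real linear maps of determinant `1` that bring the closed braid into the form used here. -/
def shear (l : ℝ) (x : ℂ × ℂ) : ℂ × ℂ :=
  (⟨x.1.re, x.1.im * Real.cos (l * (Real.pi / 2)) + x.2.im * Real.sin (l * (Real.pi / 2))⟩,
    ⟨x.2.re - l * x.1.re, x.2.im * Real.cos (l * (Real.pi / 2)) -
      x.1.im * Real.sin (l * (Real.pi / 2))⟩)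

theorem exists_shear_clm (l : ℝ) : ∃ A : (ℂ × ℂ) →L[ℝ] (ℂ × ℂ),
    Function.Injective A ∧ ∀ x, A x = shear l x := by
  let B : (ℂ × ℂ) →ₗ[ℝ] (ℂ × ℂ) :=
    { toFun := shear l
      map_add' := fun x y => by
        refine Prod.ext (Complex.ext ?_ ?_) (Complex.ext ?_ ?_) <;>
          simp only [shear, Prod.fst_add, Prod.snd_add, Complex.add_re, Complex.add_im] <;> ring
      map_smul' := fun r x => by
        refine Prod.ext (Complex.ext ?_ ?_) (Complex.ext ?_ ?_) <;>
          simp only [shear, Prod.smul_fst, Prod.smul_snd, Complex.smul_re, Complex.smul_im,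
            smul_eq_mul, RingHom.id_apply] <;> ring }
  refine ⟨LinearMap.toContinuousLinearMap B, ?_, fun x => rfl⟩
  intro x y h
  have h' : shear l x = shear l y := h
  have e1 := congrArg (fun z => z.1.re) h'
  have e2 := congrArg (fun z => z.1.im) h'
  have e3 := congrArg (fun z => z.2.re) h'
  have e4 := congrArg (fun z => z.2.im) h'
  simp only [shear] at e1 e2 e3 e4
  have hsc := Real.sin_sq_add_cos_sq (l * (Real.pi / 2))
  set c := Real.cos (l * (Real.pi / 2))
  set s := Real.sin (l * (Real.pi / 2))
  refine Prod.ext (Complex.ext e1 ?_) (Complex.ext ?_ ?_)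
  · linear_combination c * e2 - s * e4 + (y.1.im - x.1.im) * hsc
  · linear_combination e3 + l * e1
  · linear_combination s * e2 + c * e4 + (y.2.im - x.2.im) * hsc

theorem contDiff_shear {c : ℝ → ℂ × ℂ} (hc : ContDiff ℝ ∞ c) :
    ContDiff ℝ ∞ (fun p : ℝ × ℝ => shear p.1 (c p.2)) := by
  have hC : ∀ {f g : ℝ × ℝ → ℝ}, ContDiff ℝ ∞ f → ContDiff ℝ ∞ g →
      ContDiff ℝ ∞ (fun p => (⟨f p, g p⟩ : ℂ)) := fun hf hg =>
    Complex.equivRealProdCLM.symm.contDiff.comp (hf.prodMk hg)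
  have hre : ContDiff ℝ ∞ (fun z : ℂ => z.re) := Complex.reCLM.contDiff
  have him : ContDiff ℝ ∞ (fun z : ℂ => z.im) := Complex.imCLM.contDiff
  have h1 : ContDiff ℝ ∞ (fun p : ℝ × ℝ => (c p.2).1) := contDiff_fst.comp (hc.comp contDiff_snd)
  have h2 : ContDiff ℝ ∞ (fun p : ℝ × ℝ => (c p.2).2) := contDiff_snd.comp (hc.comp contDiff_snd)
  have a1 := hre.comp h1
  have a2 := him.comp h1
  have a3 := hre.comp h2
  have a4 := him.comp h2
  have hl : ContDiff ℝ ∞ (fun p : ℝ × ℝ => p.1 * (Real.pi / 2)) := contDiff_fst.mul contDiff_const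
  have hc' := Real.contDiff_cos.comp hl
  have hs' := Real.contDiff_sin.comp hl
  exact (hC a1 ((a2.mul hc').add (a4.mul hs'))).prodMk
    (hC (a3.sub (contDiff_fst.mul a1)) ((a4.mul hc').sub (a2.mul hs')))

theorem isConeLink_shear (l : ℝ) :
    IsConeLink ![fun t => shear l (whiteheadCurve 0 t), fun t => shear l (whiteheadCurve 1 t)] := by
  obtain ⟨A, hA, hAs⟩ := exists_shear_clm l
  have h := link512.isConeLink.map A hA
  have e : ∀ i, (fun t => A (link512.curve i t)) = fun t => shear l (whiteheadCurve i t) :=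
    fun i => funext fun t => hAs _
  refine isConeLink_pair (e 0 ▸ h.knot 0) (e 1 ▸ h.knot 1) fun s t k hk he => ?_
  refine h.disjoint s t k hk ?_
  change A (whiteheadCurve 0 s) = k • A (whiteheadCurve 1 t)
  rw [hAs, hAs]
  exact he

theorem shear_smul (l r : ℝ) (x : ℂ × ℂ) : shear l (r • x) = r • shear l x := by
  obtain ⟨A, -, hAs⟩ := exists_shear_clm l
  rw [← hAs, ← hAs, map_smul]

theorem shear_zero (x : ℂ × ℂ) : shear 0 x = x := by
  simp [shear]

theorem shear_one_whiteheadCurve (i : Fin 2) (t : ℝ) : ∃ k : ℝ, 0 < k ∧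
    shear 1 (whiteheadCurve i t) = k • (![axis 1 1, knotM 0] : Fin 2 → ℝ → ℂ × ℂ) i t := by
  have key : ∀ s w, ∃ k : ℝ, 0 < k ∧ shear 1 (toSphere s w) =
      k • shear 1 ((⟨Real.cos s, Real.sin s⟩ : ℂ), w) := by
    intro s w
    refine ⟨(√(1 + (w.re ^ 2 + w.im ^ 2)))⁻¹, by positivity, ?_⟩
    rw [toSphere, shear_smul]
  fin_cases i
  · obtain ⟨k, hk, he⟩ := key t 0
    refine ⟨k, hk, ?_⟩
    change shear 1 (whiteheadCurve 0 t) = k • axis 1 1 t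
    rw [show whiteheadCurve 0 t = toSphere t 0 from rfl, he]
    congr 1
    refine Prod.ext (Complex.ext ?_ ?_) (Complex.ext ?_ ?_) <;>
      simp [shear, axis, Complex.exp_re, Complex.exp_im, -Complex.ofReal_cos, -Complex.ofReal_sin]
  · obtain ⟨k, hk, he⟩ := key (2 * t) (whiteheadStrand t)
    refine ⟨k, hk, ?_⟩
    change shear 1 (whiteheadCurve 1 t) = k • knotM 0 t
    rw [show whiteheadCurve 1 t = toSphere (2 * t) (whiteheadStrand t) from rfl, he, knotM_zero]
    have hsc := Real.sin_sq_add_cos_sq t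
    congr 1
    refine Prod.ext (Complex.ext ?_ ?_) (Complex.ext ?_ ?_)
    · simp only [shear, pL_re, Real.cos_two_mul]
      linear_combination (2 : ℝ) * hsc
    · simp only [shear, pL_im, whiteheadStrand, Real.sin_three_mul, one_mul, Real.sin_pi_div_two,
        Real.cos_pi_div_two]
      ring
    · simp only [shear, whiteheadStrand, Complex.mul_re, Complex.add_re, Complex.add_im,
        Complex.mul_im, Complex.ofReal_re, Complex.ofReal_im, Complex.I_re, Complex.I_im]
      ring
    · simp only [shear, whiteheadStrand, Complex.mul_re, Complex.add_re, Complex.add_im,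
        Complex.mul_im, Complex.ofReal_re, Complex.ofReal_im, Complex.I_re, Complex.I_im, one_mul,
        Real.sin_pi_div_two, Real.cos_pi_div_two, Real.sin_two_mul]
      ring

/-- The link of the ball is the Whitehead link. -/
theorem isotopic_cut_link512 : Isotopic isConeLink_cut.toLink link512 := by
  have I0 : (0 : ℝ) ∈ Icc (0 : ℝ) 1 := by norm_num
  have I1 : (1 : ℝ) ∈ Icc (0 : ℝ) 1 := by norm_num
  have h1 : IsConeLink ![axis 1 1, knotM 0] := by simpa using isConeLink_axis_knotM I0
  -- a linear change of coordinates
  have s1 := ambientIsotopic_pair (c₀ := fun l t => shear l (whiteheadCurve 0 t))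
    (c₁ := fun l t => shear l (whiteheadCurve 1 t)) (fun l _ => isConeLink_shear l)
    (fun l _ t => (contDiff_shear (link512.smooth 0)).contDiffAt)
    (fun l _ t => (contDiff_shear (link512.smooth 1)).contDiffAt)
    (isConeLink_shear 0) (isConeLink_shear 1)
  have e0 : (isConeLink_shear 0).toLink = link512 := by
    rw [← link512.toLink_isConeLink]
    refine IsConeLink.toLink_congr _ _ fun i t => ⟨1, one_pos, ?_⟩
    rw [one_smul]
    fin_cases i <;> exact shear_zero _
  have e1 : (isConeLink_shear 1).toLink = h1.toLink := by
    refine IsConeLink.toLink_congr _ _ fun i t => ?_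
    obtain ⟨k, hk, he⟩ := shear_one_whiteheadCurve i t
    refine ⟨k, hk, ?_⟩
    rw [← he]
    fin_cases i <;> rfl
  rw [e0, e1] at s1
  have h2 : IsConeLink ![axis (1 - 0) 1, knotM 0] := isConeLink_axis_knotM I0
  have h3 : IsConeLink ![axis (1 - 1) 1, knotM 0] := isConeLink_axis_knotM I1
  -- the axis becomes a core circle
  have s2 := ambientIsotopic_pair (c₀ := fun l => axis (1 - l) 1) (c₁ := fun _ => knotM 0)
    (fun l hl => isConeLink_axis_knotM hl) (fun l _ t => (contDiff_axis 1).contDiffAt)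
    (fun l _ t => ((contDiff_pair_left contDiff_knotM 0).comp contDiff_snd).contDiffAt) h2 h3
  -- the knot takes the form of the boundary curve, with all slices centred at the origin
  have s3 := ambientIsotopic_pair (c₀ := fun _ => axis 0 1) (c₁ := knotM)
    (fun l hl => isConeLink_knotM hl)
    (fun l _ t => ((isConeKnot_axis 0 one_ne_zero).smooth.comp contDiff_snd).contDiffAt)
    (fun l _ t => contDiff_knotM.contDiffAt) (isConeLink_knotM I0) (isConeLink_knotM I1)
  -- the centres of the slices are moved
  have s4 := ambientIsotopic_pair (c₀ := fun _ => axis 0 1) (c₁ := knotL)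
    (fun l hl => isConeLink_knotL hl)
    (fun l _ t => ((isConeKnot_axis 0 one_ne_zero).smooth.comp contDiff_snd).contDiffAt)
    (fun l hl t => contDiffAt_knotL hl t) (isConeLink_knotL I0) (isConeLink_knotL I1)
  -- the core circle is pushed to the boundary of the small disc
  have s5 := ambientIsotopic_pair (c₀ := fun l => axisTwo ((1 - l) * (1 / 2000)) κ)
    (c₁ := fun _ => knotL 0) (fun l hl => isConeLink_axisTwo_knotL hl)
    (fun l _ t => (contDiff_axisTwo (1 / 2000) κ).contDiffAt)
    (fun l _ t => ((isConeKnot_knotL I0).smooth.comp contDiff_snd).contDiffAt)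
    (isConeLink_axisTwo_knotL I0) (isConeLink_axisTwo_knotL I1)
  have f1 : h1.toLink = h2.toLink := by
    refine IsConeLink.toLink_congr _ _ fun i t => ⟨1, one_pos, ?_⟩
    rw [one_smul, sub_zero]
  have f2 : h3.toLink = (isConeLink_knotM I0).toLink := by
    refine IsConeLink.toLink_congr _ _ fun i t => ⟨1, one_pos, ?_⟩
    rw [one_smul, sub_self]
  have f3 : (isConeLink_knotM I1).toLink = (isConeLink_knotL I1).toLink := by
    refine IsConeLink.toLink_congr _ _ fun i t => ⟨1, one_pos, ?_⟩
    rw [one_smul, show knotM 1 = knotL 1 from funext knotM_one]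
  have f4 : (isConeLink_axisTwo_knotL I1).toLink = (isConeLink_knotL I0).toLink := by
    refine IsConeLink.toLink_congr _ _ fun i t => ?_
    fin_cases i
    · refine ⟨κ, κ_pos, ?_⟩
      change axisTwo ((1 - 1) * (1 / 2000)) κ t = κ • axis 0 1 t
      simp [axisTwo, axis]
    · exact ⟨1, one_pos, (one_smul _ _).symm⟩
  have f5 : (isConeLink_axisTwo_knotL I0).toLink = isConeLink_cut.toLink := by
    refine IsConeLink.toLink_congr _ _ fun i t => ⟨1, one_pos, ?_⟩
    rw [one_smul, sub_zero, one_mul]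
  rw [f1] at s1
  rw [f2] at s2
  rw [f3] at s3
  rw [f4, f5] at s5
  exact (((s1.trans (s2.trans s3)).trans s4.symm).trans s5.symm).symm.isotopic

/-! ### The ball -/

/-- A smooth cutoff function: `0` for `m ≤ 1/25` and `1` for `m ≥ 1/9`. -/
def cutoff (m : ℝ) : ℝ := Real.smoothTransition ((225 * m - 9) / 16)

/-- A smooth truncation of `m`: equal to `m` for `m ≤ 9`, and constant for large `m`. It keeps
`1 - m²/400` away from `0`. -/
def trunc (m : ℝ) : ℝ := m + (9 - m) * Real.smoothTransition (m - 9)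

theorem cutoff_nonneg (m : ℝ) : 0 ≤ cutoff m := Real.smoothTransition.nonneg _

theorem cutoff_le_one (m : ℝ) : cutoff m ≤ 1 := Real.smoothTransition.le_one _

theorem cutoff_of_le {m : ℝ} (h : m ≤ 1 / 25) : cutoff m = 0 :=
  Real.smoothTransition.zero_of_nonpos (by linarith)

theorem cutoff_of_ge {m : ℝ} (h : 1 / 9 ≤ m) : cutoff m = 1 :=
  Real.smoothTransition.one_of_one_le (by linarith)

theorem contDiff_cutoff : ContDiff ℝ ∞ cutoff :=
  Real.smoothTransition.contDiff.comp (by fun_prop)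

theorem contDiff_trunc : ContDiff ℝ ∞ trunc :=
  contDiff_id.add ((contDiff_const.sub contDiff_id).mul
    (Real.smoothTransition.contDiff.comp (by fun_prop)))

theorem trunc_of_le {m : ℝ} (h : m ≤ 9) : trunc m = m := by
  rw [trunc, Real.smoothTransition.zero_of_nonpos (by linarith), mul_zero, add_zero]

theorem trunc_of_ge {m : ℝ} (h : 9 ≤ m) : 9 ≤ trunc m ∧ trunc m ≤ m ∧ trunc m ≤ 10 := by
  have h0 := Real.smoothTransition.nonneg (m - 9)
  have h1 := Real.smoothTransition.le_one (m - 9)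
  unfold trunc
  rcases le_total m 10 with h2 | h2
  · have := mul_nonneg (sub_nonneg.2 h) h0
    have := mul_nonneg (sub_nonneg.2 h) (sub_nonneg.2 h1)
    refine ⟨by linarith, by linarith, by linarith⟩
  · rw [Real.smoothTransition.one_of_one_le (by linarith)]
    refine ⟨by linarith, by linarith, by linarith⟩

theorem trunc_factor_pos {m : ℝ} (h : 0 ≤ m) : 0 < 1 - trunc m ^ 2 / 400 := by
  rcases le_total m 9 with h1 | h1
  · rw [trunc_of_le h1]
    nlinarith
  · obtain ⟨a, -, b⟩ := trunc_of_ge h1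
    nlinarith

/-- The centre of the slice over `ξ = s²`, in the frame in which `s + s³` is `cos φ + i υ sin φ`: it is
`13/25 + (1/2 + υ) cos² φ`, where `υ = (‖ξ‖ - 1) / (‖ξ‖ + 1)` and `cos² φ = (‖ξ‖ + re ξ) / (2‖ξ‖)`. -/
def centre (ξ : ℂ) : ℝ :=
  13 / 25 + (1 / 2 + (‖ξ‖ - 1) / (‖ξ‖ + 1)) * ((‖ξ‖ + ξ.re) / (2 * ‖ξ‖))

/-- The centre of the slice of the ball over `ξ`, as a smooth function on `ℂ`. -/
def alpha (ξ : ℂ) : ℂ := ((cutoff ‖ξ‖ * (√‖ξ‖ * (1 + ‖ξ‖) / ‖ξ‖ * centre ξ) : ℝ) : ℂ) * ξ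

/-- The size of the slice over `ξ` with `‖ξ‖ = m`, for `m ≥ 1/9`. The square root compensates for the size
of the first coordinate, so that in the annulus the condition to be in the ball is on `dist2` only. -/
def radius (m : ℝ) : ℝ := √m * (1 + m) * (3 / 5) / √(1 - trunc m ^ 2 / 400)

/-- The scale of the slice of the ball over `ξ`, as a smooth function on `ℂ`. Near `0` it is a multiple of
`1 + ξ`, so that the second coordinate in the ball of the points of the cubic is a multiple of `s`. -/
def beta (ξ : ℂ) : ℂ := ((1 - cutoff ‖ξ‖ : ℝ) : ℂ) * ((1 + ξ) / (10 * κ : ℝ)) +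
  (cutoff ‖ξ‖ * radius ‖ξ‖ : ℝ)

theorem radius_pos {m : ℝ} (h : 0 < m) : 0 < radius m :=
  div_pos (by positivity) (Real.sqrt_pos.2 (trunc_factor_pos h.le))

theorem alpha_of_le {ξ : ℂ} (h : ‖ξ‖ ≤ 1 / 25) : alpha ξ = 0 := by
  rw [alpha, cutoff_of_le h, zero_mul, Complex.ofReal_zero, zero_mul]

theorem beta_of_le {ξ : ℂ} (h : ‖ξ‖ ≤ 1 / 25) : beta ξ = (1 + ξ) / (10 * κ : ℝ) := by
  rw [beta, cutoff_of_le h, zero_mul, sub_zero, Complex.ofReal_zero, Complex.ofReal_one, one_mul,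
    add_zero]

theorem beta_of_ge {ξ : ℂ} (h : 1 / 9 ≤ ‖ξ‖) : beta ξ = (radius ‖ξ‖ : ℝ) := by
  rw [beta, cutoff_of_ge h, one_mul, sub_self, Complex.ofReal_zero, zero_mul, zero_add]

theorem beta_ne_zero (ξ : ℂ) : beta ξ ≠ 0 := by
  rcases le_or_gt (1 / 9) ‖ξ‖ with h | h
  · rw [beta_of_ge h]
    exact_mod_cast (radius_pos (by linarith)).ne'
  · have hre : -(1 / 9) ≤ ξ.re := by
      have := (abs_le.1 (Complex.abs_re_le_norm ξ)).1
      linarith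
    intro h0
    have h1 := congrArg Complex.re h0
    rw [beta, Complex.add_re, Complex.re_ofReal_mul, Complex.div_ofReal_re, Complex.ofReal_re,
      Complex.add_re, Complex.one_re, Complex.zero_re] at h1
    have hc0 := cutoff_nonneg ‖ξ‖
    have hc1 := cutoff_le_one ‖ξ‖
    have hp : 0 < (1 + ξ.re) / (10 * κ) := div_pos (by linarith) (by linarith [κ_pos])
    rcases hc1.eq_or_lt with h2 | h2
    · have h3 : 0 < ‖ξ‖ := by
        by_contra hn
        rw [cutoff_of_le (by linarith)] at h2
        norm_num at h2
      have := radius_pos h3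
      rw [h2] at h1
      linarith
    · have h3 : 0 ≤ radius ‖ξ‖ := by
        unfold radius
        positivity
      have := mul_pos (sub_pos.2 h2) hp
      have := mul_nonneg hc0 h3
      linarith

/-- A function that is smooth outside `0` and agrees with a smooth function near `0` is smooth. -/
theorem contDiff_of_punctured {F : ℂ → ℂ} {f : ℂ → ℂ} (hf : ContDiff ℝ ∞ f)
    (h : ∀ ξ, ‖ξ‖ ≤ 1 / 25 → F ξ = f ξ) (h' : ∀ ξ, ξ ≠ 0 → ContDiffAt ℝ ∞ F ξ) :
    ContDiff ℝ ∞ F := by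
  rw [contDiff_iff_contDiffAt]
  intro ξ
  by_cases hξ : ξ = 0
  · subst hξ
    refine hf.contDiffAt.congr_of_eventuallyEq ?_
    filter_upwards [Metric.closedBall_mem_nhds (0 : ℂ) (by norm_num : (0 : ℝ) < 1 / 25)] with ζ hζ
    exact h ζ (by simpa using hζ)
  · exact h' ξ hξ

theorem contDiff_alpha : ContDiff ℝ ∞ alpha := by
  refine contDiff_of_punctured (f := fun _ => 0) contDiff_const (fun ξ h => alpha_of_le h)
    fun ξ hξ => ?_
  have hn : ContDiffAt ℝ ∞ (fun ξ : ℂ => ‖ξ‖) ξ := contDiffAt_norm ℝ hξ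
  have hm : 0 < ‖ξ‖ := norm_pos_iff.2 hξ
  have hre : ContDiffAt ℝ ∞ (fun ξ : ℂ => ξ.re) ξ := Complex.reCLM.contDiff.contDiffAt
  have hc : ContDiffAt ℝ ∞ (fun ξ : ℂ => cutoff ‖ξ‖) ξ :=
    contDiff_cutoff.contDiffAt.comp ξ hn
  have hs : ContDiffAt ℝ ∞ (fun ξ : ℂ => √‖ξ‖) ξ := hn.sqrt hm.ne'
  have hcen : ContDiffAt ℝ ∞ centre ξ :=
    contDiffAt_const.add ((contDiffAt_const.add ((hn.sub contDiffAt_const).div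
      (hn.add contDiffAt_const) (by positivity))).mul
        ((hn.add hre).div (contDiffAt_const.mul hn) (by positivity)))
  exact (Complex.ofRealCLM.contDiff.contDiffAt.comp ξ
    (hc.mul (((hs.mul (contDiffAt_const.add hn)).div hn hm.ne').mul hcen))).mul contDiffAt_id

theorem contDiff_beta : ContDiff ℝ ∞ beta := by
  have h1 : ContDiff ℝ ∞ (fun ξ : ℂ => (1 + ξ) / (10 * κ : ℝ)) := by
    simp only [div_eq_mul_inv]
    exact (contDiff_const.add contDiff_id).mul contDiff_const
  refine contDiff_of_punctured h1 (fun ξ h => beta_of_le h) fun ξ hξ => ?_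
  have hn : ContDiffAt ℝ ∞ (fun ξ : ℂ => ‖ξ‖) ξ := contDiffAt_norm ℝ hξ
  have hm : 0 < ‖ξ‖ := norm_pos_iff.2 hξ
  have hc : ContDiffAt ℝ ∞ (fun ξ : ℂ => cutoff ‖ξ‖) ξ :=
    contDiff_cutoff.contDiffAt.comp ξ hn
  have hs : ContDiffAt ℝ ∞ (fun ξ : ℂ => √‖ξ‖) ξ := hn.sqrt hm.ne'
  have ht : ContDiffAt ℝ ∞ (fun ξ : ℂ => trunc ‖ξ‖) ξ := contDiff_trunc.contDiffAt.comp ξ hn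
  have hpos := trunc_factor_pos hm.le
  have hr : ContDiffAt ℝ ∞ (fun ξ : ℂ => radius ‖ξ‖) ξ :=
    ((hs.mul (contDiffAt_const.add hn)).mul contDiffAt_const).div
      ((contDiffAt_const.sub ((ht.pow 2).div_const 400)).sqrt hpos.ne') (Real.sqrt_pos.2 hpos).ne'
  exact ((Complex.ofRealCLM.contDiff.contDiffAt.comp ξ (contDiffAt_const.sub hc)).mul
    h1.contDiffAt).add (Complex.ofRealCLM.contDiff.contDiffAt.comp ξ (hc.mul hr))

/-- The parametrization of the ball. It is fibred over the first coordinate `z = -1 - ξ`,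
`ξ = 20 x₁`, and affine on the fibres. -/
def ballMap (x : ℂ × ℂ) : ℂ × ℂ :=
  (-1 - 20 * x.1, -Complex.I * (beta (20 * x.1) * x.2 + alpha (20 * x.1)))

theorem contDiff_ballMap : ContDiff ℝ ∞ ballMap := by
  have h1 : ContDiff ℝ ∞ (fun x : ℂ × ℂ => 20 * x.1) := contDiff_const.mul contDiff_fst
  exact (contDiff_const.sub h1).prodMk (contDiff_const.mul
    (((contDiff_beta.comp h1).mul contDiff_snd).add (contDiff_alpha.comp h1)))

theorem ballMap_injective : Function.Injective ballMap := by
  rintro ⟨a, b⟩ ⟨c, d⟩ h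
  have e1 := congrArg Prod.fst h
  have e2 := congrArg Prod.snd h
  simp only [ballMap] at e1 e2
  have h1 : a = c := by linear_combination (-1 / 20 : ℂ) * e1
  subst h1
  have h2 := mul_left_cancel₀ (neg_ne_zero.2 Complex.I_ne_zero) e2
  have h3 := mul_left_cancel₀ (beta_ne_zero _) (add_right_cancel h2)
  rw [h3]

theorem det_comp_self_pos {g : (ℂ × ℂ) →ₗ[ℝ] (ℂ × ℂ)} (hg : Function.Injective g) :
    0 < LinearMap.det (g ∘ₗ g) := by
  rw [LinearMap.det_comp]
  have : LinearMap.det g ≠ 0 := (LinearEquiv.isUnit_det' (LinearEquiv.ofInjectiveEndo g hg)).ne_zero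
  exact mul_self_pos.2 this

/-- A real linear map of `ℂ²` that is block triangular, with complex linear diagonal blocks, preserves
the orientation: it is a product of squares. -/
theorem det_block_pos {a b : ℂ} (ha : a ≠ 0) (hb : b ≠ 0) (C : ℂ →ₗ[ℝ] ℂ)
    {L : (ℂ × ℂ) →ₗ[ℝ] (ℂ × ℂ)} (hL : ∀ v, L v = (a * v.1, b * (v.2 + C v.1))) :
    0 < LinearMap.det L := by
  obtain ⟨p, rfl⟩ := IsAlgClosed.exists_eq_mul_self a
  obtain ⟨r, rfl⟩ := IsAlgClosed.exists_eq_mul_self b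
  have hp : p ≠ 0 := left_ne_zero_of_mul ha
  have hr : r ≠ 0 := left_ne_zero_of_mul hb
  let M : (ℂ × ℂ) →ₗ[ℝ] (ℂ × ℂ) :=
    { toFun := fun v => (p * v.1, r * v.2)
      map_add' := fun x y => Prod.ext (mul_add _ _ _) (mul_add _ _ _)
      map_smul' := fun c x => Prod.ext (mul_smul_comm _ _ _) (mul_smul_comm _ _ _) }
  let S : (ℂ × ℂ) →ₗ[ℝ] (ℂ × ℂ) :=
    { toFun := fun v => (v.1, v.2 + (1 / 2 : ℝ) • C v.1)
      map_add' := fun x y => Prod.ext rfl (by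
        change x.2 + y.2 + (1 / 2 : ℝ) • C (x.1 + y.1) =
          x.2 + (1 / 2 : ℝ) • C x.1 + (y.2 + (1 / 2 : ℝ) • C y.1)
        rw [map_add, smul_add]
        abel)
      map_smul' := fun c x => Prod.ext rfl (by
        change c • x.2 + (1 / 2 : ℝ) • C (c • x.1) = c • (x.2 + (1 / 2 : ℝ) • C x.1)
        rw [map_smul, smul_add, smul_comm]) }
  have hM : Function.Injective M := by
    intro x y h
    have h1 : p * x.1 = p * y.1 := congrArg Prod.fst h
    have h2 : r * x.2 = r * y.2 := congrArg Prod.snd h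
    exact Prod.ext (mul_left_cancel₀ hp h1) (mul_left_cancel₀ hr h2)
  have hS : Function.Injective S := by
    intro x y h
    have h1 : x.1 = y.1 := (congrArg (fun z : ℂ × ℂ => z.1) h : (S x).1 = (S y).1)
    have h2 : x.2 + (1 / 2 : ℝ) • C x.1 = y.2 + (1 / 2 : ℝ) • C y.1 := congrArg Prod.snd h
    rw [h1] at h2
    exact Prod.ext h1 (add_right_cancel h2)
  have hLe : L = (M ∘ₗ M) ∘ₗ (S ∘ₗ S) := by
    refine LinearMap.ext fun v => ?_
    rw [hL]
    refine Prod.ext (mul_assoc _ _ _) ?_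
    change r * r * (v.2 + C v.1) =
      r * (r * (v.2 + (1 / 2 : ℝ) • C v.1 + (1 / 2 : ℝ) • C v.1))
    rw [add_assoc, ← add_smul]
    norm_num
    ring
  rw [hLe, LinearMap.det_comp]
  exact mul_pos (det_comp_self_pos hM) (det_comp_self_pos hS)

theorem fderiv_ballMap_det_pos (x : ℂ × ℂ) : 0 < (fderiv ℝ ballMap x).det := by
  have h1 : HasFDerivAt (fun x : ℂ × ℂ => 20 * x.1)
      ((20 : ℂ) • ContinuousLinearMap.fst ℝ ℂ ℂ) x := hasFDerivAt_fst.const_mul 20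
  have h2 : HasFDerivAt (fun x : ℂ × ℂ => x.2) (ContinuousLinearMap.snd ℝ ℂ ℂ) x := hasFDerivAt_snd
  have hb := ((contDiff_beta.differentiable (by simp) (20 * x.1)).hasFDerivAt).comp x h1
  have ha := ((contDiff_alpha.differentiable (by simp) (20 * x.1)).hasFDerivAt).comp x h1
  have h : HasFDerivAt ballMap _ x :=
    (h1.const_sub (-1)).prodMk (((hb.mul h2).add ha).const_mul (-Complex.I))
  rw [h.fderiv]
  have hβ := beta_ne_zero (20 * x.1)
  refine det_block_pos (a := -20) (b := -Complex.I * beta (20 * x.1)) (by norm_num)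
    (mul_ne_zero (neg_ne_zero.2 Complex.I_ne_zero) hβ)
    (((beta (20 * x.1))⁻¹ • (x.2 • (fderiv ℝ beta (20 * x.1)).comp
        ((20 : ℂ) • ContinuousLinearMap.id ℝ ℂ) + (fderiv ℝ alpha (20 * x.1)).comp
        ((20 : ℂ) • ContinuousLinearMap.id ℝ ℂ)) : ℂ →L[ℝ] ℂ) : ℂ →ₗ[ℝ] ℂ) fun v => ?_
  refine Prod.ext ?_ ?_
  · simp
  · simp
    field_simp
    ring

theorem isBallParam_ballMap : IsBallParam ballMap (ballMap '' D4) :=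
  ⟨contDiff_ballMap, ballMap_injective.injOn, fun x _ => fderiv_ballMap_det_pos x, rfl⟩

theorem fderiv_ballMap_injective (x : ℂ × ℂ) : Function.Injective (fderiv ℝ ballMap x) := by
  have h := (fderiv_ballMap_det_pos x).ne'
  exact (LinearMap.equivOfDetNeZero (fderiv ℝ ballMap x : (ℂ × ℂ) →ₗ[ℝ] (ℂ × ℂ)) h).injective

/-! ### The parametrization of the nodal cubic -/

/-- The parametrization of the nodal cubic; `s = i` and `s = -i` give the node. -/
def cubicMap (s : ℂ) : ℂ × ℂ := (-1 - s ^ 2, -Complex.I * (s + s ^ 3))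

/-- The complex derivative of `cubicMap`. -/
def cubicDeriv (s : ℂ) : ℂ × ℂ := (-(2 * s), -Complex.I * (1 + 3 * s ^ 2))

/-- The coordinates in the ball of the point with parameter `s` of the cubic. -/
def pull (s : ℂ) : ℂ × ℂ := (s ^ 2 / 20, (s + s ^ 3 - alpha (s ^ 2)) / beta (s ^ 2))

theorem ballMap_pull (s : ℂ) : ballMap (pull s) = cubicMap s := by
  have h : 20 * (s ^ 2 / 20) = s ^ 2 := by ring
  simp only [ballMap, pull, cubicMap, h]
  rw [mul_div_cancel₀ _ (beta_ne_zero _), sub_add_cancel]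

theorem contDiff_pull : ContDiff ℝ ∞ pull := by
  have h1 : ContDiff ℝ ∞ (fun s : ℂ => s ^ 2) := contDiff_id.pow 2
  have h2 : ContDiff ℝ ∞ (fun s : ℂ => (beta (s ^ 2))⁻¹) :=
    (contDiff_beta.comp h1).inv fun s => beta_ne_zero _
  have h3 : ContDiff ℝ ∞ (fun s : ℂ => s + s ^ 3 - alpha (s ^ 2)) :=
    (contDiff_id.add (contDiff_id.pow 3)).sub (contDiff_alpha.comp h1)
  have h4 := (h1.mul (contDiff_const (c := (20 : ℂ)⁻¹))).prodMk (h3.mul h2)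
  have h5 : pull = fun s => (s ^ 2 * (20 : ℂ)⁻¹, (s + s ^ 3 - alpha (s ^ 2)) * (beta (s ^ 2))⁻¹) := by
    funext s
    simp only [pull, div_eq_mul_inv]
  rw [h5]
  exact h4

theorem mem_zeroSet_nodalCubic {p : ℂ × ℂ} :
    p ∈ zeroSet nodalCubic ↔ p.2 ^ 2 = p.1 ^ 2 + p.1 ^ 3 := by
  simp only [zeroSet, nodalCubic, Set.mem_ofPred_eq, map_sub, map_pow, MvPolynomial.eval_X,
    Matrix.cons_val_zero, Matrix.cons_val_one]
  constructor <;> intro h <;> linear_combination h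

theorem cubicMap_mem (s : ℂ) : cubicMap s ∈ zeroSet nodalCubic := by
  rw [mem_zeroSet_nodalCubic]
  simp only [cubicMap]
  linear_combination (s + s ^ 3) ^ 2 * Complex.I_sq

theorem exists_cubicMap_eq {p : ℂ × ℂ} (hp : p ∈ zeroSet nodalCubic) : ∃ s, cubicMap s = p := by
  rw [mem_zeroSet_nodalCubic] at hp
  obtain ⟨z, w⟩ := p
  simp only at hp
  by_cases hz : z = 0
  · subst hz
    have hw : w = 0 := by
      have : w ^ 2 = 0 := by rw [hp]; ring
      exact pow_eq_zero_iff two_ne_zero |>.1 this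
    subst hw
    refine ⟨Complex.I, Prod.ext ?_ ?_⟩
    · simp [cubicMap]
    · simp only [cubicMap]
      linear_combination (-Complex.I ^ 2) * Complex.I_sq
  · refine ⟨-(Complex.I * w / z), Prod.ext ?_ ?_⟩
    · simp only [cubicMap]
      field_simp
      linear_combination hp - w ^ 2 * Complex.I_sq
    · obtain ⟨u, rfl⟩ : ∃ u, w = u * z := ⟨w / z, (div_mul_cancel₀ w hz).symm⟩
      have hu : u ^ 2 = 1 + z :=
        mul_right_cancel₀ (pow_ne_zero 2 hz) (by linear_combination hp)
      rw [← mul_assoc, mul_div_cancel_right₀ _ hz]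
      simp only [cubicMap]
      linear_combination (u + (Complex.I ^ 2 - 1) * u ^ 3) * Complex.I_sq + u * hu

theorem dPoly_nodalCubic (p v : ℂ × ℂ) :
    dPoly nodalCubic p v = -(2 * p.1 + 3 * p.1 ^ 2) * v.1 + 2 * p.2 * v.2 := by
  simp [dPoly, nodalCubic, MvPolynomial.pderiv_X]
  ring_nf
  simp

theorem dPoly_cubicDeriv (s c : ℂ) : dPoly nodalCubic (cubicMap s) (c • cubicDeriv s) = 0 := by
  rw [dPoly_nodalCubic]
  simp only [cubicMap, cubicDeriv, Prod.smul_fst, Prod.smul_snd, smul_eq_mul]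
  linear_combination (2 * c * (s + s ^ 3) * (1 + 3 * s ^ 2)) * Complex.I_sq

theorem exists_dPoly_ne_zero {s : ℂ} (hs : s ^ 2 ≠ -1) :
    ∃ v, dPoly nodalCubic (cubicMap s) v ≠ 0 := by
  by_cases h : s = 0
  · refine ⟨(1, 0), ?_⟩
    rw [dPoly_nodalCubic, h]
    norm_num [cubicMap]
  · refine ⟨(0, 1), ?_⟩
    rw [dPoly_nodalCubic]
    simp only [cubicMap, mul_zero, mul_one, zero_add]
    have h1 : s + s ^ 3 = s * (1 + s ^ 2) := by ring
    rw [h1]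
    refine mul_ne_zero two_ne_zero (mul_ne_zero (neg_ne_zero.2 Complex.I_ne_zero)
      (mul_ne_zero h fun h0 => hs ?_))
    linear_combination h0

theorem fderiv_cubicMap (s v : ℂ) :
    fderiv ℝ cubicMap s v = v • cubicDeriv s := by
  have h1 : HasDerivAt (fun s : ℂ => -1 - s ^ 2) (-(2 * s)) s := by
    simpa using ((hasDerivAt_id s).pow 2).const_sub (-1)
  have h2 : HasDerivAt (fun s : ℂ => -Complex.I * (s + s ^ 3)) (-Complex.I * (1 + 3 * s ^ 2)) s := by
    simpa using ((hasDerivAt_id s).add ((hasDerivAt_id s).pow 3)).const_mul (-Complex.I)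
  have h := ((h1.prodMk h2).hasFDerivAt.restrictScalars ℝ).fderiv
  change fderiv ℝ cubicMap s = _ at h
  rw [h]
  simp [cubicDeriv]

theorem totalDegree_nodalCubic : 0 < nodalCubic.totalDegree := by
  rw [Nat.pos_iff_ne_zero]
  intro h
  rw [MvPolynomial.totalDegree_eq_zero_iff_eq_C] at h
  have h1 : MvPolynomial.eval ![(0 : ℂ), 0] nodalCubic = 0 := by simp [nodalCubic]
  have h2 : MvPolynomial.eval ![(0 : ℂ), 1] nodalCubic = 1 := by simp [nodalCubic]
  rw [h, MvPolynomial.eval_C] at h1 h2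
  rw [h1] at h2
  norm_num at h2

/-! ### The part of the cubic in the ball -/

/-- The squared norm of the point of the ball with parameter `s` on the cubic; the part of the
cubic outside the ball is given by `1 < level s`. -/
def level (s : ℂ) : ℝ := rdot (pull s) (pull s)

/-- The squared distance of the point `s` of the cubic from the centre of its slice of the ball, up to
a factor that depends on `‖s‖`. Here `φ` is the argument of `s`, and `υ = (m - 1) / (m + 1)` with
`m = ‖s‖²`. -/
def dist2 (υ φ : ℝ) : ℝ :=
  (qf (Real.cos φ) + υ * Real.cos φ ^ 2) ^ 2 + υ ^ 2 * Real.sin φ ^ 2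

/-- The point of `ℂ` with `‖s‖ = exp σ` and argument `φ`. -/
def polar (σ φ : ℝ) : ℂ := Complex.exp (σ + φ * Complex.I)

/-- The increasing bijection `(0, ∞) → (-1, 1)` inverse to `mob`. -/
def ups (m : ℝ) : ℝ := (m - 1) / (m + 1)

theorem level_eq (s : ℂ) : level s = Complex.normSq (s ^ 2) / 400 +
    Complex.normSq (s + s ^ 3 - alpha (s ^ 2)) / Complex.normSq (beta (s ^ 2)) := by
  have h : ∀ x : ℂ × ℂ, rdot x x = Complex.normSq x.1 + Complex.normSq x.2 := fun x => by
    rw [rdot, Complex.normSq_apply, Complex.normSq_apply]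
    ring
  rw [level, h, pull, Complex.normSq_div, Complex.normSq_div]
  norm_num [Complex.normSq_apply]

theorem polar_eq (σ φ : ℝ) :
    polar σ φ = (Real.exp σ : ℝ) * (Real.cos φ + Real.sin φ * Complex.I) := by
  rw [polar, Complex.exp_add, Complex.exp_mul_I, Complex.ofReal_exp, Complex.ofReal_cos,
    Complex.ofReal_sin]

theorem cos_add_sin_mul_I_mul (φ : ℝ) : ((Real.cos φ : ℂ) + Real.sin φ * Complex.I) *
    (Real.cos φ - Real.sin φ * Complex.I) = 1 := by
  have h : ((Real.sin φ : ℂ)) ^ 2 + (Real.cos φ : ℂ) ^ 2 = 1 := by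
    exact_mod_cast Real.sin_sq_add_cos_sq φ
  linear_combination h - (Real.sin φ : ℂ) ^ 2 * Complex.I_sq

theorem exp_two_mul_I (φ : ℝ) : Complex.exp ((2 * φ : ℝ) * Complex.I) =
    ((Real.cos φ : ℂ) + Real.sin φ * Complex.I) ^ 2 := by
  rw [Complex.ofReal_cos, Complex.ofReal_sin, ← Complex.exp_mul_I, ← Complex.exp_nat_mul]
  congr 1
  push_cast
  ring

theorem exp_two_mul (σ : ℝ) : Real.exp (2 * σ) = Real.exp σ ^ 2 := by
  rw [← Real.exp_nat_mul]
  norm_num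

theorem polar_sq (σ φ : ℝ) :
    polar σ φ ^ 2 = (Real.exp (2 * σ) : ℝ) * Complex.exp ((2 * φ : ℝ) * Complex.I) := by
  rw [polar_eq, exp_two_mul_I, exp_two_mul, mul_pow]
  push_cast
  ring

theorem norm_polar_sq (σ φ : ℝ) : ‖polar σ φ ^ 2‖ = Real.exp (2 * σ) := by
  rw [polar_sq, norm_mul, Complex.norm_exp_ofReal_mul_I, mul_one, Complex.norm_real,
    Real.norm_of_nonneg (Real.exp_pos _).le]

theorem re_polar_sq (σ φ : ℝ) :
    (polar σ φ ^ 2).re = Real.exp (2 * σ) * (2 * Real.cos φ ^ 2 - 1) := by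
  rw [polar_sq, Complex.re_ofReal_mul, Complex.exp_ofReal_mul_I_re, Real.cos_two_mul]

theorem exists_polar {s : ℂ} (hs : s ≠ 0) : ∃ σ φ, |φ| ≤ Real.pi ∧ polar σ φ = s :=
  ⟨Real.log ‖s‖, s.arg, Complex.abs_arg_le_pi s, by
    rw [polar, ← Complex.log.eq_1, Complex.exp_log hs]⟩

theorem centre_polar_sq (σ φ : ℝ) : centre (polar σ φ ^ 2) =
    13 / 25 + (1 / 2 + ups (Real.exp (2 * σ))) * Real.cos φ ^ 2 := by
  have := Real.exp_pos (2 * σ)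
  rw [centre, norm_polar_sq, re_polar_sq, ups]
  field_simp
  ring

/-- The position of a point of the cubic relative to the centre of its slice of the ball. -/
theorem sub_alpha_polar (σ φ : ℝ) : polar σ φ + polar σ φ ^ 3 - alpha (polar σ φ ^ 2) =
    (Real.exp σ * (1 + Real.exp (2 * σ)) : ℝ) * (Complex.exp ((2 * φ : ℝ) * Complex.I) *
      ((Real.cos φ - cutoff (Real.exp (2 * σ)) * centre (polar σ φ ^ 2) : ℝ) +
        (ups (Real.exp (2 * σ)) * Real.sin φ : ℝ) * Complex.I)) := by
  have hm := Real.exp_pos (2 * σ)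
  have hρ := Real.exp_pos σ
  have hs : √(Real.exp (2 * σ)) = Real.exp σ := by rw [exp_two_mul, Real.sqrt_sq hρ.le]
  have hu : ups (Real.exp (2 * σ)) * (1 + Real.exp (2 * σ)) = Real.exp (2 * σ) - 1 := by
    rw [ups, add_comm 1, div_mul_cancel₀ _ (by positivity)]
  have hu' : (ups (Real.exp (2 * σ)) : ℂ) * (1 + Real.exp (2 * σ) : ℝ) =
      (Real.exp (2 * σ) : ℝ) - 1 := by exact_mod_cast hu
  have ha : alpha (polar σ φ ^ 2) = ((cutoff (Real.exp (2 * σ)) *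
      (Real.exp σ * (1 + Real.exp (2 * σ)) * centre (polar σ φ ^ 2)) : ℝ) : ℂ) *
        Complex.exp ((2 * φ : ℝ) * Complex.I) := by
    rw [alpha, norm_polar_sq, hs]
    nth_rewrite 2 [polar_sq]
    rw [← mul_assoc, ← Complex.ofReal_mul]
    congr 2
    field_simp
  have h1 : polar σ φ ^ 3 = polar σ φ ^ 2 * polar σ φ := by ring
  rw [ha, h1, polar_sq, exp_two_mul_I, polar_eq]
  have h2 := cos_add_sin_mul_I_mul φ
  push_cast at hu' h2 ⊢
  linear_combination (-(Complex.exp σ * (Complex.cos φ + Complex.sin φ * Complex.I))) * h2 -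
    (Complex.exp σ * (Complex.cos φ + Complex.sin φ * Complex.I) ^ 2 * Complex.sin φ *
      Complex.I) * hu'

theorem normSq_sub_alpha_polar (σ φ : ℝ) :
    Complex.normSq (polar σ φ + polar σ φ ^ 3 - alpha (polar σ φ ^ 2)) =
      (Real.exp σ * (1 + Real.exp (2 * σ))) ^ 2 *
        ((Real.cos φ - cutoff (Real.exp (2 * σ)) * centre (polar σ φ ^ 2)) ^ 2 +
          ups (Real.exp (2 * σ)) ^ 2 * Real.sin φ ^ 2) := by
  have h : Complex.normSq (Complex.exp ((2 * φ : ℝ) * Complex.I)) = 1 := by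
    rw [Complex.normSq_eq_norm_sq, Complex.norm_exp_ofReal_mul_I, one_pow]
  rw [sub_alpha_polar, Complex.normSq_mul, Complex.normSq_mul, h, Complex.normSq_ofReal,
    Complex.normSq_add_mul_I]
  ring

theorem normSq_polar_sq (σ φ : ℝ) : Complex.normSq (polar σ φ ^ 2) = Real.exp (2 * σ) ^ 2 := by
  rw [Complex.normSq_eq_norm_sq, norm_polar_sq]

theorem cos_sub_centre (σ φ : ℝ) : Real.cos φ - centre (polar σ φ ^ 2) =
    -(qf (Real.cos φ) + ups (Real.exp (2 * σ)) * Real.cos φ ^ 2) := by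
  rw [centre_polar_sq, qf]
  ring

theorem radius_sq {m : ℝ} (h : 0 < m) :
    radius m ^ 2 = m * (1 + m) ^ 2 * (9 / 25) / (1 - trunc m ^ 2 / 400) := by
  rw [radius, div_pow, Real.sq_sqrt (trunc_factor_pos h.le).le, mul_pow, mul_pow, Real.sq_sqrt h.le]
  norm_num

theorem level_polar_of_ge {σ : ℝ} (φ : ℝ) (h : 1 / 9 ≤ Real.exp (2 * σ)) :
    level (polar σ φ) = Real.exp (2 * σ) ^ 2 / 400 +
      25 / 9 * dist2 (ups (Real.exp (2 * σ))) φ * (1 - trunc (Real.exp (2 * σ)) ^ 2 / 400) := by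
  have hm := Real.exp_pos (2 * σ)
  have hρ := Real.exp_pos σ
  rw [level_eq, normSq_polar_sq, normSq_sub_alpha_polar, beta_of_ge (by rwa [norm_polar_sq]),
    norm_polar_sq, Complex.normSq_ofReal, ← sq, radius_sq hm, cutoff_of_ge h, one_mul,
    cos_sub_centre, neg_sq, dist2, mul_pow, ← exp_two_mul σ]
  have := (trunc_factor_pos hm.le).ne'
  field_simp

/-- In the annulus a point is outside the ball if and only if `dist2` exceeds `9/25`. -/
theorem level_polar_of_mem {σ : ℝ} (φ : ℝ) (h : 1 / 9 ≤ Real.exp (2 * σ))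
    (h' : Real.exp (2 * σ) ≤ 9) : level (polar σ φ) = 1 + (1 - Real.exp (2 * σ) ^ 2 / 400) *
      (25 / 9 * dist2 (ups (Real.exp (2 * σ))) φ - 1) := by
  rw [level_polar_of_ge φ h, trunc_of_le h']
  ring

theorem pull_of_le {s : ℂ} (h : ‖s ^ 2‖ ≤ 1 / 25) : pull s = (s ^ 2 / 20, (10 * κ : ℝ) * s) := by
  have h1 : 1 + s ^ 2 ≠ 0 := fun h0 => by
    have : s ^ 2 = -1 := by linear_combination h0
    rw [this] at h
    norm_num at h
  have h2 : ((10 * κ : ℝ) : ℂ) ≠ 0 := by exact_mod_cast (mul_pos (by norm_num) κ_pos).ne'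
  rw [pull, alpha_of_le h, beta_of_le h]
  congr 1
  field_simp
  ring

theorem level_polar_of_le {σ : ℝ} (φ : ℝ) (h : Real.exp (2 * σ) ≤ 1 / 25) :
    level (polar σ φ) = Real.exp (2 * σ) ^ 2 / 400 +
      (100 - 1 / 40000) * Real.exp (2 * σ) := by
  have e : Complex.normSq (polar σ φ) = Real.exp (2 * σ) := by
    rw [Complex.normSq_eq_norm_sq, ← norm_pow, norm_polar_sq]
  have e1 : ∀ x : ℂ × ℂ, rdot x x = Complex.normSq x.1 + Complex.normSq x.2 := fun x => by
    rw [rdot, Complex.normSq_apply, Complex.normSq_apply]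
    ring
  rw [level, pull_of_le (by rwa [norm_polar_sq]), e1, Complex.normSq_div, normSq_polar_sq,
    Complex.normSq_mul, Complex.normSq_ofReal, e]
  have e2 : Complex.normSq 20 = 400 := by norm_num [Complex.normSq_apply]
  rw [e2]
  linear_combination 100 * Real.exp (2 * σ) * κ_sq

theorem ups_le_ups {m n : ℝ} (hm : 0 < m) (h : m ≤ n) : ups m ≤ ups n := by
  rw [ups, ups, div_le_div_iff₀ (by linarith) (by linarith)]
  nlinarith

theorem ups_lt_ups {m n : ℝ} (hm : 0 < m) (h : m < n) : ups m < ups n := by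
  rw [ups, ups, div_lt_div_iff₀ (by linarith) (by linarith)]
  nlinarith

theorem one_lt_level_of_nine_le {σ : ℝ} (φ : ℝ) (h : 9 ≤ Real.exp (2 * σ)) :
    1 < level (polar σ φ) := by
  rw [level_polar_of_ge φ (by linarith)]
  have hu : 4 / 5 ≤ ups (Real.exp (2 * σ)) := by
    have := ups_le_ups (by norm_num) h
    norm_num [ups] at this ⊢
    linarith
  set m := Real.exp (2 * σ)
  obtain ⟨h1, h2, h3⟩ := trunc_of_ge h
  have hF : 12 / 25 ≤ dist2 (ups m) φ := by
    have e1 : (ups m * Real.cos φ ^ 2) ^ 2 ≤ (qf (Real.cos φ) + ups m * Real.cos φ ^ 2) ^ 2 :=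
      pow_le_pow_left₀ (by positivity) (by linarith [qf_pos (Real.cos φ)]) 2
    have e2 : (4 / 5) ^ 2 ≤ ups m ^ 2 := pow_le_pow_left₀ (by norm_num) hu 2
    have e3 := Wf_ge (Real.cos φ)
    have e4 : dist2 (ups m) φ ≥ ups m ^ 2 * Wf (Real.cos φ) := by
      rw [dist2, Real.sin_sq, Wf]
      linarith
    nlinarith
  have hd : trunc m ^ 2 ≤ m ^ 2 := pow_le_pow_left₀ (by linarith) h2 2
  have hd' : trunc m ^ 2 ≤ 100 := by nlinarith
  nlinarith

/-- The ring where the cutoff takes place is outside the ball, as `υ ≤ -4/5` there: then the distance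
to the centre of the slice is large for every value of the cutoff. -/
theorem one_lt_level_of_mem {σ : ℝ} (φ : ℝ) (h : 1 / 25 ≤ Real.exp (2 * σ))
    (h' : Real.exp (2 * σ) ≤ 1 / 9) : 1 < level (polar σ φ) := by
  have hu : ups (Real.exp (2 * σ)) ≤ -(4 / 5) := by
    have := ups_le_ups (by linarith) h'
    norm_num [ups] at this ⊢
    linarith
  have hu' : -(12 / 13) ≤ ups (Real.exp (2 * σ)) := by
    have := ups_le_ups (by norm_num) h
    norm_num [ups] at this ⊢
    linarith
  have hβ : ‖beta (polar σ φ ^ 2)‖ ≤ Real.exp σ * (1 + Real.exp (2 * σ)) * (61 / 100) := by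
    have hρ : 1 / 5 ≤ Real.exp σ := by
      rw [exp_two_mul] at h
      have := Real.exp_pos σ
      nlinarith
    have e1 : ‖(1 + polar σ φ ^ 2) / ((10 * κ : ℝ) : ℂ)‖ ≤
        Real.exp σ * (1 + Real.exp (2 * σ)) * (61 / 100) := by
      rw [norm_div, Complex.norm_real, Real.norm_of_nonneg (by linarith [κ_pos]),
        div_le_iff₀ (by linarith [κ_pos])]
      have f1 : ‖1 + polar σ φ ^ 2‖ ≤ 1 + Real.exp (2 * σ) := by
        refine (norm_add_le _ _).trans ?_
        rw [norm_one, norm_polar_sq]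
      refine f1.trans ?_
      have f2 : 1 ≤ Real.exp σ * (61 / 100) * (10 * κ) := by
        have := mul_le_mul hρ κ_gt.le (by norm_num) (Real.exp_pos σ).le
        linarith
      have f3 := Real.exp_pos (2 * σ)
      nlinarith
    have e2 : radius (Real.exp (2 * σ)) ≤ Real.exp σ * (1 + Real.exp (2 * σ)) * (61 / 100) := by
      have hs : √(Real.exp (2 * σ)) = Real.exp σ := by
        rw [exp_two_mul, Real.sqrt_sq (Real.exp_pos σ).le]
      have hw : 60 / 61 ≤ √(1 - trunc (Real.exp (2 * σ)) ^ 2 / 400) := by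
        refine Real.le_sqrt_of_sq_le ?_
        rw [trunc_of_le (by linarith)]
        nlinarith
      rw [radius, hs, div_le_iff₀ (by linarith)]
      have : 0 ≤ Real.exp σ * (1 + Real.exp (2 * σ)) := by positivity
      nlinarith
    have hc0 := cutoff_nonneg (Real.exp (2 * σ))
    have hc1 := cutoff_le_one (Real.exp (2 * σ))
    rw [beta, norm_polar_sq]
    refine (norm_add_le _ _).trans ?_
    rw [norm_mul, Complex.norm_real, Complex.norm_real, Real.norm_of_nonneg (by linarith),
      Real.norm_of_nonneg (mul_nonneg hc0 (radius_pos (Real.exp_pos _)).le)]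
    have := mul_le_mul_of_nonneg_left e1 (sub_nonneg.2 hc1)
    have := mul_le_mul_of_nonneg_left e2 hc0
    linarith
  have hη : 2 / 5 ≤ (Real.cos φ - cutoff (Real.exp (2 * σ)) * centre (polar σ φ ^ 2)) ^ 2 +
      ups (Real.exp (2 * σ)) ^ 2 * Real.sin φ ^ 2 := by
    rw [centre_polar_sq, Real.sin_sq]
    have hc0 := cutoff_nonneg (Real.exp (2 * σ))
    have hc1 := cutoff_le_one (Real.exp (2 * σ))
    set u := ups (Real.exp (2 * σ))
    set χ := cutoff (Real.exp (2 * σ))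
    set x := Real.cos φ with hx
    have hx1 : x ≤ 1 := Real.cos_le_one φ
    have hx0 : -1 ≤ x := Real.neg_one_le_cos φ
    have hxx : x ^ 2 ≤ 1 := by nlinarith
    have hu2 : 16 / 25 ≤ u ^ 2 := by nlinarith
    have hA0 : 0 ≤ 13 / 25 + (1 / 2 + u) * x ^ 2 := by nlinarith
    have hA1 : 13 / 25 + (1 / 2 + u) * x ^ 2 ≤ 13 / 25 - 3 / 10 * x ^ 2 := by nlinarith
    set A := 13 / 25 + (1 / 2 + u) * x ^ 2
    have hχA0 : 0 ≤ χ * A := mul_nonneg hc0 hA0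
    have hχA1 : χ * A ≤ A := by nlinarith
    have hs : 16 / 25 * (1 - x ^ 2) ≤ u ^ 2 * (1 - x ^ 2) :=
      mul_le_mul_of_nonneg_right hu2 (by linarith)
    rcases le_or_gt x 0 with h0 | h0
    · have : x ^ 2 ≤ (x - χ * A) ^ 2 := by nlinarith
      nlinarith
    rcases le_or_gt x (3 / 5) with h1 | h1
    · nlinarith [sq_nonneg (x - χ * A)]
    · have h2 : 37 / 25 * x - 89 / 125 ≤ x - χ * A := by nlinarith [sq_nonneg (x - 4 / 5)]
      have h3 : (37 / 25 * x - 89 / 125) ^ 2 ≤ (x - χ * A) ^ 2 :=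
        pow_le_pow_left₀ (by linarith) h2 2
      nlinarith [sq_nonneg (x - 17 / 25)]
  rw [level_eq, normSq_polar_sq, normSq_sub_alpha_polar]
  have hb : 0 < Complex.normSq (beta (polar σ φ ^ 2)) := Complex.normSq_pos.2 (beta_ne_zero _)
  have hb2 : Complex.normSq (beta (polar σ φ ^ 2)) ≤
      (Real.exp σ * (1 + Real.exp (2 * σ)) * (61 / 100)) ^ 2 := by
    rw [Complex.normSq_eq_norm_sq]
    exact pow_le_pow_left₀ (norm_nonneg _) hβ 2
  have hk : 0 < (Real.exp σ * (1 + Real.exp (2 * σ))) ^ 2 := by positivity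
  have h1 : 1 ≤ (Real.exp σ * (1 + Real.exp (2 * σ))) ^ 2 *
      ((Real.cos φ - cutoff (Real.exp (2 * σ)) * centre (polar σ φ ^ 2)) ^ 2 +
          ups (Real.exp (2 * σ)) ^ 2 * Real.sin φ ^ 2) / Complex.normSq (beta (polar σ φ ^ 2)) := by
    rw [le_div_iff₀ hb, one_mul]
    refine hb2.trans ?_
    rw [mul_pow]
    exact mul_le_mul_of_nonneg_left (by linarith) hk.le
  have h2 : 0 < Real.exp (2 * σ) ^ 2 := by positivity
  linarith

theorem level_zero : level 0 = 0 := by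
  rw [level, pull_of_le (by norm_num)]
  simp [rdot]

theorem abs_ups_lt {m : ℝ} (h : 1 / 9 < m) (h' : m < 9) : |ups m| < 4 / 5 := by
  have h1 := ups_lt_ups (by norm_num) h
  have h2 := ups_lt_ups (by linarith) h'
  norm_num [ups] at h1 h2
  rw [abs_lt]
  unfold ups
  constructor <;> linarith

/-- The part of the annulus around the negative real axis is outside the ball. -/
theorem dist2_gt_of_cos_le {υ φ : ℝ} (hυ : -(4 / 5) ≤ υ) (hφ : Real.cos φ ≤ -(1 / 5)) :
    9 / 25 < dist2 υ φ := by
  have h0 := Real.neg_one_le_cos φ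
  have h : 7 / 10 ≤ qf (Real.cos φ) + υ * Real.cos φ ^ 2 := by
    unfold qf
    nlinarith
  have : 0 ≤ υ ^ 2 * Real.sin φ ^ 2 := by positivity
  unfold dist2
  nlinarith

/-- Completion of the square in `υ`. -/
theorem dist2_eq (υ φ : ℝ) : dist2 υ φ = (√(Wf (Real.cos φ)) * υ +
    qf (Real.cos φ) * Real.cos φ ^ 2 / √(Wf (Real.cos φ))) ^ 2 + Jf φ ^ 2 := by
  have h := sq_sqrt_Wf (Real.cos φ)
  have h1 := sqrt_Wf_pos (Real.cos φ)
  have h2 := Real.sin_sq φ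
  rw [dist2, Jf]
  set w := √(Wf (Real.cos φ))
  rw [Wf] at h
  field_simp
  rw [h2]
  linear_combination (qf (Real.cos φ) ^ 2 - υ ^ 2 * w ^ 2) * h

/-! ### The boundary link -/

theorem ups_mob {υ : ℝ} (h : |υ| < 4 / 5) : ups (mob υ) = υ := by
  have := abs_lt.1 h
  have h1 : (1 - υ) ≠ 0 := by linarith
  have h2 : mob υ + 1 ≠ 0 := by linarith [mob_pos h]
  rw [ups, div_eq_iff h2, mob]
  field_simp
  ring

theorem mob_ups {m : ℝ} (h : 0 < m) : mob (ups m) = m := by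
  have h1 : 1 - ups m = 2 / (m + 1) := by
    rw [ups]
    field_simp
    ring
  rw [mob, h1, ups]
  field_simp
  ring

theorem hasDerivAt_ups_exp (σ : ℝ) :
    HasDerivAt (fun σ => ups (Real.exp (2 * σ))) (1 - ups (Real.exp (2 * σ)) ^ 2) σ := by
  have h1 : HasDerivAt (fun σ : ℝ => Real.exp (2 * σ)) (Real.exp (2 * σ) * 2) σ := by
    simpa using ((hasDerivAt_id σ).const_mul 2).exp
  have hm := Real.exp_pos (2 * σ)
  have h2 := (h1.sub_const 1).div (h1.add_const 1) (by positivity)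
  refine HasDerivAt.congr_deriv (f := fun σ => ups (Real.exp (2 * σ))) h2 ?_
  simp only [ups]
  field_simp
  ring

/-- A direction in the parameter plane in which `level` increases points out of the ball. -/
theorem outward_of_hasDerivAt {σ φ a b d : ℝ} (hd : 0 < d)
    (h : HasDerivAt (fun r : ℝ => level (polar (σ + r * a) (φ - r * b))) d 0) :
    0 < rdot (pull (polar σ φ)) (fderiv ℝ pull (polar σ φ) ((a - b * Complex.I) * polar σ φ)) := by
  have h1 : HasDerivAt (fun r : ℝ => ((σ + r * a : ℝ) : ℂ) + ((φ - r * b : ℝ) : ℂ) * Complex.I)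
      ((a : ℂ) - b * Complex.I) 0 := by
    have e1 : HasDerivAt (fun r : ℝ => ((σ + r * a : ℝ) : ℂ)) (a : ℂ) 0 := by
      have : HasDerivAt (fun r : ℝ => σ + r * a) a 0 := by
        simpa using ((hasDerivAt_id (0 : ℝ)).mul_const a).const_add σ
      exact this.ofReal_comp
    have e2 : HasDerivAt (fun r : ℝ => ((φ - r * b : ℝ) : ℂ)) (((-b : ℝ)) : ℂ) 0 := by
      have : HasDerivAt (fun r : ℝ => φ - r * b) (-b) 0 := by
        simpa using ((hasDerivAt_id (0 : ℝ)).mul_const b).const_sub φ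
      exact this.ofReal_comp
    have := e1.add (e2.mul_const Complex.I)
    push_cast at this ⊢
    rwa [neg_mul, ← sub_eq_add_neg] at this
  have h2 : HasDerivAt (fun r : ℝ => polar (σ + r * a) (φ - r * b))
      ((a - b * Complex.I) * polar σ φ) 0 := by
    have := h1.cexp
    simp only [zero_mul, add_zero, sub_zero] at this
    rw [mul_comm]
    exact this
  have h0 : polar (σ + 0 * a) (φ - 0 * b) = polar σ φ := by simp
  have h3 : HasFDerivAt pull (fderiv ℝ pull (polar σ φ)) (polar (σ + 0 * a) (φ - 0 * b)) := by
    rw [h0]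
    exact (contDiff_pull.differentiable (by simp) _).hasFDerivAt
  have h4 : HasDerivAt (fun r : ℝ => pull (polar (σ + r * a) (φ - r * b)))
      (fderiv ℝ pull (polar σ φ) ((a - b * Complex.I) * polar σ φ)) 0 := 
    HasFDerivAt.comp_hasDerivAt (l := pull) 0 h3 h2
  set v := fderiv ℝ pull (polar σ φ) ((a - b * Complex.I) * polar σ φ)
  have f1 : HasDerivAt (fun r : ℝ => (pull (polar (σ + r * a) (φ - r * b))).1) v.1 0 := h4.fst
  have f2 : HasDerivAt (fun r : ℝ => (pull (polar (σ + r * a) (φ - r * b))).2) v.2 0 := h4.snd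
  have g1 : HasDerivAt (fun r : ℝ => (pull (polar (σ + r * a) (φ - r * b))).1.re) v.1.re 0 :=
    Complex.reCLM.hasFDerivAt.comp_hasDerivAt 0 f1
  have g2 : HasDerivAt (fun r : ℝ => (pull (polar (σ + r * a) (φ - r * b))).1.im) v.1.im 0 :=
    Complex.imCLM.hasFDerivAt.comp_hasDerivAt 0 f1
  have g3 : HasDerivAt (fun r : ℝ => (pull (polar (σ + r * a) (φ - r * b))).2.re) v.2.re 0 :=
    Complex.reCLM.hasFDerivAt.comp_hasDerivAt 0 f2
  have g4 : HasDerivAt (fun r : ℝ => (pull (polar (σ + r * a) (φ - r * b))).2.im) v.2.im 0 :=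
    Complex.imCLM.hasFDerivAt.comp_hasDerivAt 0 f2
  have h5 := (((g1.mul g1).add (g2.mul g2)).add (g3.mul g3)).add (g4.mul g4)
  have h6 := h.unique h5
  rw [h0] at h6
  rw [rdot]
  linarith

/-- The boundary curve around `s = 0`, the circle of radius `1/10`. -/
def axisParam (t : ℝ) : ℂ := polar (-Real.log 10) (t + Real.pi)

/-- The boundary curve in the annulus `1 / 3 < ‖s‖ < 3` of the parameter plane. -/
def knotParam (t : ℝ) : ℂ := polar (Real.log (mob (upsL 0 t)) / 2) (phi t)

theorem exp_two_mul_neg_log : Real.exp (2 * -Real.log 10) = 1 / 100 := by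
  rw [exp_two_mul, Real.exp_neg, Real.exp_log (by norm_num)]
  norm_num

theorem abs_upsL_zero_lt (t : ℝ) : |upsL 0 t| < 4 / 5 := abs_upsL_lt (by norm_num) t

theorem exp_two_mul_half_log (t : ℝ) :
    Real.exp (2 * (Real.log (mob (upsL 0 t)) / 2)) = mob (upsL 0 t) := by
  rw [mul_div_cancel₀ _ two_ne_zero, Real.exp_log (mob_pos (abs_upsL_zero_lt t))]

theorem mob_gt {υ : ℝ} (h : |υ| < 4 / 5) : 1 / 9 < mob υ := by
  have := abs_lt.1 h
  rw [mob, lt_div_iff₀ (by linarith)]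
  linarith

theorem sqrt_mul_upsL_add (t : ℝ) : √(Wf (Real.cos (phi t))) * upsL 0 t +
    qf (Real.cos (phi t)) * Real.cos (phi t) ^ 2 / √(Wf (Real.cos (phi t))) =
      3 / 5 * Real.cos t := by
  have := (sqrt_Wf_pos (Real.cos (phi t))).ne'
  rw [upsL, mul_div_cancel₀ _ this]
  ring

theorem dist2_upsL (t : ℝ) : dist2 (upsL 0 t) (phi t) = 9 / 25 := by
  rw [dist2_eq, sqrt_mul_upsL_add, Jf_phi]
  linear_combination 9 / 25 * Real.sin_sq_add_cos_sq t

theorem level_axisParam (t : ℝ) : level (axisParam t) = 1 := by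
  rw [axisParam, level_polar_of_le _ (by rw [exp_two_mul_neg_log]; norm_num), exp_two_mul_neg_log]
  norm_num

theorem level_knotParam (t : ℝ) : level (knotParam t) = 1 := by
  have h := abs_upsL_zero_lt t
  rw [knotParam, level_polar_of_mem _ (by rw [exp_two_mul_half_log]; exact (mob_gt h).le)
    (by rw [exp_two_mul_half_log]; exact (mob_lt h).le), exp_two_mul_half_log, ups_mob h,
    dist2_upsL]
  norm_num

/-- A point of the annulus in the boundary of the ball lies on the curve `knotParam`. -/
theorem exists_knotParam_eq {σ φ : ℝ} (hφ : |φ| ≤ Real.pi) (h : 1 / 9 < Real.exp (2 * σ))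
    (h' : Real.exp (2 * σ) < 9) (hF : dist2 (ups (Real.exp (2 * σ))) φ = 9 / 25) :
    ∃ t, knotParam t = polar σ φ := by
  have hu := abs_ups_lt h h'
  set υ := ups (Real.exp (2 * σ)) with hυ
  have hc : -(1 / 5) < Real.cos φ := by
    by_contra hn
    have := dist2_gt_of_cos_le (abs_lt.1 hu).1.le (not_lt.1 hn)
    linarith
  have hφm : |φ| ≤ φmax := by
    by_contra hn
    have := Real.cos_lt_cos_of_nonneg_of_le_pi φmax_pos.le hφ (not_le.1 hn)
    rw [Real.cos_abs, cos_φmax] at this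
    linarith
  rw [dist2_eq] at hF
  set a := √(Wf (Real.cos φ)) * υ + qf (Real.cos φ) * Real.cos φ ^ 2 / √(Wf (Real.cos φ)) with ha
  have hn : ‖(⟨5 / 3 * a, 5 / 3 * Jf φ⟩ : ℂ)‖ = 1 := by
    rw [← pow_left_inj₀ (norm_nonneg _) zero_le_one two_ne_zero, ← Complex.normSq_eq_norm_sq,
      Complex.normSq_mk]
    linear_combination 25 / 9 * hF
  have hn0 : (⟨5 / 3 * a, 5 / 3 * Jf φ⟩ : ℂ) ≠ 0 := norm_ne_zero_iff.1 (by rw [hn]; exact one_ne_zero)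
  set t := Complex.arg ⟨5 / 3 * a, 5 / 3 * Jf φ⟩
  have hs : Real.sin t = 5 / 3 * Jf φ := by rw [Complex.sin_arg, hn, div_one]
  have hcos : Real.cos t = 5 / 3 * a := by rw [Complex.cos_arg hn0, hn, div_one]
  have hphi : phi t = φ := angle_unique (Real.sin_mem_Icc t) (abs_le.1 hφm) (by rw [hs]; ring)
  have hups : upsL 0 t = υ := by
    have h1 := sqrt_mul_upsL_add t
    rw [hphi, hcos, ha] at h1
    exact mul_left_cancel₀ (sqrt_Wf_pos (Real.cos φ)).ne' (by linarith)
  refine ⟨t, ?_⟩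
  rw [knotParam, hphi, hups, hυ, mob_ups (Real.exp_pos _), Real.log_exp,
    mul_div_cancel_left₀ _ two_ne_zero]

/-- The points of the cubic in the boundary of the ball. -/
theorem level_eq_one_iff {s : ℂ} :
    level s = 1 ↔ (∃ t, axisParam t = s) ∨ ∃ t, knotParam t = s := by
  constructor
  · intro hs
    have hs0 : s ≠ 0 := fun h => by
      rw [h, level_zero] at hs
      norm_num at hs
    obtain ⟨σ, φ, hφ, rfl⟩ := exists_polar hs0
    have hm := Real.exp_pos (2 * σ)
    rcases le_or_gt (Real.exp (2 * σ)) (1 / 25) with h1 | h1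
    · left
      rw [level_polar_of_le φ h1] at hs
      have h2 : Real.exp (2 * σ) = 1 / 100 := by
        have : (Real.exp (2 * σ) - 1 / 100) *
            (Real.exp (2 * σ) / 400 + 1 / 40000 + (100 - 1 / 40000)) = 0 := by
          linear_combination hs
        rcases mul_eq_zero.1 this with h | h
        · linarith
        · linarith
      have h3 : -Real.log 10 = σ := by
        have := exp_two_mul_neg_log.trans h2.symm
        have := Real.exp_injective this
        linarith
      exact ⟨φ - Real.pi, by rw [axisParam, h3, sub_add_cancel]⟩
    rcases le_or_gt (Real.exp (2 * σ)) (1 / 9) with h2 | h2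
    · have := one_lt_level_of_mem φ h1.le h2
      linarith
    rcases le_or_gt 9 (Real.exp (2 * σ)) with h3 | h3
    · have := one_lt_level_of_nine_le φ h3
      linarith
    · right
      rw [level_polar_of_mem φ h2.le h3.le] at hs
      have h4 : (1 - Real.exp (2 * σ) ^ 2 / 400) ≠ 0 := by nlinarith
      have h5 : 25 / 9 * dist2 (ups (Real.exp (2 * σ))) φ - 1 = 0 :=
        (mul_eq_zero.1 (by linarith)).resolve_left h4
      exact exists_knotParam_eq hφ h2 h3 (by linarith)
  · rintro (⟨t, rfl⟩ | ⟨t, rfl⟩)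
    · exact level_axisParam t
    · exact level_knotParam t

theorem hasDerivAt_polar {σ φ : ℝ → ℝ} {a b t : ℝ} (hσ : HasDerivAt σ a t) (hφ : HasDerivAt φ b t) :
    HasDerivAt (fun t => polar (σ t) (φ t)) ((a + b * Complex.I) * polar (σ t) (φ t)) t := by
  have := (hσ.ofReal_comp.add (hφ.ofReal_comp.mul_const Complex.I)).cexp
  rw [mul_comm]
  exact this

/-- At `γ t` the rotation by a quarter turn of the velocity of the curve `γ` in the parameter
plane points out of the ball. -/
def OutwardAt (γ : ℝ → ℂ) (t : ℝ) : Prop :=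
  0 < rdot (pull (γ t)) (fderiv ℝ pull (γ t) (-Complex.I * deriv γ t))

theorem outwardAt_polar {σ φ : ℝ → ℝ} {a b t d : ℝ} (hσ : HasDerivAt σ a t)
    (hφ : HasDerivAt φ b t) (hd : 0 < d)
    (h : HasDerivAt (fun r : ℝ => level (polar (σ t + r * b) (φ t - r * a))) d 0) :
    OutwardAt (fun t => polar (σ t) (φ t)) t := by
  have h1 := outward_of_hasDerivAt hd h
  have h2 : -Complex.I * deriv (fun t => polar (σ t) (φ t)) t =
      (b - a * Complex.I) * polar (σ t) (φ t) := by
    rw [(hasDerivAt_polar hσ hφ).deriv]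
    linear_combination (-(b : ℂ) * polar (σ t) (φ t)) * Complex.I_sq
  unfold OutwardAt
  rw [h2]
  exact h1

theorem outwardAt_axisParam (t : ℝ) : OutwardAt axisParam t := by
  have hm : Real.exp (2 * (-Real.log 10 + 0 * 1)) = 1 / 100 := by
    rw [zero_mul, add_zero, exp_two_mul_neg_log]
  have h0 : HasDerivAt (fun r : ℝ => -Real.log 10 + r * 1) 1 0 := by
    simpa using (hasDerivAt_id (0 : ℝ)).const_add (-Real.log 10)
  have h1 : HasDerivAt (fun r : ℝ => Real.exp (2 * (-Real.log 10 + r * 1))) (1 / 100 * 2) 0 :=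
    (h0.const_mul 2).exp.congr_deriv (by rw [hm]; norm_num)
  have h3 : HasDerivAt (fun r : ℝ => Real.exp (2 * (-Real.log 10 + r * 1)) ^ 2 / 400 +
      (100 - 1 / 40000) * Real.exp (2 * (-Real.log 10 + r * 1)))
      (2 * (1 / 100) * (1 / 100 * 2) / 400 + (100 - 1 / 40000) * (1 / 100 * 2)) 0 := by
    refine (((h1.pow 2).div_const 400).add (h1.const_mul (100 - 1 / 40000))).congr_deriv ?_
    rw [hm]
    norm_num
  refine outwardAt_polar (σ := fun _ => -Real.log 10) (φ := fun t => t + Real.pi) (a := 0) (b := 1)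
    (d := 2 * (1 / 100) * (1 / 100 * 2) / 400 + (100 - 1 / 40000) * (1 / 100 * 2))
    (hasDerivAt_const _ _) ((hasDerivAt_id t).add_const _) (by norm_num) ?_
  refine h3.congr_of_eventuallyEq ?_
  have h4 : ∀ᶠ r : ℝ in 𝓝 0, Real.exp (2 * (-Real.log 10 + r * 1)) < 1 / 25 :=
    h1.continuousAt.eventually_lt_const (by beta_reduce; rw [hm]; norm_num)
  filter_upwards [h4] with r hr
  exact level_polar_of_le _ hr.le

/-- The derivative of `dist2` along a path, in terms of the derivatives of the two squares whose
sum is `dist2`. -/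
theorem hasDerivAt_dist2 {ν ψ : ℝ → ℝ} {ν' ψ' w1 k1 J1 r : ℝ} (hν : HasDerivAt ν ν' r)
    (hψ : HasDerivAt ψ ψ' r)
    (hw : HasDerivAt (fun φ : ℝ => √(Wf (Real.cos φ))) w1 (ψ r))
    (hk : HasDerivAt (fun φ : ℝ => qf (Real.cos φ) * Real.cos φ ^ 2 / √(Wf (Real.cos φ))) k1 (ψ r))
    (hJ : HasDerivAt Jf J1 (ψ r)) :
    HasDerivAt (fun r => dist2 (ν r) (ψ r))
      (2 * (√(Wf (Real.cos (ψ r))) * ν r +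
        qf (Real.cos (ψ r)) * Real.cos (ψ r) ^ 2 / √(Wf (Real.cos (ψ r)))) *
          (√(Wf (Real.cos (ψ r))) * ν' + (ν r * w1 + k1) * ψ') + 2 * Jf (ψ r) * (J1 * ψ')) r := by
  have h1 : HasDerivAt (fun r => √(Wf (Real.cos (ψ r)))) (w1 * ψ') r :=
    HasDerivAt.comp (h₂ := fun φ : ℝ => √(Wf (Real.cos φ))) r hw hψ
  have h2 : HasDerivAt (fun r => qf (Real.cos (ψ r)) * Real.cos (ψ r) ^ 2 /
      √(Wf (Real.cos (ψ r)))) (k1 * ψ') r := HasDerivAt.comp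
    (h₂ := fun φ : ℝ => qf (Real.cos φ) * Real.cos φ ^ 2 / √(Wf (Real.cos φ))) r hk hψ
  have h3 : HasDerivAt (fun r => Jf (ψ r)) (J1 * ψ') r := HasDerivAt.comp (h₂ := Jf) r hJ hψ
  have h4 : (fun r => dist2 (ν r) (ψ r)) = fun r => (√(Wf (Real.cos (ψ r))) * ν r +
        qf (Real.cos (ψ r)) * Real.cos (ψ r) ^ 2 / √(Wf (Real.cos (ψ r)))) ^ 2 + Jf (ψ r) ^ 2 :=
    funext fun r => dist2_eq _ _
  rw [h4]
  refine ((((h1.mul hν).add h2).pow 2).add (h3.pow 2)).congr_deriv ?_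
  simp only [Pi.add_apply, Pi.mul_apply]
  push_cast
  ring

theorem contDiff_sqrt_Wf_cos : ContDiff ℝ ∞ (fun φ : ℝ => √(Wf (Real.cos φ))) :=
  contDiff_sqrt_Wf.comp Real.contDiff_cos

theorem contDiff_shift : ContDiff ℝ ∞
    (fun φ : ℝ => qf (Real.cos φ) * Real.cos φ ^ 2 / √(Wf (Real.cos φ))) :=
  ((contDiff_qf.comp Real.contDiff_cos).mul (Real.contDiff_cos.pow 2)).div contDiff_sqrt_Wf_cos
    fun _ => (sqrt_Wf_pos _).ne'

/-- The two squares whose sum is `dist2` are `(3/5 * cos t)²` and `(3/5 * sin t)²` along the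
boundary curve. If the curve moves in the parameter plane with the velocity `(a, b)`, then `dist2`
grows in the direction `(b, -a)`. -/
theorem hasDerivAt_dist2_upsL {t a : ℝ} {ν ψ : ℝ → ℝ}
    (ha : HasDerivAt (upsL 0) ((1 - upsL 0 t ^ 2) * a) t)
    (hν : HasDerivAt ν ((1 - upsL 0 t ^ 2) * deriv phi t) 0) (hψ : HasDerivAt ψ (-a) 0)
    (hν0 : ν 0 = upsL 0 t) (hψ0 : ψ 0 = phi t) :
    ∃ d : ℝ, 0 < d ∧ HasDerivAt (fun r => dist2 (ν r) (ψ r)) d 0 := by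
  have hφ : HasDerivAt phi (deriv phi t) t := (hasDerivAt_phi t).differentiableAt.hasDerivAt
  have hJrel : deriv Jf (phi t) * deriv phi t = 3 / 5 * Real.cos t := by
    have := deriv_Jf_mul_deriv_angle (Real.sin_mem_Icc t)
    change deriv Jf (phi t) * _ = _ at this
    rw [(hasDerivAt_phi t).deriv, ← mul_assoc, this]
  have hw := (contDiff_sqrt_Wf_cos.differentiable (by simp) (phi t)).hasDerivAt
  have hk := (contDiff_shift.differentiable (by simp) (phi t)).hasDerivAt
  have hJ := (contDiff_Jf.differentiable (by simp) (phi t)).hasDerivAt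
  have hJpos := deriv_Jf_pos (cos_phi_gt t).le
  generalize deriv (fun φ : ℝ => √(Wf (Real.cos φ))) (phi t) = w1 at hw
  generalize deriv (fun φ : ℝ => qf (Real.cos φ) * Real.cos φ ^ 2 / √(Wf (Real.cos φ))) (phi t) =
    k1 at hk
  generalize deriv Jf (phi t) = J1 at hJ hJrel hJpos
  generalize deriv phi t = b at hφ hν hJrel
  have hw0 : 0 < √(Wf (Real.cos (phi t))) := sqrt_Wf_pos _
  have hArel : √(Wf (Real.cos (phi t))) * ((1 - upsL 0 t ^ 2) * a) + (upsL 0 t * w1 + k1) * b =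
      -(3 / 5 * Real.sin t) := by
    have h1 : HasDerivAt (fun t => √(Wf (Real.cos (phi t)))) (w1 * b) t :=
      HasDerivAt.comp (h₂ := fun φ : ℝ => √(Wf (Real.cos φ))) t hw hφ
    have h2 : HasDerivAt (fun t => qf (Real.cos (phi t)) * Real.cos (phi t) ^ 2 /
      √(Wf (Real.cos (phi t)))) (k1 * b) t := HasDerivAt.comp
        (h₂ := fun φ : ℝ => qf (Real.cos φ) * Real.cos φ ^ 2 / √(Wf (Real.cos φ))) t hk hφ
    have h3 := (h1.mul ha).add h2
    have h4 : HasDerivAt (fun t => √(Wf (Real.cos (phi t))) * upsL 0 t +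
      qf (Real.cos (phi t)) * Real.cos (phi t) ^ 2 / √(Wf (Real.cos (phi t))))
        (w1 * b * upsL 0 t + √(Wf (Real.cos (phi t))) * ((1 - upsL 0 t ^ 2) * a) + k1 * b) t := h3
    rw [funext sqrt_mul_upsL_add] at h4
    have h5 := h4.unique ((Real.hasDerivAt_cos t).const_mul (3 / 5))
    linarith
  have hp := hasDerivAt_dist2 (w1 := w1) (k1 := k1) (J1 := J1) hν hψ (by rwa [hψ0]) (by rwa [hψ0])
    (by rwa [hψ0])
  rw [hψ0, hν0, sqrt_mul_upsL_add, Jf_phi] at hp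
  generalize √(Wf (Real.cos (phi t))) = w at hw0 hArel hp
  have hυ := abs_lt.1 (abs_upsL_zero_lt t)
  have hq : 0 < 1 - upsL 0 t ^ 2 := by nlinarith
  refine ⟨2 * J1 * w * ((1 - upsL 0 t ^ 2) * (b ^ 2 + a ^ 2)), ?_, hp.congr_deriv ?_⟩
  · refine mul_pos (mul_pos (mul_pos two_pos hJpos) hw0) (mul_pos hq ?_)
    by_contra hn
    have hb0 : b = 0 := by nlinarith
    have ha0 : a = 0 := by nlinarith
    rw [hb0, mul_zero] at hJrel
    rw [ha0, hb0] at hArel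
    have := Real.sin_sq_add_cos_sq t
    have e1 : Real.cos t = 0 := by linarith
    have e2 : Real.sin t = 0 := by linarith
    rw [e1, e2] at this
    norm_num at this
  · linear_combination (-2 * (w * ((1 - upsL 0 t ^ 2) * b) - (upsL 0 t * w1 + k1) * a)) * hJrel +
        (-2 * J1 * a) * hArel

theorem contDiff_upsL_zero : ContDiff ℝ ∞ (upsL 0) := by
  have h : ContDiff ℝ ∞ (fun t : ℝ => ((0 : ℝ), t)) := contDiff_const.prodMk contDiff_id
  exact ContDiff.comp (g := fun p : ℝ × ℝ => upsL p.1 p.2) (f := fun t : ℝ => ((0 : ℝ), t))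
    contDiff_upsL h

theorem outwardAt_knotParam (t : ℝ) : OutwardAt knotParam t := by
  have hυ := abs_upsL_zero_lt t
  obtain ⟨σ, hσdef⟩ : ∃ σ : ℝ → ℝ, σ = fun t => Real.log (mob (upsL 0 t)) / 2 := ⟨_, rfl⟩
  have hexp : ∀ t, Real.exp (2 * σ t) = mob (upsL 0 t) := fun t => by
    rw [hσdef, exp_two_mul_half_log]
  have hσ : HasDerivAt σ (deriv σ t) t := by
    have h1 : DifferentiableAt ℝ mob (upsL 0 t) :=
      (contDiffAt_mob hυ).differentiableAt (by simp)
    have h2 : DifferentiableAt ℝ (fun t => mob (upsL 0 t)) t :=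
      DifferentiableAt.comp (g := mob) t h1 (contDiff_upsL_zero.differentiable (by simp) t)
    rw [hσdef]
    exact ((h2.log (mob_pos hυ).ne').div_const 2).hasDerivAt
  have hφ : HasDerivAt phi (deriv phi t) t := (hasDerivAt_phi t).differentiableAt.hasDerivAt
  have hups : ∀ t, ups (Real.exp (2 * σ t)) = upsL 0 t := fun t => by
    rw [hexp, ups_mob (abs_upsL_zero_lt t)]
  have hcurve : knotParam = fun t => polar (σ t) (phi t) := by
    rw [hσdef]
    rfl
  rw [hcurve]
  clear hσdef hcurve
  generalize deriv σ t = a at hσ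
  have ha : HasDerivAt (upsL 0) ((1 - upsL 0 t ^ 2) * a) t := by
    have h1 : HasDerivAt (fun t => ups (Real.exp (2 * σ t))) ((1 - upsL 0 t ^ 2) * a) t := by
      have := HasDerivAt.comp (h₂ := fun σ => ups (Real.exp (2 * σ))) t
        (hasDerivAt_ups_exp (σ t)) hσ
      rwa [hups] at this
    rwa [funext hups] at h1
  have hp1 : HasDerivAt (fun r : ℝ => σ t + r * deriv phi t) (deriv phi t) 0 := by
    simpa using ((hasDerivAt_id (0 : ℝ)).mul_const (deriv phi t)).const_add (σ t)
  have hp2 : HasDerivAt (fun r : ℝ => phi t - r * a) (-a) 0 := by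
    simpa using ((hasDerivAt_id (0 : ℝ)).mul_const a).const_sub (phi t)
  have hm0 : Real.exp (2 * (σ t + 0 * deriv phi t)) = mob (upsL 0 t) := by
    rw [zero_mul, add_zero, hexp]
  have hpe : HasDerivAt (fun r : ℝ => Real.exp (2 * (σ t + r * deriv phi t)))
      (mob (upsL 0 t) * (2 * deriv phi t)) 0 :=
    (hp1.const_mul 2).exp.congr_deriv (by rw [hm0])
  have hpu : HasDerivAt (fun r : ℝ => ups (Real.exp (2 * (σ t + r * deriv phi t))))
      ((1 - upsL 0 t ^ 2) * deriv phi t) 0 := by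
    have h1 : HasDerivAt (fun σ => ups (Real.exp (2 * σ))) (1 - upsL 0 t ^ 2)
        (σ t + 0 * deriv phi t) :=
      (hasDerivAt_ups_exp _).congr_deriv (by rw [hm0, ups_mob hυ])
    exact HasDerivAt.comp (h₂ := fun σ => ups (Real.exp (2 * σ))) 0 h1 hp1
  obtain ⟨d, hd, hpd⟩ := hasDerivAt_dist2_upsL ha hpu hp2 (by rw [hm0, ups_mob hυ]) (by ring)
  have hlev : HasDerivAt (fun r : ℝ => 1 + (1 - Real.exp (2 * (σ t + r * deriv phi t)) ^ 2 / 400) *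
      (25 / 9 * dist2 (ups (Real.exp (2 * (σ t + r * deriv phi t)))) (phi t - r * a) - 1))
      ((1 - mob (upsL 0 t) ^ 2 / 400) * (25 / 9 * d)) 0 := by
    refine ((((hpe.pow 2).div_const 400).const_sub 1).mul
      ((hpd.const_mul (25 / 9)).sub_const 1)).const_add 1 |>.congr_deriv ?_
    simp only [Pi.pow_apply]
    rw [hm0, ups_mob hυ, zero_mul, sub_zero, dist2_upsL]
    ring
  have hmob := mob_sq_lt hυ
  refine outwardAt_polar hσ hφ (mul_pos (by linarith) (mul_pos (by norm_num) hd))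
    (hlev.congr_of_eventuallyEq ?_)
  have h4 : ∀ᶠ r : ℝ in 𝓝 0, Real.exp (2 * (σ t + r * deriv phi t)) < 9 :=
    hpe.continuousAt.eventually_lt_const (by beta_reduce; rw [hm0]; exact mob_lt hυ)
  have h5 : ∀ᶠ r : ℝ in 𝓝 0, 1 / 9 < Real.exp (2 * (σ t + r * deriv phi t)) :=
    hpe.continuousAt.eventually_const_lt (by beta_reduce; rw [hm0]; exact mob_gt hυ)
  filter_upwards [h4, h5] with r hr hr'
  exact level_polar_of_mem _ hr'.le hr.le

/-! ### Transversality and orientation -/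

theorem axisTwo_eq_pull (t : ℝ) : axisTwo (1 / 2000) κ t = pull (axisParam t) := by
  have h1 : Real.exp (-Real.log 10) = 1 / 10 := by
    rw [Real.exp_neg, Real.exp_log (by norm_num)]
    norm_num
  rw [axisParam, pull_of_le (by rw [norm_polar_sq, exp_two_mul_neg_log]; norm_num), polar_sq,
    exp_two_mul_neg_log, polar_eq, h1, exp_two_mul_I, Real.cos_add_pi, Real.sin_add_pi, axisTwo,
    exp_two_mul_I, Complex.exp_mul_I]
  refine Prod.ext ?_ ?_
  · push_cast
    ring
  · push_cast
    ring

/-- Up to positive factors, `knotL 0` is the part of the link of the ball in the annulus. -/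
theorem knotL_eq_pull (t : ℝ) : ∃ k : ℝ, 0 < k ∧ pull (knotParam t) = k • knotL 0 t := by
  have hυ := abs_upsL_zero_lt t
  have hm := mob_pos hυ
  have hq := mob_sq_lt hυ
  set m := mob (upsL 0 t) with hmdef
  have hge : 1 / 9 ≤ ‖knotParam t ^ 2‖ := by
    rw [knotParam, norm_polar_sq, exp_two_mul_half_log]
    exact (mob_gt hυ).le
  have hsq : √(1 - m ^ 2 / 400) = √(400 - m ^ 2) / 20 := by
    rw [show (1 - m ^ 2 / 400) = (400 - m ^ 2) / 20 ^ 2 by ring, Real.sqrt_div hq.le,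
      Real.sqrt_sq (by norm_num)]
  have hr : 0 < √(400 - m ^ 2) := Real.sqrt_pos.2 hq
  refine ⟨5 / 3 * √(1 - m ^ 2 / 400), by rw [hsq]; positivity, Prod.ext ?_ ?_⟩
  · simp only [pull, knotL, Prod.smul_fst]
    rw [knotParam, polar_sq, exp_two_mul_half_log, ff, hsq, ← hmdef, Complex.real_smul,
      ← mul_assoc, ← Complex.ofReal_mul, mul_div_right_comm]
    congr 1
    have : 5 / 3 * (√(400 - m ^ 2) / 20) * (3 / 5 * m / √(400 - m ^ 2)) = m / 20 := by
      field_simp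
    rw [this]
    push_cast
    ring
  · simp only [pull, knotL, Prod.smul_snd]
    rw [beta_of_ge hge, knotParam, sub_alpha_polar, norm_polar_sq, cutoff_of_ge, one_mul,
      cos_sub_centre, exp_two_mul_half_log, ups_mob hυ, radius, ← hmdef, trunc_of_le (mob_lt hυ).le,
      Complex.real_smul, yL]
    · have hs : √m = Real.exp (Real.log m / 2) := by
        rw [Real.exp_half, Real.exp_log hm]
      have hc : cL 0 (Real.cos (phi t)) = Real.cos (phi t) ^ 2 := by rw [cL]; ring
      have he := Real.exp_pos (Real.log m / 2)
      have hw : 0 < √(1 - m ^ 2 / 400) := by rw [hsq]; positivity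
      rw [← hs, hc]
      have hk : √m * (1 + m) =
          5 / 3 * √(1 - m ^ 2 / 400) * (√m * (1 + m) * (3 / 5) / √(1 - m ^ 2 / 400)) := by
        field_simp
      have hne : ((√m * (1 + m) * (3 / 5) / √(1 - m ^ 2 / 400) : ℝ) : ℂ) ≠ 0 := by
        have : 0 < √m := Real.sqrt_pos.2 hm
        exact_mod_cast (by positivity : (0 : ℝ) < _).ne'
      have hq0 : -((1 - 0) * qf (Real.cos (phi t))) - upsL 0 t * Real.cos (phi t) ^ 2 =
          -(qf (Real.cos (phi t)) + upsL 0 t * Real.cos (phi t) ^ 2) := by ring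
      rw [div_eq_iff hne, hq0, mul_right_comm, ← Complex.ofReal_mul, ← hk]
    · rw [exp_two_mul_half_log]
      exact (mob_gt hυ).le

theorem curve_zero_eq (t : ℝ) : isConeLink_cut.toLink.curve 0 t = pull (axisParam t) := by
  change normalize (axisTwo (1 / 2000) κ t) = _
  rw [axisTwo_eq_pull]
  exact normalize_of_mem (level_axisParam t)

theorem curve_one_eq (t : ℝ) : isConeLink_cut.toLink.curve 1 t = pull (knotParam t) := by
  change normalize (knotL 0 t) = _
  obtain ⟨k, hk, he⟩ := knotL_eq_pull t
  rw [← normalize_smul hk, ← he]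
  exact normalize_of_mem (level_knotParam t)

theorem differentiable_axisParam : Differentiable ℝ axisParam := fun t =>
  (hasDerivAt_polar (σ := fun _ => -Real.log 10) (φ := fun t => t + Real.pi)
    (hasDerivAt_const t _) ((hasDerivAt_id t).add_const _)).differentiableAt

theorem differentiable_knotParam : Differentiable ℝ knotParam := fun t => by
  have h1 : DifferentiableAt ℝ mob (upsL 0 t) :=
    (contDiffAt_mob (abs_upsL_zero_lt t)).differentiableAt (by simp)
  have h2 : DifferentiableAt ℝ (fun t => mob (upsL 0 t)) t :=
    DifferentiableAt.comp (g := mob) t h1 (contDiff_upsL_zero.differentiable (by simp) t)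
  exact (hasDerivAt_polar (σ := fun t => Real.log (mob (upsL 0 t)) / 2) (φ := phi)
    ((h2.log (mob_pos (abs_upsL_zero_lt t)).ne').div_const 2).hasDerivAt
    (hasDerivAt_phi t)).differentiableAt

/-- Each component of the cut link is the image of a curve in the parameter plane, which has the
region inside the ball on its left. -/
theorem exists_param (i : Fin 2) : ∃ γ : ℝ → ℂ, Differentiable ℝ γ ∧ (∀ t, OutwardAt γ t) ∧
    isConeLink_cut.toLink.curve i = fun t => pull (γ t) := by
  fin_cases i
  · exact ⟨axisParam, differentiable_axisParam, outwardAt_axisParam, funext curve_zero_eq⟩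
  · exact ⟨knotParam, differentiable_knotParam, outwardAt_knotParam, funext curve_one_eq⟩

theorem fderiv_ballMap_pull (s v : ℂ) :
    fderiv ℝ ballMap (pull s) (fderiv ℝ pull s v) = v • cubicDeriv s := by
  have h1 := (contDiff_ballMap.differentiable (by simp) (pull s)).hasFDerivAt.comp s
    (contDiff_pull.differentiable (by simp) s).hasFDerivAt
  have h2 : ballMap ∘ pull = cubicMap := funext ballMap_pull
  rw [h2] at h1
  rw [← fderiv_cubicMap, h1.fderiv]
  rfl

theorem exists_pull_eq {x : ℂ × ℂ} (h : ballMap x ∈ zeroSet nodalCubic) : ∃ s, pull s = x := by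
  obtain ⟨s, hs⟩ := exists_cubicMap_eq h
  exact ⟨s, ballMap_injective ((ballMap_pull s).trans hs)⟩

/-- The node is inside the ball. -/
theorem level_lt_of_sq {s : ℂ} (hs : s ^ 2 = -1) : level s < 1 := by
  have h1 : s + s ^ 3 = 0 := by linear_combination s * hs
  have h2 : alpha (-1) = ((-(26 / 25) : ℝ) : ℂ) := by
    have hc : centre (-1) = 13 / 25 := by norm_num [centre]
    rw [alpha, hc, norm_neg, norm_one, cutoff_of_ge (by norm_num)]
    norm_num
  rw [level_eq, hs, h1, h2, beta_of_ge (by norm_num), zero_sub, Complex.normSq_neg,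
    Complex.normSq_neg, Complex.normSq_ofReal, Complex.normSq_ofReal, ← sq (radius _), norm_neg,
    norm_one, radius_sq one_pos, trunc_of_le (by norm_num)]
  norm_num

theorem isCutLink_toLink : IsCutLink nodalCubic ballMap isConeLink_cut.toLink := by
  refine ⟨?_, fun i t => ?_⟩
  · ext x
    constructor
    · rintro ⟨i, t, rfl⟩
      refine ⟨isConeLink_cut.toLink.mem_sphere i t, ?_⟩
      obtain ⟨γ, -, -, hγ⟩ := exists_param i
      rw [hγ, ballMap_pull]
      exact cubicMap_mem _
    · rintro ⟨hx, hx'⟩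
      obtain ⟨s, rfl⟩ := exists_pull_eq hx'
      rcases level_eq_one_iff.1 hx with ⟨t, rfl⟩ | ⟨t, rfl⟩
      · exact ⟨0, t, curve_zero_eq t⟩
      · exact ⟨1, t, curve_one_eq t⟩
  · obtain ⟨γ, hd, ho, hγ⟩ := exists_param i
    have hc : isConeLink_cut.toLink.curve i t = pull (γ t) := congrFun hγ t
    rw [hc]
    refine ⟨(-Complex.I * deriv γ t) • cubicDeriv (γ t), ?_, ⟨_, ho t, fderiv_ballMap_pull _ _⟩,
      Complex.I, by simp, ?_⟩
    · rw [ballMap_pull]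
      exact dPoly_cubicDeriv _ _
    · have h1 : HasDerivAt (isConeLink_cut.toLink.curve i) (fderiv ℝ pull (γ t) (deriv γ t)) t := by
        rw [hγ]
        exact HasFDerivAt.comp_hasDerivAt (l := pull) t
          (contDiff_pull.differentiable (by simp) (γ t)).hasFDerivAt (hd t).hasDerivAt
      rw [h1.deriv, fderiv_ballMap_pull, smul_smul, ← mul_assoc]
      congr 1
      linear_combination (deriv γ t) * Complex.I_sq

theorem transverseToBoundary_ballMap : TransverseToBoundary nodalCubic ballMap := by
  intro x hx hx'
  obtain ⟨i, t, rfl⟩ : x ∈ isConeLink_cut.toLink.support := isCutLink_toLink.1 ▸ ⟨hx, hx'⟩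
  obtain ⟨γ, -, ho, hγ⟩ := exists_param i
  have hc : isConeLink_cut.toLink.curve i t = pull (γ t) := congrFun hγ t
  rw [hc] at hx ⊢
  rw [ballMap_pull]
  refine ⟨exists_dPoly_ne_zero fun h => ?_, _, dPoly_cubicDeriv (γ t) (-Complex.I * deriv γ t), ?_⟩
  · have h1 := level_lt_of_sq h
    have h2 : level (γ t) = 1 := hx
    linarith
  · rintro ⟨ξ, h0, hξ⟩
    have h1 := fderiv_ballMap_injective _ (hξ.trans (fderiv_ballMap_pull _ _).symm)
    have h2 := ho t
    rw [OutwardAt, ← h1, h0] at h2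
    exact lt_irrefl _ h2

/-! ### The part of the cubic outside the ball -/

theorem zeroSet_diff_ball : zeroSet nodalCubic \ ballMap '' D4 = cubicMap '' {s | 1 < level s} := by
  ext p
  constructor
  · rintro ⟨hp, hp'⟩
    obtain ⟨s, rfl⟩ := exists_cubicMap_eq hp
    refine ⟨s, ?_, rfl⟩
    by_contra hs
    have h1 : level s ≤ 1 := not_lt.1 hs
    exact hp' ⟨pull s, h1, ballMap_pull s⟩
  · rintro ⟨s, hs, rfl⟩
    refine ⟨cubicMap_mem s, ?_⟩
    rintro ⟨x, hx, hxs⟩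
    have h1 : x = pull s := ballMap_injective (hxs.trans (ballMap_pull s).symm)
    subst h1
    have h2 : level s ≤ 1 := hx
    exact not_lt.2 h2 hs

theorem continuous_polar : Continuous (fun p : ℝ × ℝ => polar p.1 p.2) := by
  unfold polar
  fun_prop

theorem isPreconnected_polar_image {A : Set ℝ} {B : Set ℝ} (hA : IsPreconnected A)
    (hB : IsPreconnected B) : IsPreconnected ((fun p : ℝ × ℝ => polar p.1 p.2) '' (A ×ˢ B)) :=
  (hA.prod hB).image _ continuous_polar.continuousOn

/-- `dist2` is a convex function of its first argument. -/
theorem dist2_le_of_mem {a b c φ k : ℝ} (hab : a ≤ b) (hbc : b ≤ c) (ha : dist2 a φ ≤ k)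
    (hc : dist2 c φ ≤ k) : dist2 b φ ≤ k := by
  have h1 : 0 ≤ (b - a) * (c - b) := mul_nonneg (by linarith) (by linarith)
  rcases hab.eq_or_lt with h | h
  · rwa [← h]
  have hW : 0 ≤ Real.cos φ ^ 4 + Real.sin φ ^ 2 := by positivity
  have h2 : (c - a) * dist2 b φ = (c - b) * dist2 a φ + (b - a) * dist2 c φ -
      (c - a) * ((b - a) * (c - b)) * (Real.cos φ ^ 4 + Real.sin φ ^ 2) := by
    unfold dist2
    ring
  have h3 : 0 ≤ (c - a) * ((b - a) * (c - b)) * (Real.cos φ ^ 4 + Real.sin φ ^ 2) :=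
    mul_nonneg (mul_nonneg (by linarith) h1) hW
  have h4 := mul_le_mul_of_nonneg_left ha (sub_nonneg.2 hbc)
  have h5 := mul_le_mul_of_nonneg_left hc (sub_nonneg.2 hab)
  have h6 : (c - a) * dist2 b φ ≤ (c - a) * k := by linarith
  exact le_of_mul_le_mul_left h6 (by linarith)

theorem one_lt_level_iff {σ φ : ℝ} (h : 1 / 9 ≤ Real.exp (2 * σ)) (h' : Real.exp (2 * σ) ≤ 9) :
    1 < level (polar σ φ) ↔ 9 / 25 < dist2 (ups (Real.exp (2 * σ))) φ := by
  rw [level_polar_of_mem φ h h']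
  have : 0 < 1 - Real.exp (2 * σ) ^ 2 / 400 := by nlinarith
  constructor
  · intro h1
    have := pos_of_mul_pos_right (by linarith : 0 < (1 - Real.exp (2 * σ) ^ 2 / 400) *
      (25 / 9 * dist2 (ups (Real.exp (2 * σ))) φ - 1)) this.le
    linarith
  · intro h1
    have := mul_pos this (by linarith : 0 < 25 / 9 * dist2 (ups (Real.exp (2 * σ))) φ - 1)
    linarith

theorem one_lt_level_inner {σ : ℝ} (φ : ℝ) (h : 1 / 100 < Real.exp (2 * σ))
    (h' : Real.exp (2 * σ) ≤ 1 / 9) : 1 < level (polar σ φ) := by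
  rcases le_or_gt (Real.exp (2 * σ)) (1 / 25) with h1 | h1
  · rw [level_polar_of_le φ h1]
    nlinarith
  · exact one_lt_level_of_mem φ h1.le h'

/-- Outside the ball each point can be moved along its radius, to the outside or to the inside. -/
theorem radius_subset {σ φ : ℝ} (h : 1 < level (polar σ φ)) :
    (∀ τ, σ ≤ τ → 1 < level (polar τ φ)) ∨
      ∀ τ, τ ≤ σ → 1 / 100 < Real.exp (2 * τ) → 1 < level (polar τ φ) := by
  by_contra! hn
  obtain ⟨⟨τ, h1, h2⟩, ν, h3, h4, h5⟩ := hn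
  have e1 : Real.exp (2 * σ) ≤ Real.exp (2 * τ) := Real.exp_le_exp.2 (by linarith)
  have e2 : Real.exp (2 * ν) ≤ Real.exp (2 * σ) := Real.exp_le_exp.2 (by linarith)
  have e3 : 1 / 9 < Real.exp (2 * ν) := by
    by_contra hn
    exact not_lt.2 h5 (one_lt_level_inner φ h4 (not_lt.1 hn))
  have e4 : Real.exp (2 * τ) < 9 := by
    by_contra hn
    exact not_lt.2 h2 (one_lt_level_of_nine_le φ (not_lt.1 hn))
  rw [← not_lt, one_lt_level_iff (by linarith) (by linarith), not_lt] at h2 h5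
  rw [one_lt_level_iff (by linarith) (by linarith)] at h
  exact not_le.2 h (dist2_le_of_mem (ups_le_ups (by positivity) e2) (ups_le_ups (by positivity) e1)
    h5 h2)

theorem one_lt_level_negative {σ : ℝ} (h : 1 / 100 < Real.exp (2 * σ)) :
    1 < level (polar σ Real.pi) := by
  rcases le_or_gt (Real.exp (2 * σ)) (1 / 9) with h1 | h1
  · exact one_lt_level_inner _ h h1
  rcases le_or_gt 9 (Real.exp (2 * σ)) with h2 | h2
  · exact one_lt_level_of_nine_le _ h2
  · rw [one_lt_level_iff h1.le h2.le]
    exact dist2_gt_of_cos_le (abs_lt.1 (abs_ups_lt h1 h2)).1.le (by rw [Real.cos_pi]; norm_num)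

/-- The part of the parameter plane outside the ball is connected: it consists of the disc
`‖s‖ ≥ 3`, the annulus `1 / 10 < ‖s‖ ≤ 1 / 3`, the negative ray, which joins them, and radial
segments, which end in one of them. -/
theorem isConnected_outside : IsConnected {s | 1 < level s} := by
  have hl9 : ∀ σ : ℝ, Real.log 9 / 2 ≤ σ → 9 ≤ Real.exp (2 * σ) := fun σ h => by
    rw [← Real.log_le_iff_le_exp (by norm_num)]
    linarith
  have hl100 : ∀ σ : ℝ, Real.log (1 / 100) / 2 < σ ↔ 1 / 100 < Real.exp (2 * σ) := fun σ => by
    rw [← Real.log_lt_iff_lt_exp (by norm_num)]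
    constructor <;> intro h <;> linarith
  set P : ℝ × ℝ → ℂ := fun p => polar p.1 p.2 with hP
  set c := Real.log (1 / 100) / 2
  set d := Real.log 9 / 2
  set e := Real.log (1 / 9) / 2
  have hle9 : ∀ σ : ℝ, σ ≤ e → Real.exp (2 * σ) ≤ 1 / 9 := fun σ h => by
    rw [← Real.le_log_iff_exp_le (by norm_num)]
    change σ ≤ Real.log (1 / 9) / 2 at h
    linarith
  have hce : c < e := by
    have := Real.log_lt_log (by norm_num) (by norm_num : (1 / 100 : ℝ) < 1 / 9)
    change _ / 2 < _ / 2
    linarith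
  have hcd : c < d := by
    have := Real.log_lt_log (by norm_num) (by norm_num : (1 / 100 : ℝ) < 9)
    change _ / 2 < _ / 2
    linarith
  set O := P '' (Ici d ×ˢ univ)
  set N := P '' (Ioc c e ×ˢ univ)
  set R := P '' (Ioi c ×ˢ {Real.pi})
  have hOc : IsPreconnected O := isPreconnected_polar_image isPreconnected_Ici isPreconnected_univ
  have hNc : IsPreconnected N := isPreconnected_polar_image isPreconnected_Ioc isPreconnected_univ
  have hRc : IsPreconnected R :=
    isPreconnected_polar_image isPreconnected_Ioi isPreconnected_singleton
  have hO : O ⊆ {s | 1 < level s} := by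
    rintro _ ⟨⟨σ, φ⟩, ⟨h1, -⟩, rfl⟩
    exact one_lt_level_of_nine_le φ (hl9 σ h1)
  have hN : N ⊆ {s | 1 < level s} := by
    rintro _ ⟨⟨σ, φ⟩, ⟨h1, -⟩, rfl⟩
    exact one_lt_level_inner φ ((hl100 σ).1 h1.1) (hle9 σ h1.2)
  have hR : R ⊆ {s | 1 < level s} := by
    rintro _ ⟨⟨σ, φ⟩, ⟨h1, h2⟩, rfl⟩
    rw [mem_singleton_iff] at h2
    subst h2
    exact one_lt_level_negative ((hl100 σ).1 h1)
  have hdO : P (d, Real.pi) ∈ O := ⟨_, ⟨mem_Ici.2 le_rfl, mem_univ _⟩, rfl⟩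
  have hdR : P (d, Real.pi) ∈ R := ⟨(d, Real.pi), ⟨mem_Ioi.2 hcd, mem_singleton _⟩, rfl⟩
  have heR : P (e, Real.pi) ∈ R := ⟨(e, Real.pi), ⟨mem_Ioi.2 hce, mem_singleton _⟩, rfl⟩
  have heN : P (e, Real.pi) ∈ N := ⟨_, ⟨⟨hce, le_rfl⟩, mem_univ _⟩, rfl⟩
  have hB : IsPreconnected (O ∪ R ∪ N) :=
    (hOc.union _ hdO hdR hRc).union _ (Or.inr heR) heN hNc
  have hBs : O ∪ R ∪ N ⊆ {s | 1 < level s} := union_subset (union_subset hO hR) hN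
  refine ⟨⟨_, hO hdO⟩, isPreconnected_of_forall (P (d, Real.pi)) fun s hs => ?_⟩
  have hs0 : s ≠ 0 := fun h => by
    rw [h, mem_ofPred_eq, level_zero] at hs
    norm_num at hs
  obtain ⟨σ, φ, -, rfl⟩ := exists_polar hs0
  have hcσ : c < σ := by
    rw [hl100]
    by_contra hn
    have h1 : Real.exp (2 * σ) ≤ 1 / 100 := not_lt.1 hn
    rw [mem_ofPred_eq, level_polar_of_le φ (by linarith)] at hs
    have := Real.exp_pos (2 * σ)
    nlinarith
  rcases radius_subset hs with h | h
  · refine ⟨P '' (Ici σ ×ˢ {φ}) ∪ (O ∪ R ∪ N), union_subset ?_ hBs, Or.inr (Or.inl (Or.inl hdO)),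
      Or.inl ⟨(σ, φ), ⟨mem_Ici.2 le_rfl, rfl⟩, rfl⟩, ?_⟩
    · rintro _ ⟨⟨τ, ψ⟩, ⟨h1, h2⟩, rfl⟩
      rw [mem_singleton_iff] at h2
      subst h2
      exact h τ h1
    · refine (isPreconnected_polar_image isPreconnected_Ici isPreconnected_singleton).union
        (P (max σ d, φ)) ⟨(max σ d, φ), ⟨mem_Ici.2 (le_max_left _ _), rfl⟩, rfl⟩
        (Or.inl (Or.inl ⟨(max σ d, φ), ⟨mem_Ici.2 (le_max_right _ _), mem_univ _⟩, rfl⟩)) hB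
  · refine ⟨P '' (Ioc c σ ×ˢ {φ}) ∪ (O ∪ R ∪ N), union_subset ?_ hBs, Or.inr (Or.inl (Or.inl hdO)),
      Or.inl ⟨(σ, φ), ⟨⟨hcσ, le_rfl⟩, rfl⟩, rfl⟩, ?_⟩
    · rintro _ ⟨⟨τ, ψ⟩, ⟨h1, h2⟩, rfl⟩
      rw [mem_singleton_iff] at h2
      subst h2
      exact h τ h1.2 ((hl100 τ).1 h1.1)
    · refine (isPreconnected_polar_image isPreconnected_Ioc isPreconnected_singleton).union
        (P (min σ e, φ)) ⟨(min σ e, φ), ⟨⟨lt_min hcσ hce, min_le_left _ _⟩, rfl⟩, rfl⟩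
        (Or.inr ⟨(min σ e, φ), ⟨⟨lt_min hcσ hce, min_le_right _ _⟩, mem_univ _⟩, rfl⟩) hB

theorem continuous_cubicMap : Continuous cubicMap := by
  unfold cubicMap
  fun_prop

theorem realizesStrongly_nodalCubic : RealizesStrongly nodalCubic (ballMap '' D4) link512 := by
  refine ⟨totalDegree_nodalCubic, ⟨ballMap, isBallParam_ballMap, transverseToBoundary_ballMap,
    isConeLink_cut.toLink, isCutLink_toLink, isotopic_cut_link512⟩, ?_⟩
  rw [zeroSet_diff_ball]
  exact isConnected_outside.image _ continuous_cubicMap.continuousOn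

end FancyBall

end

open FancyBall in
theorem proposition6p3 :
    IsStrongCBoundary link512 ∧
      ∃ B : Set (ℂ × ℂ), RealizesStrongly nodalCubic B link512 :=
  ⟨⟨nodalCubic, ballMap '' D4, realizesStrongly_nodalCubic⟩, ballMap '' D4,
    realizesStrongly_nodalCubic⟩
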